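/- Let $d\ge 2$. A quantum channel on $\mathbb M_d$ (not necessarily trace-preserving) is a map $\mathcal E(\rho)=\sum_i E_i\rho E_i^\dagger$ with $\sum_i E_i^\dagger E_i\le I$. Let $\psi=U|0\rangle\langle 0|U^\dagger$ and $\phi=U|1\rangle\langle 1|U^\dagger$ with $U$ a Haar-random $d\times d$ unitary. Let $\mathcal E'$ be the linear map with $\mathcal E'(X)=\mathcal E(X)-\frac{\operatorname{tr}\mathcal E(X)}{d}I$ for traceless $X$ and $\mathcal E'(I)=0$. Define the alternative unitarity $$\mathfrak u'(\mathcal E)=\frac{d}{d-1}\,\mathbb E_\psi\operatorname{tr}\left[\mathcal E'(\psi)^\dagger\mathcal E'(\psi)\right],$$ and $$\mathfrak p(\mathcal E)=\mathbb E_\psi\operatorname{tr}[\mathcal E(\psi)^2],\qquad \mathfrak o(\mathcal E)=\mathbb E_{\psi,\phi}\operatorname{tr}[\mathcal E(\phi)\mathcal E(\psi)],\qquad \mathfrak s(\mathcal E)=\mathbb E_{\psi,W}\operatorname{tr}[\mathcal E(\psi)\,W\mathcal E(\psi)W^\dagger],\qquad \mathfrak t(\mathcal E)=\operatorname{tr}\mathcal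 E(I/d),$$ where $W$ is an independent Haar-random unitary. Let $\mathfrak u(\mathcal E)=\operatorname{tr}(\mathfrak J(\mathcal E)^2)$, where $\mathfrak J(\mathcal E)=(\mathcal E\otimes\mathcal I)(|\Phi\rangle\langle\Phi|)$ and $|\Phi\rangle=d^{-1/2}\sum_i|i\rangle|i\rangle$. An algorithm with coherent access prepares a state of the main system and an ancilla, interleaves calls to $\mathcal E\otimes\mathcal I_{\rm anc}$ with arbitrary quantum channels (which may use a finite classical memory, not counted in the ancilla), and finally measures a POVM. An algorithm with incoherent access repeats the following, each choice possibly depending on earlier outcomes: prepare a state on the main system and an ancilla, call $\mathcal E\otimes\mathcal I_{\rm anc}$ once, and measure a POVM completely; it is non-adaptive if inputs and POVMs do not depend on earlier outcomes. Classical randomness is allowed. If $\mathcal E$ is not trace-preserving, the missing trace is the probability of a visible failure of the call. An algorithm estimates $\mathfrak u'$ to precision $\epsilon$ if, for every quantum channel $\mathcal E$ on $\mathbb M_d$, it outputs a value within $\epsilon$ of $\mathfrak u'(\mathcal E)$ with probability at least $2/3$. All constants below are universal (independent of $d$, $\epsilon$ and $\mathcal E$). 1. (Identity) For every quantum channel $\mathcal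 E$, $$\mathfrak u'(\mathcal E)=\mathfrak p(\mathcal E)-\mathfrak o(\mathcal E)-\frac{d}{d-1}\mathfrak s(\mathcal E)+\frac1{d-1}\mathfrak t(\mathcal E)^2.$$ 2. (Upper bounds) For all $d\ge2$ and $0<\epsilon\le 1$ there is an algorithm with coherent access that estimates $\mathfrak u'$ to precision $\epsilon$ using $O(\epsilon^{-2})$ calls to $\mathcal E$ and an $O(d)$-dimensional ancilla, and a non-adaptive algorithm with incoherent access and no ancilla that does so using $O(\sqrt d\,\epsilon^{-2})$ calls. 3. (Reductions) For the completely depolarizing channel $\mathcal D(\rho)=\operatorname{tr}(\rho)I/d$ and every unitary channel $\mathcal U$, $\mathfrak u'(\mathcal D)=0$ and $\mathfrak u'(\mathcal U)=1$. For $0<\epsilon\le\frac13$, let $\mathcal E_1=\frac23\mathcal I+\frac13\mathcal X$ and $\mathcal E_2=(\frac23+\epsilon)\mathcal I+(\frac13-\epsilon)\mathcal X$, where $\mathcal X(\rho)=X\rho X^\dagger$ and $X|i\rangle=|i+1 \bmod d\rangle$. Then $$\mathfrak u'(\mathcal E_2)-\mathfrak u'(\mathcal E_1)=\frac{d^2}{d^2-1}\left(\mathfrak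 u(\mathcal E_2)-\mathfrak u(\mathcal E_1)\right)\ge\tfrac23\epsilon .$$ 4. (Lower bounds) For all $d\ge2$ and $0<\epsilon<\frac12$, every algorithm with coherent access that estimates $\mathfrak u'$ to precision $\epsilon$ makes $\Omega(\epsilon^{-2})$ calls to $\mathcal E$, whatever the size of its ancilla; and every algorithm with incoherent access that does so makes $\Omega(\sqrt d+\epsilon^{-2})$ calls, even if adaptive strategies and ancillas of any size are allowed. -/

import Mathlib

open scoped Matrix ComplexOrder
open MeasureTheory

noncomputable section

namespace UnitarityEstimation

/-! ### Operators and quantum channels -/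

/-- Operators on the Hilbert space with orthonormal basis indexed by `n`. -/
abbrev Op (n : Type) : Type := Matrix n n ℂ

/-- Completely positive maps, in Kraus form. -/
def IsCP {m n : Type} [Fintype m] (Φ : Op m →ₗ[ℂ] Op n) : Prop :=
  ∃ (r : ℕ) (K : Fin r → Matrix n m ℂ), ∀ X : Op m, Φ X = ∑ i, K i * X * (K i)ᴴ

/-- Quantum channels on a `d`-dimensional system, not necessarily trace-preserving:
`ρ ↦ ∑ i, Kᵢ ρ Kᵢ†` with `∑ i, Kᵢ† Kᵢ ≤ I`. -/
def IsChannel {d : ℕ} (E : Op (Fin d) →ₗ[ℂ] Op (Fin d)) : Prop :=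
  ∃ (r : ℕ) (K : Fin r → Op (Fin d)),
    (1 - ∑ i, (K i)ᴴ * K i).PosSemidef ∧ ∀ X, E X = ∑ i, K i * X * (K i)ᴴ

/-- `Φ ⊗ id` on a system extended by an ancilla with basis `a`. -/
def amplify {m n : Type} (a : Type) (Φ : Op m →ₗ[ℂ] Op n) : Op (m × a) →ₗ[ℂ] Op (n × a) where
  toFun M := Matrix.of fun p q => Φ (Matrix.of fun i j => M (i, p.2) (j, q.2)) p.1 q.1
  map_add' M N := by
    ext p q
    exact congrFun (congrFun (Φ.map_add (Matrix.of fun i j => M (i, p.2) (j, q.2))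
      (Matrix.of fun i j => N (i, p.2) (j, q.2))) p.1) q.1
  map_smul' c M := by
    ext p q
    exact congrFun (congrFun (Φ.map_smul c (Matrix.of fun i j => M (i, p.2) (j, q.2))) p.1) q.1

/-- The trace-preserving extension of a possibly trace-decreasing channel: the missing trace is
put on one additional basis state `none`, which signals the failure `⊥`. On a trace-preserving
channel the failure never occurs. -/
def withFailure {d : ℕ} (E : Op (Fin d) →ₗ[ℂ] Op (Fin d)) :
    Op (Fin d) →ₗ[ℂ] Op (Option (Fin d)) where
  toFun X := Matrix.of fun p q =>
    match p, q with
    | some i, some j => E X i j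
    | none, none => X.trace - (E X).trace
    | _, _ => 0
  map_add' X Y := by
    ext p q
    rcases p with _ | i <;> rcases q with _ | j <;> simp [Matrix.trace_add]
    ring
  map_smul' c X := by
    ext p q
    rcases p with _ | i <;> rcases q with _ | j <;> simp [Matrix.trace_smul]
    ring

/-- The map `X ↦ A X A†`. -/
def conjMap {d : ℕ} (A : Op (Fin d)) : Op (Fin d) →ₗ[ℂ] Op (Fin d) where
  toFun X := A * X * Aᴴ
  map_add' X Y := by simp [mul_add, add_mul]
  map_smul' c X := by simp

/-- The completely depolarizing channel `ρ ↦ tr(ρ) I / d`. -/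
def depolarizing (d : ℕ) : Op (Fin d) →ₗ[ℂ] Op (Fin d) where
  toFun X := (X.trace / d) • (1 : Op (Fin d))
  map_add' X Y := by simp [Matrix.trace_add, add_div, add_smul]
  map_smul' c X := by simp [Matrix.trace_smul, mul_div_assoc, mul_smul]

/-- The cyclic shift `|j⟩ ↦ |j + 1 mod d⟩`. -/
def shift (d : ℕ) [NeZero d] : Op (Fin d) :=
  Matrix.of fun i j => if i = j + 1 then 1 else 0

/-- The map `a ℐ + b 𝒳`, where `𝒳` is the unitary channel of the cyclic shift. -/
def shiftMixture (d : ℕ) [NeZero d] (a b : ℝ) : Op (Fin d) →ₗ[ℂ] Op (Fin d) :=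
  (a : ℂ) • LinearMap.id + (b : ℂ) • conjMap (shift d)

/-! ### Haar measure on the unitary group -/

/-- The group of `d × d` unitary matrices. -/
abbrev U (d : ℕ) : Type := Matrix.unitaryGroup (Fin d) ℂ

instance (d : ℕ) : CompactSpace (U d) := by
  have hcl : IsClosed (Matrix.unitaryGroup (Fin d) ℂ : Set (Op (Fin d))) :=
    isClosed_unitary (R := Op (Fin d))
  have hcpt : IsCompact (Set.pi Set.univ fun _ : Fin d => Set.pi Set.univ
      fun _ : Fin d => Metric.closedBall (0 : ℂ) 1) :=
    isCompact_univ_pi fun _ => isCompact_univ_pi fun _ => isCompact_closedBall 0 1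
  refine isCompact_iff_compactSpace.mp (hcpt.of_isClosed_subset hcl ?_)
  intro M hM i _ j _
  simpa using entry_norm_bound_of_unitary hM i j

instance (d : ℕ) : MeasurableSpace (U d) := borel _

instance (d : ℕ) : BorelSpace (U d) := ⟨rfl⟩

/-- The Haar probability measure on the unitary group. -/
def haar (d : ℕ) : Measure (U d) := Measure.haarMeasure ⊤

/-- The pure state `U|i⟩⟨i|U†`. -/
def pureState {d : ℕ} (V : U d) (i : Fin d) : Op (Fin d) :=
  (V : Op (Fin d)) * Matrix.single i i 1 * (V : Op (Fin d))ᴴ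

/-! ### Unitarity and related quantities -/

/-- The Jamiołkowski state `(E ⊗ id)(|Φ⟩⟨Φ|)`, where `|Φ⟩ = d^{-1/2} ∑ i, |i⟩|i⟩`. -/
def jamiolkowski {d : ℕ} (E : Op (Fin d) →ₗ[ℂ] Op (Fin d)) : Op (Fin d × Fin d) :=
  amplify (Fin d) E
    (Matrix.of fun p q => if p.1 = p.2 ∧ q.1 = q.2 then 1 / (d : ℂ) else 0)

/-- The unitarity `𝔲`: the purity of the Jamiołkowski state. -/
def unitarity {d : ℕ} (E : Op (Fin d) →ₗ[ℂ] Op (Fin d)) : ℝ :=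
  (jamiolkowski E * jamiolkowski E).trace.re

/-- `X ↦ X - (tr X / d) I`. -/
def tracelessPart (d : ℕ) : Op (Fin d) →ₗ[ℂ] Op (Fin d) :=
  LinearMap.id - depolarizing d

/-- The linear map `E'` with `E'(X) = E(X) - (tr E(X) / d) I` for traceless `X` and
`E'(I) = 0`. -/
def primed {d : ℕ} (E : Op (Fin d) →ₗ[ℂ] Op (Fin d)) : Op (Fin d) →ₗ[ℂ] Op (Fin d) :=
  tracelessPart d ∘ₗ E ∘ₗ tracelessPart d

theorem primed_of_trace_eq_zero {d : ℕ} (E : Op (Fin d) →ₗ[ℂ] Op (Fin d)) (X : Op (Fin d))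
    (hX : X.trace = 0) : primed E X = E X - ((E X).trace / d) • (1 : Op (Fin d)) := by
  simp [primed, tracelessPart, depolarizing, hX]

theorem primed_one {d : ℕ} [NeZero d] (E : Op (Fin d) →ₗ[ℂ] Op (Fin d)) : primed E 1 = 0 := by
  have h : (d : ℂ) ≠ 0 := Nat.cast_ne_zero.mpr (NeZero.ne d)
  simp [primed, tracelessPart, depolarizing, h]

/-- The alternative unitarity `𝔲'(E) = d/(d-1) ∫ tr[E'(ψ)† E'(ψ)] dψ`. -/
def altUnitarity {d : ℕ} [NeZero d] (E : Op (Fin d) →ₗ[ℂ] Op (Fin d)) : ℝ :=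
  (d : ℝ) / (d - 1) *
    ∫ V, ((primed E (pureState V 0))ᴴ * primed E (pureState V 0)).trace.re ∂(haar d)

/-- The purity-preservation index `𝔭`. -/
def purityIndex {d : ℕ} [NeZero d] (E : Op (Fin d) →ₗ[ℂ] Op (Fin d)) : ℝ :=
  ∫ V, (E (pureState V 0) * E (pureState V 0)).trace.re ∂(haar d)

/-- The orthogonality-preservation index `𝔬`. -/
def orthogonalityIndex {d : ℕ} [NeZero d] (E : Op (Fin d) →ₗ[ℂ] Op (Fin d)) : ℝ :=
  ∫ V, (E (pureState V 1) * E (pureState V 0)).trace.re ∂(haar d)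

/-- `𝔰(E)`: the average, over independent Haar-random `V` and `W`, of
`tr[E(ψ) · W E(ψ) W†]` with `ψ = V|0⟩⟨0|V†`. -/
def sIndex {d : ℕ} [NeZero d] (E : Op (Fin d) →ₗ[ℂ] Op (Fin d)) : ℝ :=
  ∫ V, ∫ W, ((E (pureState V 0))ᴴ *
    conjMap (W : Op (Fin d)) (E (pureState V 0))).trace.re ∂(haar d) ∂(haar d)

/-- The trace-preservation index `𝔱(E) = tr E(I/d)`. -/
def traceIndex {d : ℕ} (E : Op (Fin d) →ₗ[ℂ] Op (Fin d)) : ℝ :=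
  (E ((1 / (d : ℂ)) • (1 : Op (Fin d)))).trace.re

/-! ### Algorithms with access to an unknown channel

Both kinds of algorithms may use classical randomness: a random seed is drawn first, and all
choices may depend on it. All measurements have finitely many outcomes. -/

/-- An algorithm with coherent access on `ℂ^d ⊗ ℂ^anc`. It keeps a quantum state together with a
finite classical memory; the unnormalized state `ρ k` is the part of the state on which the memory
is `k`. It starts in the state `init`; then, for `t = 0, …, calls - 1`, it applies an arbitrary
quantum channel to system, ancilla and memory (the quantum instrument `step t`) followed by one
call to the unknown channel on the main system; finally it measures a POVM and outputs a real
number. The basis state `none` of the main system signals a failed call. Without memory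
(`Mem` a one-point type) this is a circuit of channels interleaved with calls. -/
structure CoherentAlgorithm (d : ℕ) where
  /-- Number of calls to the unknown channel. -/
  calls : ℕ
  /-- Dimension of the ancilla system. -/
  anc : ℕ
  Mem : Type
  [memFintype : Fintype Mem]
  Out : Type
  [outFintype : Fintype Out]
  Seed : Type
  [seedSpace : MeasurableSpace Seed]
  law : Measure Seed
  [lawProb : IsProbabilityMeasure law]
  init : Seed → Mem → Op (Option (Fin d) × Fin anc)
  init_pos : ∀ ω k, (init ω k).PosSemidef
  init_trace : ∀ ω, ∑ k, (init ω k).trace = 1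
  init_meas : ∀ k p q, Measurable fun ω => init ω k p q
  step : Seed → ℕ → Mem → Mem → (Op (Option (Fin d) × Fin anc) →ₗ[ℂ] Op (Fin d × Fin anc))
  step_cp : ∀ ω t k k', IsCP (step ω t k k')
  step_trace : ∀ ω t k X, ∑ k', (step ω t k k' X).trace = X.trace
  step_meas : ∀ t k k' X p q, Measurable fun ω => step ω t k k' X p q
  povm : Seed → Mem → Out → Op (Option (Fin d) × Fin anc)
  povm_pos : ∀ ω k v, (povm ω k v).PosSemidef
  povm_sum : ∀ ω k, ∑ v, povm ω k v = 1
  povm_meas : ∀ k v p q, Measurable fun ω => povm ω k v p q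
  /-- The estimate returned on memory content `k` and final outcome `v`. -/
  value : Seed → Mem → Out → ℝ
  value_meas : ∀ k v, Measurable fun ω => value ω k v

attribute [instance] CoherentAlgorithm.memFintype CoherentAlgorithm.outFintype
  CoherentAlgorithm.seedSpace CoherentAlgorithm.lawProb

namespace CoherentAlgorithm

variable {d : ℕ}

/-- The state after `t` calls to `E`. -/
def state (A : CoherentAlgorithm d) (E : Op (Fin d) →ₗ[ℂ] Op (Fin d)) (ω : A.Seed) :
    ℕ → A.Mem → Op (Option (Fin d) × Fin A.anc)
  | 0 => A.init ω
  | t + 1 => fun k' =>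
      amplify (Fin A.anc) (withFailure E) (∑ k, A.step ω t k k' (A.state E ω t k))

/-- The probability of ending with memory content `k` and final outcome `v`, given the seed. -/
def prob (A : CoherentAlgorithm d) (E : Op (Fin d) →ₗ[ℂ] Op (Fin d)) (ω : A.Seed)
    (k : A.Mem) (v : A.Out) : ℝ :=
  (A.povm ω k v * A.state E ω A.calls k).trace.re

/-- The probability that the output is within `ε` of `x` when the unknown channel is `E`. -/
def successProb (A : CoherentAlgorithm d) (E : Op (Fin d) →ₗ[ℂ] Op (Fin d)) (x ε : ℝ) : ℝ :=
  ∫ ω, ∑ k, ∑ v, (if |A.value ω k v - x| ≤ ε then A.prob E ω k v else 0) ∂A.law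

/-- The algorithm estimates `f(E)` to precision `ε` with success probability at least `2/3`, for
every quantum channel `E` on a `d`-dimensional system. -/
def Estimates (A : CoherentAlgorithm d) (f : (Op (Fin d) →ₗ[ℂ] Op (Fin d)) → ℝ) (ε : ℝ) : Prop :=
  ∀ E, IsChannel E → 2 / 3 ≤ A.successProb E (f E) ε

end CoherentAlgorithm

/-- An algorithm with incoherent access: in round `t = 0, …, calls - 1`, depending on the previous
outcomes `h : Fin t → Out`, it prepares a state on `ℂ^d ⊗ ℂ^anc`, calls the unknown channel once
on the main system, and measures a POVM, recording only the outcome. After the last round a real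
number is computed from all outcomes. The basis state `none` of the main system signals a failed
call. -/
structure IncoherentAlgorithm (d : ℕ) where
  /-- Number of calls to the unknown channel. -/
  calls : ℕ
  /-- Dimension of the ancilla system. -/
  anc : ℕ
  Out : Type
  [outFintype : Fintype Out]
  Seed : Type
  [seedSpace : MeasurableSpace Seed]
  law : Measure Seed
  [lawProb : IsProbabilityMeasure law]
  input : Seed → (t : ℕ) → (Fin t → Out) → Op (Fin d × Fin anc)
  input_pos : ∀ ω t h, (input ω t h).PosSemidef
  input_trace : ∀ ω t h, (input ω t h).trace = 1
  input_meas : ∀ t h p q, Measurable fun ω => input ω t h p q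
  povm : Seed → (t : ℕ) → (Fin t → Out) → Out → Op (Option (Fin d) × Fin anc)
  povm_pos : ∀ ω t h v, (povm ω t h v).PosSemidef
  povm_sum : ∀ ω t h, ∑ v, povm ω t h v = 1
  povm_meas : ∀ t h v p q, Measurable fun ω => povm ω t h v p q
  /-- The estimate computed from all outcomes. -/
  value : Seed → (Fin calls → Out) → ℝ
  value_meas : ∀ h, Measurable fun ω => value ω h

attribute [instance] IncoherentAlgorithm.outFintype
  IncoherentAlgorithm.seedSpace IncoherentAlgorithm.lawProb

namespace IncoherentAlgorithm

variable {d : ℕ}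

/-- The outcomes of the rounds before round `t`. -/
def past (A : IncoherentAlgorithm d) (h : Fin A.calls → A.Out) (t : Fin A.calls) :
    Fin (t : ℕ) → A.Out :=
  fun s => h ⟨s, s.isLt.trans t.isLt⟩

/-- The probability of the sequence of outcomes `h`, given the seed. -/
def prob (A : IncoherentAlgorithm d) (E : Op (Fin d) →ₗ[ℂ] Op (Fin d)) (ω : A.Seed)
    (h : Fin A.calls → A.Out) : ℝ :=
  ∏ t : Fin A.calls, (A.povm ω t (A.past h t) (h t) *
    amplify (Fin A.anc) (withFailure E) (A.input ω t (A.past h t))).trace.re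

/-- The probability that the output is within `ε` of `x` when the unknown channel is `E`. -/
def successProb (A : IncoherentAlgorithm d) (E : Op (Fin d) →ₗ[ℂ] Op (Fin d)) (x ε : ℝ) : ℝ :=
  ∫ ω, ∑ h : Fin A.calls → A.Out, (if |A.value ω h - x| ≤ ε then A.prob E ω h else 0) ∂A.law

/-- The algorithm estimates `f(E)` to precision `ε` with success probability at least `2/3`, for
every quantum channel `E` on a `d`-dimensional system. -/
def Estimates (A : IncoherentAlgorithm d) (f : (Op (Fin d) →ₗ[ℂ] Op (Fin d)) → ℝ) (ε : ℝ) : Prop :=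
  ∀ E, IsChannel E → 2 / 3 ≤ A.successProb E (f E) ε

/-- The inputs and measurements do not depend on previous outcomes. -/
def NonAdaptive (A : IncoherentAlgorithm d) : Prop :=
  ∀ ω t h h', A.input ω t h = A.input ω t h' ∧ A.povm ω t h = A.povm ω t h'

end IncoherentAlgorithm

end UnitarityEstimation

end

open scoped Matrix ComplexOrder
open MeasureTheory

noncomputable section

namespace UnitarityEstimation

/-! ### The Haar measure on the unitary group -/

/-! Identity. Left invariance of the Haar measure makes the moment matrices of a random unitary
commute with all tensor powers of unitaries, hence with their derivatives. The resulting linear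
relations determine the moments of order one and two. The average of a bilinear form `β` over a
Haar-random state, or over two orthogonal ones, is therefore a combination of `β 1 1` and `swapSum β
= ∑ β(Eᵢⱼ, Eⱼᵢ)` (`integral_bilin_pureState`). Every quantity in the identity is expressed by these
two invariants of the forms `tr[E(X) E(Y)]` and `tr E(X) tr E(Y)`; what remains is algebra.

Upper bounds. Both algorithms average unbiased estimators of bounded variance and conclude by
Chebyshev's inequality. With coherent access, the two halves of a normalized symmetric or
antisymmetric projection pass through the channel and are compared by a swap test. The difference of
the two inputs is proportional to the traceless part of the swap operator, so the difference of the
two means is twice the alternative unitarity (`swapMean_sub`). With incoherent access, two random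
orthogonal states are sent through the channel and the outputs are measured in a common random
basis. The centered squared distance of the two outcome distributions, times `(d + 1) / 2`, has the
right mean (`integral_groupMean`). It is estimated by a bilinear statistic of samples of size about
`√d`. Its variance stays bounded because outcome probabilities in a random basis have fourth moments
of order `d⁻⁴`, which follows from the eighth moment of a matrix element.

Lower bound in the precision. A mixture of two unitary channels amounts to biased coins tossed
before each call. The `χ²` divergence of coins with biases `2/3 + 4ε` and `2/3` is of order `ε²` and
multiplies over the calls, whatever the strategy (`mixSum_sq_le`, `accept_mix_le`).

Lower bound in the dimension. A random unitary channel must be told apart from the depolarizing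
channel. A sequence of outcomes has probability `∑ ∏ |⟨Bₜ, V⟩|²` for the unitary `V` and `∑ ∏ ‖Bₜ‖²
/ d` for the depolarizing channel, with the same linear forms `Bₜ`. A one-sided comparison suffices:
`d (d + 1) ⋯ (d + T - 1) · 𝔼 ∏ |⟨Bₜ, V⟩|² ≥ ∏ ‖Bₜ‖²` (`prod_le_integral_prod_linear`). The
likelihood ratio is then at least `exp(-T² / d)`, so `T` must be of order `√d`.

This inequality compares two norms of `g = ∏ ⟨Bₜ, ·⟩`. The Fischer norm, which sums the squares of
all `T`-fold derivatives, is at least `T! ∏ ‖Bₜ‖²`. Conversely, on the unitary group the squared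
gradient of a form of degree `k` is the Casimir element in disguise, whose eigenvalues are at most
`k (d + k - 1)`. Thus differentiating `T` times costs at most `T! · d (d + 1) ⋯ (d + T - 1)` in the
`L²` norm, and the factorials cancel. -/

instance (d : ℕ) : SecondCountableTopology (U d) :=
  haveI : SecondCountableTopology (Op (Fin d)) :=
    inferInstanceAs (SecondCountableTopology (Fin d → Fin d → ℂ))
  TopologicalSpace.Subtype.secondCountableTopology _

instance (d : ℕ) : TopologicalSpace.MetrizableSpace (U d) :=
  haveI : TopologicalSpace.MetrizableSpace (Op (Fin d)) :=
    inferInstanceAs (TopologicalSpace.MetrizableSpace (Fin d → Fin d → ℂ))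
  inferInstance

instance (d : ℕ) : IsProbabilityMeasure (haar d) :=
  ⟨by
    have h := Measure.haarMeasure_self (G := U d) (K₀ := ⊤)
    simpa [haar] using h⟩

instance (d : ℕ) : (haar d).IsMulLeftInvariant := by
  unfold haar
  infer_instance

@[fun_prop]
theorem continuous_unitary_entry {d : ℕ} (i j : Fin d) :
    Continuous fun V : U d => (V : Op (Fin d)) i j :=
  continuous_subtype_val.matrix_elem i j

theorem integrable_haar {d : ℕ} {F : Type*} [NormedAddCommGroup F] {f : U d → F}
    (hf : Continuous f) : Integrable f (haar d) :=
  hf.integrable_of_hasCompactSupport (HasCompactSupport.of_compactSpace f)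

theorem integral_haar_mul_left {d : ℕ} {F : Type*} [NormedAddCommGroup F] [NormedSpace ℝ F]
    (f : U d → F) (W : U d) : ∫ V, f (W * V) ∂(haar d) = ∫ V, f V ∂(haar d) :=
  integral_mul_left_eq_self f W

/-! ### Tensor powers -/

/-- The `T`-th tensor power of an operator. -/
def tpow {d : ℕ} (T : ℕ) (W : Op (Fin d)) : Op (Fin T → Fin d) :=
  Matrix.of fun x y => ∏ t, W (x t) (y t)

/-- The derivative at `1` of the tensor power, in direction `X`. -/
def dtpow {d : ℕ} (T : ℕ) : Op (Fin d) →ₗ[ℂ] Op (Fin T → Fin d) where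
  toFun X := Matrix.of fun x y =>
    ∑ t, ∑ k, X (x t) k * (if y = Function.update x t k then 1 else 0)
  map_add' X Y := by
    ext x y
    simp only [Matrix.of_apply, Matrix.add_apply, add_mul, Finset.sum_add_distrib]
  map_smul' c X := by
    ext x y
    simp [Finset.mul_sum]

theorem tpow_mul {d : ℕ} (T : ℕ) (V W : Op (Fin d)) : tpow T (V * W) = tpow T V * tpow T W := by
  ext x y
  simp only [tpow, Matrix.of_apply, Matrix.mul_apply]
  rw [Finset.prod_univ_sum, Fintype.piFinset_univ]
  exact Finset.sum_congr rfl fun z _ => Finset.prod_mul_distrib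

theorem tpow_one {d : ℕ} (T : ℕ) : tpow T (1 : Op (Fin d)) = 1 := by
  ext x y
  simp only [tpow, Matrix.of_apply, Matrix.one_apply]
  by_cases h : x = y
  · simp [h]
  · obtain ⟨t, ht⟩ := Function.ne_iff.mp h
    rw [if_neg h]
    exact Finset.prod_eq_zero (Finset.mem_univ t) (by simp [ht])

theorem tpow_conjTranspose {d : ℕ} (T : ℕ) (W : Op (Fin d)) : tpow T Wᴴ = (tpow T W)ᴴ := by
  ext x y
  simp [tpow, Matrix.conjTranspose_apply]

theorem tpow_transpose {d : ℕ} (T : ℕ) (W : Op (Fin d)) : tpow T Wᵀ = (tpow T W)ᵀ := by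
  ext x y
  simp [tpow]

/-- In the Leibniz rule at the identity all factors but one are Kronecker deltas. Their product says
that `y` agrees with `x` away from `t`, so that only `k = y t` contributes to the sum. -/
theorem prod_erase_one_apply {d T : ℕ} (x y : Fin T → Fin d) (t : Fin T) (f : Fin d → ℂ) :
    (∏ s ∈ Finset.univ.erase t, (1 : Op (Fin d)) (x s) (y s)) * f (y t)
      = ∑ k, f k * (if y = Function.update x t k then 1 else 0) := by
  by_cases h : ∀ s, s ≠ t → x s = y s
  · have hy : ∀ k, y = Function.update x t k ↔ k = y t := by
      intro k
      constructor
      · intro e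
        rw [e]
        simp
      · rintro rfl
        funext s
        by_cases hs : s = t
        · subst hs; simp
        · simp [hs, h s hs]
    rw [Finset.prod_eq_one]
    · simp [hy]
    · intro s hs
      rw [h s (Finset.ne_of_mem_erase hs)]
      exact Matrix.one_apply_eq _
  · push Not at h
    obtain ⟨s, hs, hxy⟩ := h
    rw [Finset.prod_eq_zero (Finset.mem_erase.mpr ⟨hs, Finset.mem_univ s⟩) (by simp [hxy]),
      zero_mul]
    refine (Finset.sum_eq_zero fun k _ => ?_).symm
    rw [if_neg, mul_zero]
    intro e
    apply hxy
    rw [e]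
    simp [hs]

/-- The curve passes through `1` at `s = 0` with velocity `I • v`. It is used because it stays in
the unitary group when `v` is an orthogonal projection. -/
theorem hasDerivAt_tpow {d T : ℕ} (v : Op (Fin d)) (x y : Fin T → Fin d) :
    HasDerivAt (fun s : ℝ => tpow T (1 + (Complex.exp (s * Complex.I) - 1) • v) x y)
      (Complex.I * dtpow T v x y) 0 := by
  have h1 : ∀ a b : Fin d, HasDerivAt
      (fun s : ℝ => (1 + (Complex.exp (s * Complex.I) - 1) • v) a b) (Complex.I * v a b) 0 := by
    intro a b
    have h2 : HasDerivAt (fun s : ℝ => Complex.exp (s * Complex.I)) Complex.I 0 := by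
      have h3 := ((Complex.ofRealCLM.hasDerivAt (x := (0 : ℝ))).mul_const Complex.I).cexp
      simpa using h3
    have h4 := ((h2.sub_const 1).mul_const (v a b)).const_add ((1 : Op (Fin d)) a b)
    simpa [Matrix.add_apply, Matrix.smul_apply] using h4
  have h5 := HasDerivAt.fun_finsetProd (u := (Finset.univ : Finset (Fin T)))
    (fun t _ => h1 (x t) (y t))
  refine h5.congr_deriv ?_
  simp only [dtpow, LinearMap.coe_mk, AddHom.coe_mk, Matrix.of_apply, Finset.mul_sum]
  refine Finset.sum_congr rfl fun t _ => ?_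
  have h6 := prod_erase_one_apply x y t fun k => Complex.I * v (x t) k
  simp only [Complex.ofReal_zero, zero_mul, Complex.exp_zero, sub_self, zero_smul, add_zero,
    smul_eq_mul]
  rw [h6]
  exact Finset.sum_congr rfl fun k _ => by ring

/-- Rotating the phase of one vector. -/
theorem phase_mem_unitaryGroup {d : ℕ} (v : Op (Fin d)) (hv : vᴴ = v) (hvv : v * v = v) (s : ℝ) :
    1 + (Complex.exp (s * Complex.I) - 1) • v ∈ Matrix.unitaryGroup (Fin d) ℂ := by
  rw [Matrix.mem_unitaryGroup_iff, Matrix.star_eq_conjTranspose]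
  have hs : star (Complex.exp (s * Complex.I)) = Complex.exp (-(s * Complex.I)) := by
    rw [Complex.star_def, ← Complex.exp_conj]
    simp
  have hm : Complex.exp (s * Complex.I) * Complex.exp (-(s * Complex.I)) = 1 := by
    rw [← Complex.exp_add]
    simp
  rw [Matrix.conjTranspose_add, Matrix.conjTranspose_smul, hv, Matrix.conjTranspose_one,
    star_sub, star_one, hs]
  rw [add_mul, mul_add, mul_add, smul_mul_smul_comm, hvv]
  simp only [one_mul, mul_one]
  have : ∀ a b : ℂ, a * b = 1 → (1 : Op (Fin d)) + (b - 1) • v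
      + ((a - 1) • v + ((a - 1) * (b - 1)) • v) = 1 := by
    intro a b hab
    rw [add_assoc, ← add_smul, ← add_smul]
    have : b - 1 + (a - 1 + (a - 1) * (b - 1)) = 0 := by linear_combination hab
    rw [this, zero_smul, add_zero]
  exact this _ _ hm

/-- A linear functional that vanishes on the tensor powers of all unitaries vanishes on their
derivatives in all directions. -/
theorem map_dtpow_eq_zero {d T : ℕ} (Λ : Op (Fin T → Fin d) →ₗ[ℂ] ℂ)
    (h : ∀ W : U d, Λ (tpow T W) = 0) (X : Op (Fin d)) : Λ (dtpow T X) = 0 := by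
  have expand : ∀ M, Λ M = ∑ x, ∑ y, M x y * Λ (Matrix.single x y 1) := by
    intro M
    conv_lhs => rw [Matrix.matrix_eq_sum_single M]
    simp only [map_sum]
    refine Finset.sum_congr rfl fun x _ => Finset.sum_congr rfl fun y _ => ?_
    rw [← smul_eq_mul, ← map_smul, Matrix.smul_single, smul_eq_mul, mul_one]
  -- For an orthogonal projection `v` the functional vanishes along the whole curve of phases, so
  -- its derivative at `0` vanishes too.
  have proj : ∀ v : Op (Fin d), vᴴ = v → v * v = v → Λ (dtpow T v) = 0 := by
    intro v hv hvv
    have h1 : HasDerivAt (fun s : ℝ => Λ (tpow T (1 + (Complex.exp (s * Complex.I) - 1) • v)))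
        (∑ x, ∑ y, Complex.I * dtpow T v x y * Λ (Matrix.single x y 1)) 0 := by
      rw [funext fun s : ℝ => expand (tpow T (1 + (Complex.exp (s * Complex.I) - 1) • v))]
      exact HasDerivAt.fun_sum fun x _ => HasDerivAt.fun_sum fun y _ =>
        (hasDerivAt_tpow v x y).mul_const _
    have h2 : (fun s : ℝ => Λ (tpow T (1 + (Complex.exp (s * Complex.I) - 1) • v)))
        = fun _ => 0 := by
      ext s
      exact h ⟨_, phase_mem_unitaryGroup v hv hvv s⟩
    rw [h2] at h1
    have h3 := h1.unique (hasDerivAt_const _ _)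
    simp only [mul_assoc, ← Finset.mul_sum] at h3
    rw [← expand] at h3
    exact (mul_eq_zero.mp h3).resolve_left Complex.I_ne_zero
  -- A nonzero rank-one positive operator is a multiple of a projection, and `dtpow` is linear.
  have rankOne : ∀ w : Fin d → ℂ, Λ (dtpow T (Matrix.vecMulVec w (star w))) = 0 := by
    intro w
    by_cases hw : star w ⬝ᵥ w = 0
    · rw [dotProduct_star_self_eq_zero.mp hw]
      simp
    · have hr : star (star w ⬝ᵥ w) = star w ⬝ᵥ w := (Matrix.star_dotProduct w w).symm
      have h1 := proj ((star w ⬝ᵥ w)⁻¹ • Matrix.vecMulVec w (star w)) ?_ ?_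
      · rw [map_smul, map_smul, smul_eq_mul] at h1
        exact (mul_eq_zero.mp h1).resolve_left (inv_ne_zero hw)
      · rw [Matrix.conjTranspose_smul, star_inv₀, hr, Matrix.conjTranspose_vecMulVec, star_star]
      · rw [smul_mul_smul_comm, Matrix.vecMulVec_mul_vecMulVec, Matrix.vecMulVec_smul, smul_smul]
        congr 1
        field_simp
  -- Polarization. The operators reached in this way include all matrix units, which span.
  have pair : ∀ a b : Fin d → ℂ, Λ (dtpow T (Matrix.vecMulVec a (star b))) = 0 := by
    intro a b
    have h4 : (4 : ℂ) • Matrix.vecMulVec a (star b)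
        = Matrix.vecMulVec (a + b) (star (a + b))
          - Matrix.vecMulVec (a - b) (star (a - b))
          + Complex.I • Matrix.vecMulVec (a + Complex.I • b) (star (a + Complex.I • b))
          - Complex.I • Matrix.vecMulVec (a - Complex.I • b) (star (a - Complex.I • b)) := by
      ext i j
      simp [Matrix.vecMulVec_apply]
      ring_nf
      simp [Complex.I_sq]
      ring
    have h5 := congrArg (fun M => Λ (dtpow T M)) h4
    simp only [map_add, map_sub, map_smul, rankOne, smul_zero, sub_self, add_zero] at h5
    exact (smul_eq_zero.mp h5).resolve_left (by norm_num)
  rw [Matrix.matrix_eq_sum_single X]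
  simp only [map_sum]
  refine Finset.sum_eq_zero fun i _ => Finset.sum_eq_zero fun j _ => ?_
  have h6 := pair (Pi.single i (X i j)) (Pi.single j 1)
  have h7 : Matrix.vecMulVec (Pi.single i (X i j)) (star (Pi.single j (1 : ℂ)))
      = Matrix.single i j (X i j) := by
    ext a b
    rcases eq_or_ne i a with rfl | ha <;> rcases eq_or_ne j b with rfl | hb <;>
      simp [Matrix.vecMulVec_apply, *]
  rwa [h7] at h6

theorem dtpow_mulVec {d T : ℕ} (X : Op (Fin d)) (f : (Fin T → Fin d) → ℂ) (x : Fin T → Fin d) :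
    (dtpow T X *ᵥ f) x = ∑ t, ∑ k, X (x t) k * f (Function.update x t k) := by
  simp only [Matrix.mulVec, dotProduct, dtpow, LinearMap.coe_mk, AddHom.coe_mk, Matrix.of_apply,
    Finset.sum_mul]
  rw [Finset.sum_comm]
  refine Finset.sum_congr rfl fun t _ => ?_
  rw [Finset.sum_comm]
  refine Finset.sum_congr rfl fun k _ => ?_
  simp

theorem update_eq_comm {d T : ℕ} (x y : Fin T → Fin d) (t : Fin T) :
    y = Function.update x t (y t) ↔ x = Function.update y t (x t) := by
  constructor <;>
  · intro h
    funext s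
    by_cases hs : s = t
    · subst hs; simp
    · rw [h]; simp [hs]

theorem dtpow_apply {d T : ℕ} (X : Op (Fin d)) (x y : Fin T → Fin d) : dtpow T X x y
    = ∑ t, X (x t) (y t) * (if y = Function.update x t (y t) then 1 else 0) := by
  simp only [dtpow, LinearMap.coe_mk, AddHom.coe_mk, Matrix.of_apply]
  refine Finset.sum_congr rfl fun t _ => ?_
  refine Finset.sum_eq_single (y t) (fun k _ hk => ?_) (by simp)
  rw [if_neg, mul_zero]
  intro e
  apply hk
  rw [e]
  simp

theorem dtpow_transpose {d T : ℕ} (X : Op (Fin d)) : (dtpow T X)ᵀ = dtpow T Xᵀ := by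
  ext x y
  rw [Matrix.transpose_apply, dtpow_apply, dtpow_apply]
  refine Finset.sum_congr rfl fun t _ => ?_
  simp only [Matrix.transpose_apply, update_eq_comm x y t]

theorem dtpow_conjTranspose {d T : ℕ} (X : Op (Fin d)) : (dtpow T X)ᴴ = dtpow T Xᴴ := by
  ext x y
  rw [Matrix.conjTranspose_apply, dtpow_apply, dtpow_apply, star_sum]
  refine Finset.sum_congr rfl fun t _ => ?_
  simp only [star_mul', Matrix.conjTranspose_apply, update_eq_comm x y t]
  congr 1
  split_ifs <;> simp

/-! ### The Casimir element and its largest eigenvalue. -/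

/-- Exchange of two tensor factors. -/
def tswap (d : ℕ) {T : ℕ} (s t : Fin T) : Op (Fin T → Fin d) :=
  Matrix.of fun x y => if y = x ∘ Equiv.swap s t then 1 else 0

theorem tswap_mulVec {d T : ℕ} (s t : Fin T) (f : (Fin T → Fin d) → ℂ) (x : Fin T → Fin d) :
    (tswap d s t *ᵥ f) x = f (x ∘ Equiv.swap s t) := by
  simp [Matrix.mulVec, dotProduct, tswap]

/-- The Casimir element of the tensor power representation. -/
def casimir (d T : ℕ) : Op (Fin T → Fin d) :=
  ∑ i, ∑ j, dtpow T (Matrix.single j i 1) * dtpow T (Matrix.single i j 1)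

/-- The two derivatives act on positions `s` and `t`. If `s = t`, then `∑ Eⱼᵢ Eᵢⱼ = d`; if `s ≠ t`,
then `∑ Eⱼᵢ ⊗ Eᵢⱼ` is the exchange of the two positions. -/
theorem casimir_eq (d T : ℕ) : casimir d T
    = ((d * T : ℕ) : ℂ) • (1 : Op (Fin T → Fin d))
      + ∑ s : Fin T, ∑ t ∈ Finset.univ.erase s, tswap d s t := by
  refine Matrix.ext_of_mulVec_single fun y => ?_
  generalize (Pi.single y (1 : ℂ) : (Fin T → Fin d) → ℂ) = f
  ext x
  simp only [casimir, Matrix.sum_mulVec, Finset.sum_apply, ← Matrix.mulVec_mulVec, dtpow_mulVec,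
    Matrix.add_mulVec, Pi.add_apply, Matrix.smul_mulVec, Matrix.one_mulVec, Pi.smul_apply,
    tswap_mulVec, Matrix.single_apply, ite_and, ite_mul, one_mul, zero_mul]
  have h1 : ∀ i j : Fin d, ∀ s : Fin T, (∑ k, if j = x s then if i = k then
      ∑ t, ∑ k', (if i = Function.update x s k t then if j = k' then
        f (Function.update (Function.update x s k) t k') else 0 else 0) else 0 else 0)
      = if j = x s then ∑ t, if i = Function.update x s i t then
        f (Function.update (Function.update x s i) t j) else 0 else 0 := by
    intro i j s
    split_ifs <;> simp
  simp only [h1]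
  have h2 : ∀ i : Fin d, (∑ j, ∑ s, if j = x s then ∑ t, if i = Function.update x s i t then
        f (Function.update (Function.update x s i) t j) else 0 else 0)
      = ∑ s, ∑ t, if i = Function.update x s i t then
        f (Function.update (Function.update x s i) t (x s)) else 0 := by
    intro i
    rw [Finset.sum_comm]
    simp
  simp only [h2]
  rw [Finset.sum_comm]
  have h3 : ∀ s : Fin T, (∑ i, ∑ t, if i = Function.update x s i t then
        f (Function.update (Function.update x s i) t (x s)) else 0)
      = d * f x + ∑ t ∈ Finset.univ.erase s, f (x ∘ Equiv.swap s t) := by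
    intro s
    rw [Finset.sum_comm, ← Finset.add_sum_erase _ _ (Finset.mem_univ s)]
    congr 1
    · simp
    · refine Finset.sum_congr rfl fun t ht => ?_
      have hts : t ≠ s := Finset.ne_of_mem_erase ht
      simp only [Function.update_of_ne hts]
      rw [Finset.sum_ite_eq' Finset.univ (x t)]
      simp only [Finset.mem_univ, if_true]
      congr 1
      funext r
      by_cases hr : r = t
      · subst hr; simp
      · by_cases hrs : r = s
        · subst hrs; simp [hr]
        · simp [hr, hrs, Equiv.swap_apply_of_ne_of_ne]
  simp only [h3, Finset.sum_add_distrib]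
  simp
  ring

/-- An exchange `P` is a self-adjoint involution, so `1 - P = (1 - P)ᴴ (1 - P) / 2`. -/
theorem posSemidef_one_sub_tswap {d T : ℕ} (s t : Fin T) : (1 - tswap d s t).PosSemidef := by
  have hh : (tswap d s t)ᴴ = tswap d s t := by
    ext x y
    simp only [tswap, Matrix.conjTranspose_apply, Matrix.of_apply]
    have : x = y ∘ Equiv.swap s t ↔ y = x ∘ Equiv.swap s t := by
      constructor <;> (rintro rfl; ext r; simp)
    simp only [this]
    split_ifs <;> simp
  have hs : tswap d s t * tswap d s t = 1 := by
    refine Matrix.ext_of_mulVec_single fun y => ?_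
    ext x
    rw [← Matrix.mulVec_mulVec, tswap_mulVec, tswap_mulVec, Matrix.one_mulVec]
    congr 1
    ext r
    simp
  have h2 : 1 - tswap d s t = (2⁻¹ : ℂ) • ((1 - tswap d s t)ᴴ * (1 - tswap d s t)) := by
    rw [Matrix.conjTranspose_sub, hh, Matrix.conjTranspose_one, sub_mul, mul_sub, mul_sub, hs]
    ext x y
    simp
    ring
  rw [h2]
  exact (Matrix.posSemidef_conjTranspose_mul_self _).smul (by positivity)

/-- There are `T (T - 1)` exchanges in `casimir_eq`, each at most `1`; together with `d T` this
gives the constant, which is attained on symmetric tensors. -/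
theorem posSemidef_sub_casimir (d T : ℕ) :
    (((T * (d + T - 1) : ℕ) : ℂ) • (1 : Op (Fin T → Fin d)) - casimir d T).PosSemidef := by
  have h : ((T * (d + T - 1) : ℕ) : ℂ) • (1 : Op (Fin T → Fin d)) - casimir d T
      = ∑ s : Fin T, ∑ t ∈ Finset.univ.erase s, (1 - tswap d s t) := by
    rw [casimir_eq]
    simp only [Finset.sum_sub_distrib]
    rw [← sub_sub]
    congr 1
    simp only [Finset.sum_const, Finset.card_erase_of_mem (Finset.mem_univ _), Finset.card_univ,
      Fintype.card_fin, ← sub_smul, smul_smul, ← Nat.cast_smul_eq_nsmul ℂ]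
    congr 1
    -- The natural subtractions in `d + T - 1` and `T - 1` are harmless only for positive `T`; for
    -- `T = 0` both sides are zero.
    rcases T with _ | T
    · simp
    · push_cast
      simp
      ring
  rw [h]
  exact Matrix.posSemidef_sum _ fun s _ => Matrix.posSemidef_sum _ fun t _ =>
    posSemidef_one_sub_tswap s t

/-! ### Polynomials on the unitary group -/

/-- Polynomials in the entries of a matrix. -/
abbrev EntryPoly (d : ℕ) : Type := MvPolynomial (Fin d × Fin d) ℂ

/-- The value of a polynomial at a unitary. -/
def evalU {d : ℕ} (V : U d) : EntryPoly d →ₐ[ℂ] ℂ :=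
  MvPolynomial.aeval fun c => (V : Op (Fin d)) c.1 c.2

@[fun_prop]
theorem continuous_evalU {d : ℕ} (g : EntryPoly d) : Continuous fun V : U d => evalU V g := by
  induction g using MvPolynomial.induction_on with
  | C a => simpa [evalU] using continuous_const
  | add p q hp hq => exact (hp.add hq).congr fun V => (map_add _ _ _).symm
  | mul_X p c hp =>
    simp only [map_mul]
    refine hp.mul ?_
    simpa [evalU] using continuous_unitary_entry c.1 c.2

/-- The `L²` inner product of two polynomials on the unitary group. -/
def haarInner {d : ℕ} (f g : EntryPoly d) : ℂ :=
  ∫ V, star (evalU V f) * evalU V g ∂(haar d)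

/-- The squared `L²` norm of a polynomial on the unitary group. -/
def haarNormSq {d : ℕ} (g : EntryPoly d) : ℝ := ∫ V, ‖evalU V g‖ ^ 2 ∂(haar d)

theorem haarNormSq_nonneg {d : ℕ} (g : EntryPoly d) : 0 ≤ haarNormSq g :=
  integral_nonneg fun _ => by positivity

theorem haarInner_self {d : ℕ} (g : EntryPoly d) : haarInner g g = haarNormSq g := by
  unfold haarInner haarNormSq
  rw [← integral_complex_ofReal]
  congr 1
  ext V
  rw [Complex.star_def, Complex.conj_mul']
  norm_cast

/-- Index set of the monomials of degree `T`. -/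
abbrev Word (d T : ℕ) : Type := (Fin T → Fin d) × (Fin T → Fin d)

/-- The monomial `∏ t, X (x t, y t)`. -/
def wordMono {d T : ℕ} (p : Word d T) : EntryPoly d := ∏ t, MvPolynomial.X (p.1 t, p.2 t)

/-- A linear combination of monomials. -/
def wordPoly {d T : ℕ} (β : Word d T → ℂ) : EntryPoly d := ∑ p, β p • wordMono p

theorem evalU_wordMono {d T : ℕ} (V : U d) (p : Word d T) :
    evalU V (wordMono p) = tpow T (V : Op (Fin d)) p.1 p.2 := by
  simp [evalU, wordMono, tpow]

/-- The Gram matrix of the monomials. -/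
def gram (d T : ℕ) : Op (Word d T) := Matrix.of fun p q => haarInner (wordMono p) (wordMono q)

theorem haarInner_wordPoly {d T : ℕ} (β γ : Word d T → ℂ) :
    haarInner (wordPoly β) (wordPoly γ) = star β ⬝ᵥ (gram d T *ᵥ γ) := by
  simp only [haarInner, wordPoly, gram, dotProduct, Matrix.mulVec, Matrix.of_apply, map_sum,
    star_sum, Finset.sum_mul_sum, map_smul, smul_eq_mul, star_mul', Pi.star_apply]
  rw [integral_finsetSum _ fun p _ => integrable_haar (by fun_prop)]
  refine Finset.sum_congr rfl fun p _ => ?_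
  rw [integral_finsetSum _ fun q _ => integrable_haar (by fun_prop), Finset.mul_sum]
  refine Finset.sum_congr rfl fun q _ => ?_
  rw [← integral_mul_const, ← integral_const_mul]
  congr 1
  ext V
  ring

/-- The matrix need not be definite: words that differ by a permutation of the positions give the
same monomial. -/
theorem posSemidef_gram (d T : ℕ) : (gram d T).PosSemidef := by
  refine Matrix.PosSemidef.of_dotProduct_mulVec_nonneg ?_ fun β => ?_
  · ext p q
    simp only [gram, Matrix.conjTranspose_apply, Matrix.of_apply, haarInner]
    rw [Complex.star_def, ← integral_conj]
    congr 1
    ext V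
    simp [mul_comm]
  · rw [← haarInner_wordPoly, haarInner_self]
    exact_mod_cast haarNormSq_nonneg _

-- Left translation by `Wᵀ` maps the monomial `q` to the polynomial whose coefficients form column
-- `q` of `B`; this is why the transpose appears. Invariance of the Haar measure gives `Bᴴ * gram *
-- B = gram`, and `B` is unitary.
open scoped Kronecker in
theorem commute_gram_tpow {d T : ℕ} (W : U d) :
    gram d T * (tpow T (W : Op (Fin d)) ⊗ₖ 1) = (tpow T (W : Op (Fin d)) ⊗ₖ 1) * gram d T := by
  set B : Op (Word d T) := tpow T (W : Op (Fin d)) ⊗ₖ 1 with hB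
  have hWW : (W : Op (Fin d)) * (W : Op (Fin d))ᴴ = 1 := Matrix.mem_unitaryGroup_iff.mp W.2
  have hBB : B * Bᴴ = 1 := by
    rw [hB, Matrix.conjTranspose_kronecker, ← Matrix.mul_kronecker_mul, ← tpow_conjTranspose,
      ← tpow_mul, hWW, tpow_one]
    simp
  have hW' : (W : Op (Fin d))ᵀ ∈ Matrix.unitaryGroup (Fin d) ℂ := by
    rw [Matrix.mem_unitaryGroup_iff, Matrix.star_eq_conjTranspose]
    change (W : Op (Fin d))ᵀ * ((W : Op (Fin d))ᴴ)ᵀ = 1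
    rw [← Matrix.transpose_mul]
    have := Matrix.mem_unitaryGroup_iff'.mp W.2
    rw [Matrix.star_eq_conjTranspose] at this
    rw [this, Matrix.transpose_one]
  have hm : ∀ (V : U d) (q : Word d T), evalU ((⟨_, hW'⟩ : U d) * V) (wordMono q)
      = ∑ q', evalU V (wordMono q') * B q' q := by
    intro V q
    simp only [evalU_wordMono]
    rw [Submonoid.coe_mul, tpow_mul, tpow_transpose, Matrix.mul_apply, Fintype.sum_prod_type]
    refine Finset.sum_congr rfl fun x _ => ?_
    simp [hB, Matrix.kroneckerMap_apply, Matrix.one_apply, mul_comm]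
  have hN : gram d T = Bᴴ * gram d T * B := by
    ext p q
    have h1 : gram d T p q = haarInner (wordPoly fun p' => B p' p) (wordPoly fun q' => B q' q) := by
      simp only [gram, Matrix.of_apply, haarInner]
      rw [← integral_haar_mul_left _ (⟨_, hW'⟩ : U d)]
      simp only [hm, wordPoly, map_sum, map_smul, smul_eq_mul, mul_comm]
    rw [h1, haarInner_wordPoly, mul_assoc, Matrix.mul_apply]
    simp only [dotProduct, Pi.star_apply, Matrix.conjTranspose_apply, Matrix.mul_apply,
      Matrix.mulVec]
  calc gram d T * B = B * Bᴴ * gram d T * B := by rw [hBB, one_mul]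
    _ = B * (Bᴴ * gram d T * B) := by simp only [mul_assoc]
    _ = B * gram d T := by rw [← hN]

-- Each entry of the commutator with `M ⊗ 1` is a linear functional of `M`, so `map_dtpow_eq_zero`
-- passes from the group to its derivatives.
open scoped Kronecker in
theorem commute_gram_dtpow {d T : ℕ} (X : Op (Fin d)) :
    gram d T * (dtpow T X ⊗ₖ 1) = (dtpow T X ⊗ₖ 1) * gram d T := by
  ext p q
  let K : Op (Fin T → Fin d) →ₗ[ℂ] Op (Word d T) :=
    (Matrix.kroneckerBilinear (α := ℂ) (R := ℂ)).flip (1 : Op (Fin T → Fin d))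
  let Λ : Op (Fin T → Fin d) →ₗ[ℂ] ℂ :=
    Matrix.entryLinearMap ℂ ℂ p q ∘ₗ
      ((LinearMap.mulLeft ℂ (gram d T) - LinearMap.mulRight ℂ (gram d T)) ∘ₗ K)
  have hΛ : ∀ M : Op (Fin T → Fin d),
      Λ M = (gram d T * (M ⊗ₖ (1 : Op (Fin T → Fin d))) : Op (Word d T)) p q
        - ((M ⊗ₖ (1 : Op (Fin T → Fin d))) * gram d T : Op (Word d T)) p q := fun M => rfl
  have h := map_dtpow_eq_zero Λ (fun W => by rw [hΛ, commute_gram_tpow, sub_self]) X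
  rw [hΛ] at h
  exact sub_eq_zero.mp h

/-! ### Invariant derivations and the gradient on the unitary group. -/

theorem derivation_prod {σ A : Type*} [CommRing A] [Algebra ℂ A] [DecidableEq σ]
    (D : Derivation ℂ A A) (s : Finset σ) (f : σ → A) :
    D (∏ t ∈ s, f t) = ∑ t ∈ s, (∏ r ∈ s.erase t, f r) * D (f t) := by
  induction s using Finset.induction_on with
  | empty => simp
  | insert a s ha ih =>
    rw [Finset.prod_insert ha, Derivation.leibniz, ih, Finset.sum_insert ha,
      Finset.erase_insert ha, smul_eq_mul, smul_eq_mul, add_comm, Finset.mul_sum]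
    congr 1
    refine Finset.sum_congr rfl fun t ht => ?_
    have hta : t ≠ a := fun e => ha (e ▸ ht)
    rw [Finset.erase_insert_of_ne hta.symm, Finset.prod_insert (by simp [ha]), mul_assoc]

/-- The infinitesimal left multiplication by `Eᵢⱼ`. -/
def leftDeriv {d : ℕ} (i j : Fin d) : Derivation ℂ (EntryPoly d) (EntryPoly d) :=
  ∑ k : Fin d, (MvPolynomial.X (i, k) : EntryPoly d) • MvPolynomial.pderiv (j, k)

theorem leftDeriv_apply {d : ℕ} (i j : Fin d) (g : EntryPoly d) :
    leftDeriv i j g = ∑ k, MvPolynomial.X (i, k) * MvPolynomial.pderiv (j, k) g := by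
  have h := congrFun (map_sum (Derivation.coeFnAddMonoidHom (R := ℂ) (A := EntryPoly d)
    (M := EntryPoly d)) (fun k : Fin d => (MvPolynomial.X (i, k) : EntryPoly d) •
    MvPolynomial.pderiv (j, k)) Finset.univ) g
  exact h.trans (by rw [Finset.sum_apply]; rfl)

theorem leftDeriv_wordMono {d T : ℕ} (i j : Fin d) (p : Word d T) :
    leftDeriv i j (wordMono p)
      = ∑ t, if p.1 t = j then wordMono (Function.update p.1 t i, p.2) else 0 := by
  rw [wordMono, derivation_prod]
  refine Finset.sum_congr rfl fun t _ => ?_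
  have h1 : leftDeriv i j (MvPolynomial.X (p.1 t, p.2 t))
      = if p.1 t = j then MvPolynomial.X (i, p.2 t) else (0 : EntryPoly d) := by
    rw [leftDeriv_apply]
    simp only [MvPolynomial.pderiv_X, Pi.single_apply, Prod.mk.injEq, mul_ite, mul_one, mul_zero]
    split_ifs with h
    · simp [h]
    · simp [h]
  rw [h1]
  split_ifs with h
  · rw [wordMono, ← Finset.prod_erase_mul _ _ (Finset.mem_univ t)]
    simp only [Function.update_self]
    congr 1
    refine Finset.prod_congr rfl fun r hr => ?_
    rw [Function.update_of_ne (Finset.ne_of_mem_erase hr)]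
  · simp

-- The derivation replaces one row index `j` of a monomial by `i`, which is how the matrix unit
-- `Eᵢⱼ` acts on one factor of a tensor power.
open scoped Kronecker in
theorem leftDeriv_wordPoly {d T : ℕ} (i j : Fin d) (β : Word d T → ℂ) :
    leftDeriv i j (wordPoly β) = wordPoly ((dtpow T (Matrix.single i j 1) ⊗ₖ 1) *ᵥ β) := by
  simp only [wordPoly, map_sum, Matrix.mulVec, dotProduct, Finset.sum_smul]
  rw [Finset.sum_comm]
  refine Finset.sum_congr rfl fun p _ => ?_
  rw [Derivation.map_smul, leftDeriv_wordMono, Finset.smul_sum, Fintype.sum_prod_type]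
  obtain ⟨x, y⟩ := p
  simp only [Matrix.kroneckerMap_apply, Matrix.one_apply, mul_ite, mul_one, mul_zero, ite_mul,
    zero_mul, ite_smul, zero_smul, Finset.sum_ite_eq', Finset.mem_univ, if_true, dtpow_apply,
    Finset.sum_mul, Finset.sum_smul, update_eq_comm _ x]
  rw [Finset.sum_comm]
  refine Finset.sum_congr rfl fun t _ => ?_
  rw [Finset.sum_eq_single (Function.update x t i)]
  · by_cases h : x t = j
    · simp [h]
    · simp [h, Ne.symm h]
  · intro z _ hz
    by_cases h : z = Function.update x t (z t)
    · have : i ≠ z t := by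
        rintro rfl
        exact hz h
      simp [this]
    · simp [h]
  · simp

/-- For fixed `j`, the left derivatives form the vector of partial derivatives in row `j`,
multiplied by `V`. Unitarity of `V` preserves its norm, so the invariant gradient and the coordinate
gradient have the same length on the group. -/
theorem sum_normSq_leftDeriv {d : ℕ} (V : U d) (g : EntryPoly d) :
    ∑ i, ∑ j, star (evalU V (leftDeriv i j g)) * evalU V (leftDeriv i j g)
      = ∑ c, star (evalU V (MvPolynomial.pderiv c g)) * evalU V (MvPolynomial.pderiv c g) := by
  rw [Finset.sum_comm, Fintype.sum_prod_type]
  refine Finset.sum_congr rfl fun j _ => ?_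
  set a : Fin d → ℂ := fun k => evalU V (MvPolynomial.pderiv (j, k) g) with ha
  have h1 : ∀ i, evalU V (leftDeriv i j g) = ((V : Op (Fin d)) *ᵥ a) i := by
    intro i
    rw [leftDeriv_apply]
    simp [Matrix.mulVec, dotProduct, ha, evalU]
  have hV : (V : Op (Fin d))ᴴ * (V : Op (Fin d)) = 1 := Matrix.mem_unitaryGroup_iff'.mp V.2
  simp only [h1]
  change star ((V : Op (Fin d)) *ᵥ a) ⬝ᵥ ((V : Op (Fin d)) *ᵥ a) = star a ⬝ᵥ a
  rw [Matrix.star_mulVec, Matrix.dotProduct_mulVec, Matrix.vecMul_vecMul, hV, Matrix.vecMul_one]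

open scoped Kronecker in
/-- The gradient of a homogeneous polynomial in terms of the Casimir element. -/
theorem sum_haarNormSq_pderiv {d T : ℕ} (β : Word d T → ℂ) :
    (∑ c, haarNormSq (MvPolynomial.pderiv c (wordPoly β)) : ℝ)
      = star β ⬝ᵥ ((gram d T * (casimir d T ⊗ₖ 1)) *ᵥ β) := by
  have h1 : ((∑ c, haarNormSq (MvPolynomial.pderiv c (wordPoly β)) : ℝ) : ℂ)
      = ∑ i, ∑ j, haarInner (leftDeriv i j (wordPoly β)) (leftDeriv i j (wordPoly β)) := by
    push_cast
    simp only [← haarInner_self, haarInner]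
    rw [← integral_finsetSum _ fun c _ => integrable_haar (by fun_prop)]
    simp only [← sum_normSq_leftDeriv]
    rw [integral_finsetSum _ fun i _ => integrable_haar (by fun_prop)]
    refine Finset.sum_congr rfl fun i _ => ?_
    rw [integral_finsetSum _ fun j _ => integrable_haar (by fun_prop)]
  rw [h1]
  simp only [leftDeriv_wordPoly, haarInner_wordPoly]
  -- The adjoint of the action of `Eᵢⱼ` is the action of `Eⱼᵢ`; it commutes with the Gram matrix and
  -- so can be moved to its right, next to the other factor.
  have h2 : ∀ i j : Fin d, star ((dtpow T (Matrix.single i j 1) ⊗ₖ 1) *ᵥ β)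
      ⬝ᵥ (gram d T *ᵥ ((dtpow T (Matrix.single i j 1) ⊗ₖ (1 : Op (Fin T → Fin d))) *ᵥ β))
      = star β ⬝ᵥ ((gram d T * ((dtpow T (Matrix.single j i 1) * dtpow T (Matrix.single i j 1))
        ⊗ₖ 1)) *ᵥ β) := by
    intro i j
    rw [Matrix.star_mulVec, ← Matrix.dotProduct_mulVec, Matrix.mulVec_mulVec, Matrix.mulVec_mulVec,
      Matrix.conjTranspose_kronecker, dtpow_conjTranspose, Matrix.conjTranspose_single, star_one,
      Matrix.conjTranspose_one, ← commute_gram_dtpow, mul_assoc,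
      ← Matrix.mul_kronecker_mul, one_mul]
  simp only [h2, ← dotProduct_sum, ← Matrix.sum_mulVec, ← Finset.mul_sum]
  congr 3
  ext p q
  simp [casimir, Matrix.sum_apply, Finset.sum_mul]

open scoped Kronecker MatrixOrder in
/-- A reverse Poincaré inequality for homogeneous polynomials on the unitary group. -/
theorem sum_haarNormSq_pderiv_le {d T : ℕ} (β : Word d T → ℂ) :
    ∑ c, haarNormSq (MvPolynomial.pderiv c (wordPoly β))
      ≤ (T * (d + T - 1) : ℕ) * haarNormSq (wordPoly β) := by
  set A : Op (Word d T) :=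
    (((T * (d + T - 1) : ℕ) : ℂ) • (1 : Op (Fin T → Fin d)) - casimir d T) ⊗ₖ 1 with hA
  have hA0 : A.PosSemidef := (posSemidef_sub_casimir d T).kronecker Matrix.PosSemidef.one
  have hAe : A = ((T * (d + T - 1) : ℕ) : ℂ) • 1 - casimir d T ⊗ₖ 1 := by
    rw [hA, ← Matrix.one_kronecker_one, ← Matrix.smul_kronecker]
    ext p q
    simp [sub_mul]
  have hcc : Commute (gram d T) (casimir d T ⊗ₖ 1) := by
    have : casimir d T ⊗ₖ (1 : Op (Fin T → Fin d)) = ∑ i, ∑ j,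
        (dtpow T (Matrix.single j i 1) ⊗ₖ (1 : Op (Fin T → Fin d)))
          * (dtpow T (Matrix.single i j 1) ⊗ₖ (1 : Op (Fin T → Fin d))) := by
      ext p q
      simp [casimir, Matrix.sum_apply, Finset.sum_mul, ← Matrix.mul_kronecker_mul]
    rw [this]
    exact Commute.sum_right _ _ _ fun i _ => Commute.sum_right _ _ _ fun j _ =>
      Commute.mul_right (commute_gram_dtpow _) (commute_gram_dtpow _)
  have hc : Commute (gram d T) A := by
    rw [hAe]
    exact ((Commute.one_right _).smul_right _).sub_right hcc
  -- A product of two commuting positive semidefinite matrices is positive semidefinite.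
  have h0 : (gram d T * A).PosSemidef :=
    Matrix.nonneg_iff_posSemidef.mp (Commute.mul_nonneg
      (Matrix.nonneg_iff_posSemidef.mpr (posSemidef_gram d T))
      (Matrix.nonneg_iff_posSemidef.mpr hA0) hc)
  have h1 := h0.dotProduct_mulVec_nonneg β
  rw [hAe, mul_sub, Matrix.sub_mulVec, dotProduct_sub, ← sum_haarNormSq_pderiv, Matrix.mul_smul,
    mul_one, Matrix.smul_mulVec, dotProduct_smul, ← haarInner_wordPoly, haarInner_self,
    smul_eq_mul] at h1
  have h2 := sub_nonneg.mp h1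
  exact_mod_cast h2

/-! ### The Fischer inner product -/

/-- The sum over all derivatives of order `T` of the products of their constant terms. -/
def fischer {d : ℕ} : ℕ → EntryPoly d → EntryPoly d → ℂ
  | 0, f, g => star (MvPolynomial.constantCoeff f) * MvPolynomial.constantCoeff g
  | T + 1, f, g => ∑ c, fischer T (MvPolynomial.pderiv c f) (MvPolynomial.pderiv c g)

theorem fischer_add_right {d : ℕ} (T : ℕ) (f g h : EntryPoly d) :
    fischer T f (g + h) = fischer T f g + fischer T f h := by
  induction T generalizing f g h with
  | zero => simp [fischer, mul_add]
  | succ T ih => simp [fischer, ih, Finset.sum_add_distrib]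

theorem fischer_smul_right {d : ℕ} (T : ℕ) (c : ℂ) (f g : EntryPoly d) :
    fischer T f (c • g) = c * fischer T f g := by
  induction T generalizing f g with
  | zero => simp [fischer, mul_left_comm]
  | succ T ih => simp [fischer, ih, Finset.mul_sum]

theorem fischer_star {d : ℕ} (T : ℕ) (f g : EntryPoly d) :
    star (fischer T f g) = fischer T g f := by
  induction T generalizing f g with
  | zero => simp [fischer, mul_comm]
  | succ T ih => simp only [fischer, star_sum, ih]

theorem fischer_add_left {d : ℕ} (T : ℕ) (f g h : EntryPoly d) :
    fischer T (f + g) h = fischer T f h + fischer T g h := by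
  rw [← fischer_star, fischer_add_right, star_add, fischer_star, fischer_star]

theorem fischer_smul_left {d : ℕ} (T : ℕ) (c : ℂ) (f g : EntryPoly d) :
    fischer T (c • f) g = star c * fischer T f g := by
  rw [← fischer_star, fischer_smul_right, star_mul', fischer_star]

theorem fischer_sum_left {d : ℕ} {ι : Type*} (T : ℕ) (s : Finset ι) (f : ι → EntryPoly d)
    (g : EntryPoly d) : fischer T (∑ i ∈ s, f i) g = ∑ i ∈ s, fischer T (f i) g := by
  classical
  induction s using Finset.induction_on with
  | empty =>
    have := fischer_smul_left T 0 (0 : EntryPoly d) g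
    simpa using this
  | insert a s ha ih => rw [Finset.sum_insert ha, fischer_add_left, ih, Finset.sum_insert ha]

theorem fischer_self_nonneg {d : ℕ} (T : ℕ) (g : EntryPoly d) : 0 ≤ fischer T g g := by
  induction T generalizing g with
  | zero =>
    simp only [fischer]
    exact star_mul_self_nonneg _
  | succ T ih => exact Finset.sum_nonneg fun c _ => ih _

theorem pderiv_comm {d : ℕ} (a b : Fin d × Fin d) (g : EntryPoly d) :
    MvPolynomial.pderiv a (MvPolynomial.pderiv b g)
      = MvPolynomial.pderiv b (MvPolynomial.pderiv a g) := by
  have h : ⁅MvPolynomial.pderiv (R := ℂ) a, MvPolynomial.pderiv (R := ℂ) b⁆ = 0 := by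
    refine MvPolynomial.derivation_ext fun c => ?_
    rw [Derivation.commutator_apply, MvPolynomial.pderiv_X, MvPolynomial.pderiv_X]
    simp only [Pi.single_apply]
    split_ifs <;> simp
  have h2 := congrArg (fun D : Derivation ℂ (EntryPoly d) (EntryPoly d) => D g) h
  simp only [Derivation.commutator_apply, Derivation.coe_zero, Pi.zero_apply] at h2
  exact sub_eq_zero.mp h2

/-- The linear form with coefficients `B`. -/
def linForm {d : ℕ} (B : Fin d × Fin d → ℂ) : EntryPoly d := ∑ c, B c • MvPolynomial.X c

theorem pderiv_linForm {d : ℕ} (B : Fin d × Fin d → ℂ) (c : Fin d × Fin d) :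
    MvPolynomial.pderiv c (linForm B) = MvPolynomial.C (B c) := by
  simp [linForm, MvPolynomial.pderiv_X, Pi.single_apply, MvPolynomial.smul_eq_C_mul]

theorem pderiv_linForm_mul {d : ℕ} (B : Fin d × Fin d → ℂ) (c : Fin d × Fin d) (g : EntryPoly d) :
    MvPolynomial.pderiv c (linForm B * g)
      = B c • g + linForm B * MvPolynomial.pderiv c g := by
  rw [Derivation.leibniz, pderiv_linForm, smul_eq_mul, smul_eq_mul, MvPolynomial.smul_eq_C_mul]
  ring

theorem evalU_linForm {d : ℕ} (B : Fin d × Fin d → ℂ) (V : U d) :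
    evalU V (linForm B) = ∑ c, B c * (V : Op (Fin d)) c.1 c.2 := by
  simp [linForm, evalU]

/-- The derivative dual to multiplication by a linear form. -/
def dualDeriv {d : ℕ} (B : Fin d × Fin d → ℂ) (g : EntryPoly d) : EntryPoly d :=
  ∑ c, star (B c) • MvPolynomial.pderiv c g

/-- Multiplication by a linear form is adjoint to `dualDeriv`, up to a factor: only constant terms
count in the end, so exactly one of the `T + 1` derivatives has to hit the linear form. -/
theorem fischer_linForm_mul {d : ℕ} (T : ℕ) (B : Fin d × Fin d → ℂ) (g h : EntryPoly d) :
    fischer (T + 1) g (linForm B * h) = (T + 1) * fischer T (dualDeriv B g) h := by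
  have h1 : ∀ S (g h : EntryPoly d), fischer S (dualDeriv B g) h
      = ∑ c, B c * fischer S (MvPolynomial.pderiv c g) h := by
    intro S g h
    simp only [dualDeriv, fischer_sum_left, fischer_smul_left, star_star]
  induction T generalizing g h with
  | zero =>
    rw [h1]
    simp only [fischer, pderiv_linForm_mul]
    simp only [map_add, map_mul, MvPolynomial.smul_eq_C_mul, MvPolynomial.constantCoeff_C]
    have : MvPolynomial.constantCoeff (linForm B) = 0 := by
      simp [linForm, MvPolynomial.smul_eq_C_mul]
    simp only [this]
    simp only [Nat.cast_zero, zero_add, one_mul, zero_mul, add_zero]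
    exact Finset.sum_congr rfl fun c _ => by ring
  | succ T ih =>
    conv_lhs => rw [fischer]
    simp only [pderiv_linForm_mul, fischer_add_right, fischer_smul_right, Finset.sum_add_distrib]
    rw [← h1]
    simp only [ih]
    have h2 : ∀ c, dualDeriv B (MvPolynomial.pderiv c g)
        = MvPolynomial.pderiv c (dualDeriv B g) := by
      intro c
      simp only [dualDeriv, map_sum, Derivation.map_smul, pderiv_comm c]
    simp only [h2, ← Finset.mul_sum]
    have h3 : ∑ c, fischer T (MvPolynomial.pderiv c (dualDeriv B g)) (MvPolynomial.pderiv c h)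
        = fischer (T + 1) (dualDeriv B g) h := rfl
    rw [h3]
    push_cast
    ring

/-- With `D` for `dualDeriv B`, the product rule reads `D (B g) = ‖B‖² g + B (D g)`. The first term
gives the bound. The second contributes, by adjointness once more, a nonnegative multiple of the
Fischer norm of `D g`. -/
theorem le_fischer_linForm_mul {d : ℕ} (T : ℕ) (B : Fin d × Fin d → ℂ) (g : EntryPoly d) :
    (T + 1) * (∑ c, (‖B c‖ : ℂ) ^ 2) * fischer T g g
      ≤ fischer (T + 1) (linForm B * g) (linForm B * g) := by
  have h1 : dualDeriv B (linForm B * g)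
      = (∑ c, (‖B c‖ : ℂ) ^ 2) • g + linForm B * dualDeriv B g := by
    simp only [dualDeriv, pderiv_linForm_mul, smul_add, Finset.sum_add_distrib, Finset.sum_smul,
      Finset.mul_sum, smul_smul, Complex.star_def, Complex.conj_mul', mul_smul_comm]
  have hs : star (∑ c, (‖B c‖ : ℂ) ^ 2) = ∑ c, (‖B c‖ : ℂ) ^ 2 := by
    simp [star_sum]
  rw [fischer_linForm_mul, h1, fischer_add_left, fischer_smul_left, hs, mul_add, mul_assoc]
  refine le_add_of_nonneg_right (mul_nonneg (by positivity) ?_)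
  rw [← fischer_star, star_nonneg_iff]
  -- In degree zero the additional term vanishes, since a linear form has no constant term.
  rcases T with _ | T
  · have : MvPolynomial.constantCoeff (linForm B) = 0 := by
      simp [linForm, MvPolynomial.smul_eq_C_mul]
    simp [fischer, this]
  · rw [fischer_linForm_mul]
    exact mul_nonneg (by positivity) (fischer_self_nonneg _ _)

/-- Taking off one linear form at a time collects the factors of `T!`. Pairwise orthogonal
coefficient vectors give equality. -/
theorem le_fischer_prod_linForm {d : ℕ} (T : ℕ) (B : Fin T → Fin d × Fin d → ℂ) :
    (T.factorial : ℂ) * ∏ t, ∑ c, (‖B t c‖ : ℂ) ^ 2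
      ≤ fischer T (∏ t, linForm (B t)) (∏ t, linForm (B t)) := by
  induction T with
  | zero => simp [fischer]
  | succ T ih =>
    rw [Fin.prod_univ_succ, Fin.prod_univ_succ]
    refine le_trans (le_of_eq ?_) ((mul_le_mul_of_nonneg_left (ih fun t => B t.succ)
      (by positivity)).trans (le_fischer_linForm_mul T (B 0) _))
    rw [Nat.factorial_succ]
    push_cast
    ring

theorem exists_wordMono_eq {d : ℕ} (T : ℕ) (α : (Fin d × Fin d) →₀ ℕ) (hα : α.degree = T) :
    ∃ p : Word d T, MvPolynomial.monomial α (1 : ℂ) = wordMono p := by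
  induction T generalizing α with
  | zero =>
    refine ⟨(Fin.elim0, Fin.elim0), ?_⟩
    rw [(Finsupp.degree_eq_zero_iff α).mp hα]
    simp [wordMono]
  | succ T ih =>
    have hne : α ≠ 0 := by
      rintro rfl
      simp at hα
    obtain ⟨c, hc⟩ := Finsupp.ne_iff.mp hne
    have hle : Finsupp.single c 1 ≤ α := by
      rw [Finsupp.single_le_iff]
      exact Nat.one_le_iff_ne_zero.mpr hc
    have hd := tsub_add_cancel_of_le hle
    have hdeg : (α - Finsupp.single c 1).degree = T := by
      have := congrArg Finsupp.degree hd
      rw [map_add, hα, Finsupp.degree_single] at this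
      omega
    obtain ⟨p, hp⟩ := ih _ hdeg
    refine ⟨(Fin.cons c.1 p.1, Fin.cons c.2 p.2), ?_⟩
    rw [← hd, add_comm, ← one_mul (1 : ℂ), ← MvPolynomial.monomial_mul, hp]
    simp [wordMono, Fin.prod_univ_succ, MvPolynomial.X]

theorem exists_wordPoly_eq {d T : ℕ} (g : EntryPoly d) (hg : g.IsHomogeneous T) :
    ∃ β : Word d T → ℂ, g = wordPoly β := by
  classical
  have h1 : g ∈ Submodule.span ℂ (Set.range (wordMono (d := d) (T := T))) := by
    rw [g.as_sum]
    refine Submodule.sum_mem _ fun α hα => ?_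
    have hdeg : α.degree = T := by
      have := hg (MvPolynomial.mem_support_iff.mp hα)
      rw [Finsupp.degree_eq_weight_one]
      exact this
    obtain ⟨p, hp⟩ := exists_wordMono_eq T α hdeg
    have : MvPolynomial.monomial α (g.coeff α) = g.coeff α • wordMono p := by
      rw [← hp, MvPolynomial.smul_monomial, smul_eq_mul, mul_one]
    rw [this]
    exact Submodule.smul_mem _ _ (Submodule.subset_span ⟨p, rfl⟩)
  obtain ⟨β, hβ⟩ := (Submodule.mem_span_range_iff_exists_fun ℂ).mp h1
  exact ⟨β, hβ.symm⟩

theorem isHomogeneous_linForm {d : ℕ} (B : Fin d × Fin d → ℂ) : (linForm B).IsHomogeneous 1 := by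
  refine MvPolynomial.IsHomogeneous.sum _ _ _ fun c _ => ?_
  rw [MvPolynomial.smul_eq_C_mul]
  simpa using (MvPolynomial.isHomogeneous_C _ (B c)).mul (MvPolynomial.isHomogeneous_X ℂ c)

/-- The Fischer norm of a homogeneous polynomial is bounded by its norm on the unitary group. -/
theorem fischer_le_haarNormSq {d : ℕ} (T : ℕ) (g : EntryPoly d) (hg : g.IsHomogeneous T) :
    (fischer T g g).re ≤ (∏ i ∈ Finset.range T, ((i + 1) * (d + i) : ℝ)) * haarNormSq g := by
  induction T generalizing g with
  | zero =>
    have hC : g = MvPolynomial.C (MvPolynomial.constantCoeff g) := by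
      refine (MvPolynomial.totalDegree_eq_zero_iff_eq_C).mp ?_
      exact Nat.le_zero.mp hg.totalDegree_le
    rw [hC]
    generalize MvPolynomial.constantCoeff g = a
    have h1 : star a * a = ((‖a‖ ^ 2 : ℝ) : ℂ) := by
      rw [Complex.star_def, Complex.conj_mul']
      norm_cast
    simp only [fischer, haarNormSq, evalU, MvPolynomial.aeval_C, MvPolynomial.constantCoeff_C, h1]
    simp [-Complex.ofReal_pow]
  | succ T ih =>
    obtain ⟨β, rfl⟩ := exists_wordPoly_eq g hg
    -- In degree `T + 1` the reverse Poincaré constant is `(T + 1) (d + T)`, the last factor of the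
    -- product.
    have h1 := sum_haarNormSq_pderiv_le β
    simp only [fischer, Complex.re_sum]
    refine (Finset.sum_le_sum fun c _ => ih _ (by simpa using hg.pderiv)).trans ?_
    rw [← Finset.mul_sum, Finset.prod_range_succ, mul_assoc]
    rw [show d + (T + 1) - 1 = d + T by omega] at h1
    refine mul_le_mul_of_nonneg_left (h1.trans (le_of_eq ?_))
      (Finset.prod_nonneg fun i _ => by positivity)
    push_cast
    ring

/-- The expectation of a product of squared linear forms in a Haar-random unitary is almost the
product of their expectations, or larger. -/
theorem prod_le_integral_prod_linear {d T : ℕ} (B : Fin T → Fin d × Fin d → ℂ) :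
    ∏ t, ∑ c, ‖B t c‖ ^ 2 ≤ (∏ i ∈ Finset.range T, (d + i : ℝ)) *
      ∫ V : U d, ∏ t, ‖∑ c, B t c * (V : Op (Fin d)) c.1 c.2‖ ^ 2 ∂(haar d) := by
  have hhom : (∏ t, linForm (B t)).IsHomogeneous T := by
    have := MvPolynomial.IsHomogeneous.prod Finset.univ (fun t => linForm (B t)) (fun _ => 1)
      fun t _ => isHomogeneous_linForm (B t)
    simpa using this
  have h1 := fischer_le_haarNormSq T _ hhom
  have h2 := (Complex.le_def.mp (le_fischer_prod_linForm T B)).1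
  have h3 : ((T.factorial : ℂ) * ∏ t, ∑ c, (‖B t c‖ : ℂ) ^ 2).re
      = T.factorial * ∏ t, ∑ c, ‖B t c‖ ^ 2 := by
    have : (T.factorial : ℂ) * ∏ t, ∑ c, (‖B t c‖ : ℂ) ^ 2
      = ((T.factorial * ∏ t, ∑ c, ‖B t c‖ ^ 2 : ℝ) : ℂ) := by push_cast; rfl
    rw [this, Complex.ofReal_re]
  have h4 : haarNormSq (∏ t, linForm (B t))
      = ∫ V : U d, ∏ t, ‖∑ c, B t c * (V : Op (Fin d)) c.1 c.2‖ ^ 2 ∂(haar d) := by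
    unfold haarNormSq
    simp only [map_prod, evalU_linForm, norm_prod, Finset.prod_pow]
  rw [h3] at h2
  rw [h4, Finset.prod_mul_distrib] at h1
  have h5 : ∏ i ∈ Finset.range T, ((i : ℝ) + 1) = T.factorial := by
    rw [← Finset.prod_range_add_one_eq_factorial]
    push_cast
    rfl
  rw [h5, mul_assoc] at h1
  -- Both bounds on the Fischer norm contain the factor `T!`, which cancels.
  exact le_of_mul_le_mul_left (h2.trans h1) (by positivity)

/-! ### Moments of a matrix element -/

-- The coefficients of a power of a rank-one form are a product tensor `u ⊗ ⋯ ⊗ u` in the row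
-- indices. It is symmetric, hence an eigenvector of the Casimir element for the largest eigenvalue,
-- and the gradient formula becomes an exact recursion for the moments.
open scoped Kronecker in
theorem haarNormSq_linForm_pow {d : ℕ} (T : ℕ) (u v : Fin d → ℂ) :
    (d + T) * haarNormSq (linForm (fun c => u c.1 * v c.2) ^ (T + 1))
      = (T + 1) * ((∑ i, ‖u i‖ ^ 2) * ∑ j, ‖v j‖ ^ 2)
        * haarNormSq (linForm (fun c => u c.1 * v c.2) ^ T) := by
  set B : Fin d × Fin d → ℂ := fun c => u c.1 * v c.2 with hB
  set β : Word d (T + 1) → ℂ := fun p => (∏ t, u (p.1 t)) * ∏ t, v (p.2 t) with hβ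
  have hpow : linForm B ^ (T + 1) = wordPoly β := by
    have h1 : linForm B ^ (T + 1) = ∏ _t : Fin (T + 1), linForm B := by simp
    rw [h1]
    unfold linForm
    rw [Finset.prod_univ_sum, Fintype.piFinset_univ]
    refine Fintype.sum_equiv (Equiv.arrowProdEquivProdArrow (Fin (T + 1)) (fun _ => Fin d)
      (fun _ => Fin d)) _ _ fun w => ?_
    simp only [hβ, wordMono, hB, Equiv.arrowProdEquivProdArrow, Equiv.coe_fn_mk]
    rw [← Finset.prod_mul_distrib, Finset.prod_smul]
  have hcas : (casimir d (T + 1) ⊗ₖ (1 : Op (Fin (T + 1) → Fin d))) *ᵥ β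
      = (((T + 1) * (d + T) : ℕ) : ℂ) • β := by
    ext ⟨x, y⟩
    have h1 : ((casimir d (T + 1) ⊗ₖ (1 : Op (Fin (T + 1) → Fin d))) *ᵥ β) (x, y)
        = (casimir d (T + 1) *ᵥ fun x => ∏ t, u (x t)) x * ∏ t, v (y t) := by
      simp only [Matrix.mulVec, dotProduct, Matrix.kroneckerMap_apply, Matrix.one_apply,
        Fintype.sum_prod_type, hβ, Finset.sum_mul]
      refine Finset.sum_congr rfl fun z _ => ?_
      simp [mul_assoc]
    have h2 : ∀ s t : Fin (T + 1), ∏ r, u ((x ∘ Equiv.swap s t) r) = ∏ r, u (x r) :=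
      fun s t => Equiv.prod_comp (Equiv.swap s t) fun r => u (x r)
    rw [h1, casimir_eq]
    simp only [Matrix.add_mulVec, Matrix.smul_mulVec, Matrix.one_mulVec, Matrix.sum_mulVec,
      Pi.add_apply, Pi.smul_apply, Finset.sum_apply, tswap_mulVec, h2, Finset.sum_const,
      Finset.card_erase_of_mem (Finset.mem_univ _), Finset.card_univ, Fintype.card_fin,
      smul_eq_mul, nsmul_eq_mul, hβ]
    push_cast
    ring
  have hpd : ∀ c, haarNormSq (MvPolynomial.pderiv c (linForm B ^ (T + 1)))
      = (T + 1) ^ 2 * ‖B c‖ ^ 2 * haarNormSq (linForm B ^ T) := by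
    intro c
    rw [Derivation.leibniz_pow, pderiv_linForm]
    unfold haarNormSq
    rw [← integral_const_mul]
    congr 1
    ext V
    have : evalU V (MvPolynomial.C (B c)) = B c := by simp [evalU]
    simp only [Nat.add_sub_cancel, smul_eq_mul, nsmul_eq_mul, map_mul, map_natCast, this,
      norm_mul, mul_pow, Complex.norm_natCast]
    push_cast
    ring
  have key := sum_haarNormSq_pderiv β
  rw [← Matrix.mulVec_mulVec, hcas, Matrix.mulVec_smul, dotProduct_smul, ← haarInner_wordPoly,
    haarInner_self, ← hpow] at key
  simp only [hpd] at key
  have key2 : ∑ c, ((T : ℝ) + 1) ^ 2 * ‖B c‖ ^ 2 * haarNormSq (linForm B ^ T)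
      = ((T + 1) * (d + T) : ℕ) * haarNormSq (linForm B ^ (T + 1)) := by
    rw [smul_eq_mul] at key
    exact_mod_cast key
  have hn : ∑ c, ‖B c‖ ^ 2 = (∑ i, ‖u i‖ ^ 2) * ∑ j, ‖v j‖ ^ 2 := by
    rw [Finset.sum_mul_sum, Fintype.sum_prod_type]
    simp [hB, mul_pow]
  rw [← Finset.sum_mul, ← Finset.mul_sum, hn] at key2
  push_cast at key2
  have hT : ((T : ℝ) + 1) ≠ 0 := by positivity
  refine mul_left_cancel₀ hT ?_
  linear_combination -key2

/-- The eighth moment of a matrix element of a Haar-random unitary. -/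
theorem integral_norm_pow_eight_le {d : ℕ} [NeZero d] (u v : Fin d → ℂ) :
    ∫ V : U d, ‖∑ i, ∑ j, u i * v j * (V : Op (Fin d)) i j‖ ^ 8 ∂(haar d)
      ≤ 24 * ((∑ i, ‖u i‖ ^ 2) * ∑ j, ‖v j‖ ^ 2) ^ 4 / d ^ 4 := by
  set s := (∑ i, ‖u i‖ ^ 2) * ∑ j, ‖v j‖ ^ 2 with hs
  have hs0 : 0 ≤ s := by positivity
  have hd : (0 : ℝ) < d := by exact_mod_cast Nat.pos_of_ne_zero (NeZero.ne d)
  -- Here `d + T` in the recursion is weakened to `d`; four such steps produce the factor `4! = 24`.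
  have step : ∀ T : ℕ, haarNormSq (linForm (fun c : Fin d × Fin d => u c.1 * v c.2) ^ (T + 1))
      ≤ (T + 1) * s / d * haarNormSq (linForm (fun c : Fin d × Fin d => u c.1 * v c.2) ^ T) := by
    intro T
    have h := haarNormSq_linForm_pow T u v
    rw [← hs] at h
    have h0 := haarNormSq_nonneg (linForm (fun c : Fin d × Fin d => u c.1 * v c.2) ^ (T + 1))
    rw [div_mul_eq_mul_div, le_div_iff₀ hd, ← h]
    nlinarith [mul_nonneg (Nat.cast_nonneg (α := ℝ) T) h0]
  have h0 : haarNormSq (linForm (fun c : Fin d × Fin d => u c.1 * v c.2) ^ 0) = 1 := by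
    simp [haarNormSq]
  have h1 : haarNormSq (linForm (fun c : Fin d × Fin d => u c.1 * v c.2) ^ 4)
      = ∫ V : U d, ‖∑ i, ∑ j, u i * v j * (V : Op (Fin d)) i j‖ ^ 8 ∂(haar d) := by
    unfold haarNormSq
    simp only [map_pow, evalU_linForm, norm_pow, ← pow_mul, Fintype.sum_prod_type]
  rw [← h1]
  have c : ∀ k : ℝ, 0 ≤ k → 0 ≤ k * s / d := fun k hk => by positivity
  calc _ ≤ _ := step 3
    _ ≤ _ := mul_le_mul_of_nonneg_left (step 2) (c _ (by positivity))
    _ ≤ _ := mul_le_mul_of_nonneg_left (mul_le_mul_of_nonneg_left (step 1) (c _ (by positivity)))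
        (c _ (by positivity))
    _ ≤ _ := mul_le_mul_of_nonneg_left (mul_le_mul_of_nonneg_left (mul_le_mul_of_nonneg_left
        (step 0) (c _ (by positivity))) (c _ (by positivity))) (c _ (by positivity))
    _ = _ := by
      rw [h0]
      push_cast
      field_simp
      ring

/-! ### First and second moments of Haar-random states -/

theorem natCast_ne_zero_of_two {d : ℕ} [d.AtLeastTwo] : (d : ℂ) ≠ 0 :=
  Nat.cast_ne_zero.mpr (NeZero.ne d)

theorem sq_sub_one_ne_zero_of_two {d : ℕ} [h : d.AtLeastTwo] : (d : ℂ) ^ 2 - 1 ≠ 0 := by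
  have h2 : 2 ≤ d := h.prop
  have : (d : ℝ) ^ 2 - 1 ≠ 0 := by
    have : (2 : ℝ) ≤ d := by exact_mod_cast h2
    nlinarith
  exact_mod_cast this

/-- The matrix of moments of the entries of a Haar-random unitary. -/
def haarMoment {d T : ℕ} (z z' : Fin T → Fin d) : Op (Fin T → Fin d) :=
  Matrix.of fun x y => ∫ V : U d, tpow T (V : Op (Fin d)) x z
    * star (tpow T (V : Op (Fin d)) y z') ∂(haar d)

@[fun_prop]
theorem continuous_tpow_apply {d T : ℕ} (x y : Fin T → Fin d) :
    Continuous fun V : U d => tpow T (V : Op (Fin d)) x y := by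
  unfold tpow
  simp only [Matrix.of_apply]
  fun_prop

theorem commute_haarMoment_tpow {d T : ℕ} (z z' : Fin T → Fin d) (W : U d) :
    haarMoment z z' * tpow T (W : Op (Fin d)) = tpow T (W : Op (Fin d)) * haarMoment z z' := by
  set B := tpow T (W : Op (Fin d)) with hB
  have hBB : Bᴴ * B = 1 := by
    rw [hB, ← tpow_conjTranspose, ← tpow_mul]
    have := Matrix.mem_unitaryGroup_iff'.mp W.2
    rw [Matrix.star_eq_conjTranspose] at this
    rw [this, tpow_one]
  have hN : haarMoment z z' = B * haarMoment z z' * Bᴴ := by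
    ext x y
    rw [mul_assoc, Matrix.mul_apply]
    simp only [Matrix.mul_apply, haarMoment, Matrix.of_apply, Finset.mul_sum]
    rw [← integral_haar_mul_left _ W]
    simp only [Submonoid.coe_mul, tpow_mul, ← hB, Matrix.mul_apply, star_sum, Finset.sum_mul_sum]
    rw [integral_finsetSum _ fun p _ => integrable_haar (by fun_prop)]
    refine Finset.sum_congr rfl fun p _ => ?_
    rw [integral_finsetSum _ fun q _ => integrable_haar (by fun_prop)]
    refine Finset.sum_congr rfl fun q _ => ?_
    rw [← integral_mul_const, ← integral_const_mul]
    congr 1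
    ext V
    simp only [Matrix.conjTranspose_apply, star_mul']
    ring
  calc haarMoment z z' * B = (B * haarMoment z z' * Bᴴ) * B := by rw [← hN]
    _ = B * haarMoment z z' * (Bᴴ * B) := by rw [mul_assoc]
    _ = B * haarMoment z z' := by rw [hBB, mul_one]

theorem commute_haarMoment_dtpow {d T : ℕ} (z z' : Fin T → Fin d) (X : Op (Fin d)) :
    haarMoment z z' * dtpow T X = dtpow T X * haarMoment z z' := by
  ext p q
  let Λ : Op (Fin T → Fin d) →ₗ[ℂ] ℂ := Matrix.entryLinearMap ℂ ℂ p q ∘ₗ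
    (LinearMap.mulLeft ℂ (haarMoment z z') - LinearMap.mulRight ℂ (haarMoment z z'))
  have hΛ : ∀ M : Op (Fin T → Fin d),
      Λ M = (haarMoment z z' * M) p q - (M * haarMoment z z') p q := fun M => rfl
  have h := map_dtpow_eq_zero Λ (fun W => by rw [hΛ, commute_haarMoment_tpow, sub_self]) X
  rw [hΛ] at h
  exact sub_eq_zero.mp h

/-- These are the entries of the commutation relation with a matrix unit: linear relations between
moments. Together with the orthonormality of the columns they determine the moments of order one and
two. -/
theorem haarMoment_single {d T : ℕ} (z z' : Fin T → Fin d) (x y : Fin T → Fin d) (p q : Fin d) :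
    (∑ t, if x t = p then haarMoment z z' (Function.update x t q) y else 0)
      = ∑ t, if y t = q then haarMoment z z' x (Function.update y t p) else 0 := by
  have h := congrFun (congrFun (commute_haarMoment_dtpow z z' (Matrix.single p q 1)) x) y
  have h1 : (dtpow T (Matrix.single p q 1) * haarMoment z z') x y
      = (dtpow T (Matrix.single p q 1) *ᵥ fun x => haarMoment z z' x y) x := rfl
  have h2 : (haarMoment z z' * dtpow T (Matrix.single p q 1)) x y
      = (dtpow T (Matrix.single q p 1) *ᵥ fun y => haarMoment z z' x y) y := by
    rw [← Matrix.transpose_single, ← dtpow_transpose]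
    simp only [Matrix.mul_apply, Matrix.mulVec, dotProduct, Matrix.transpose_apply, mul_comm]
  rw [h1, h2, dtpow_mulVec, dtpow_mulVec] at h
  simpa [Matrix.single_apply, ite_and, eq_comm] using h.symm

theorem sum_star_mul_entry {d : ℕ} (V : U d) (a b : Fin d) :
    ∑ p, (V : Op (Fin d)) p a * star ((V : Op (Fin d)) p b) = if a = b then 1 else 0 := by
  have h := Matrix.mem_unitaryGroup_iff'.mp V.2
  have h2 := congrFun (congrFun h b) a
  rw [Matrix.mul_apply, Matrix.one_apply] at h2
  simp only [Matrix.star_apply] at h2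
  rw [Finset.sum_congr rfl fun p _ => mul_comm _ _, h2]
  simp only [eq_comm]

/-- Schur's lemma in coordinates: the moment is zero off the diagonal and constant on it, and
summation over the diagonal yields the constant. -/
theorem integral_entry_mul {d : ℕ} [d.AtLeastTwo] (i j a b : Fin d) :
    ∫ V : U d, (V : Op (Fin d)) i a * star ((V : Op (Fin d)) j b) ∂(haar d)
      = (if i = j then 1 else 0) * (if a = b then 1 else 0) / d := by
  have hm : ∀ i j, haarMoment ![a] ![b] ![i] ![j]
      = ∫ V : U d, (V : Op (Fin d)) i a * star ((V : Op (Fin d)) j b) ∂(haar d) := by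
    intro i j
    simp [haarMoment, tpow]
  have h : ∀ p, haarMoment ![a] ![b] ![i] ![j]
      = if j = i then haarMoment ![a] ![b] ![p] ![p] else 0 := by
    intro p
    have e : ∀ r s : Fin d, Function.update ![r] 0 s = ![s] := by
      intro r s; ext t; fin_cases t; simp
    have := haarMoment_single ![a] ![b] ![p] ![j] p i
    simpa [e] using this
  have h2 := Finset.sum_congr (rfl : (Finset.univ : Finset (Fin d)) = _) fun p _ => h p
  have h3 : ∑ p, haarMoment ![a] ![b] ![p] ![p] = if a = b then 1 else 0 := by
    simp only [hm]
    rw [← integral_finsetSum _ fun p _ => integrable_haar (by fun_prop)]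
    simp only [sum_star_mul_entry]
    simp
  rw [← hm, eq_div_iff natCast_ne_zero_of_two]
  by_cases hij : i = j
  · subst hij
    simp only [if_true, h3, Finset.sum_const, Finset.card_univ, Fintype.card_fin,
      nsmul_eq_mul] at h2
    rw [mul_comm, h2]
    simp
  · rw [h i, if_neg (Ne.symm hij), if_neg hij]
    simp

/-- Summing `haarMoment_single` over one index turns it into a relation between a moment, the moment
with `i` and `k` exchanged, and contractions known from `integral_entry_mul`. This relation and its
exchanged version form a linear system with determinant `d² - 1`. -/
theorem integral_entry_mul_four {d : ℕ} [d.AtLeastTwo] (a b i j k l : Fin d) :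
    ∫ V : U d, (V : Op (Fin d)) i a * star ((V : Op (Fin d)) j a)
        * ((V : Op (Fin d)) k b * star ((V : Op (Fin d)) l b)) ∂(haar d)
      = ((1 - (if a = b then 1 else 0) / d) * ((if i = j then 1 else 0) * if k = l then 1 else 0)
        + ((if a = b then 1 else 0) - 1 / d) * ((if i = l then 1 else 0) * if k = j then 1 else 0))
        / ((d : ℂ) ^ 2 - 1) := by
  have hd := natCast_ne_zero_of_two (d := d)
  have hm : ∀ i j k l, haarMoment ![a, b] ![a, b] ![i, k] ![j, l]
      = ∫ V : U d, (V : Op (Fin d)) i a * star ((V : Op (Fin d)) j a)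
        * ((V : Op (Fin d)) k b * star ((V : Op (Fin d)) l b)) ∂(haar d) := by
    intro i j k l
    simp only [haarMoment, tpow, Matrix.of_apply, Fin.prod_univ_two, Matrix.cons_val_zero,
      Matrix.cons_val_one, star_mul']
    congr 1
    ext V
    ring
  have hA : ∀ k l, ∑ p, haarMoment ![a, b] ![a, b] ![p, k] ![p, l]
      = (if k = l then 1 else 0) / d := by
    intro k l
    simp only [hm]
    rw [← integral_finsetSum _ fun p _ => integrable_haar (by fun_prop)]
    simp only [← Finset.sum_mul, sum_star_mul_entry]
    simp only [if_true, one_mul, integral_entry_mul, mul_one]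
  have hB : ∀ k j, ∑ p, haarMoment ![a, b] ![a, b] ![p, k] ![j, p]
      = (if a = b then 1 else 0) * (if k = j then 1 else 0) / d := by
    intro k j
    simp only [hm]
    rw [← integral_finsetSum _ fun p _ => integrable_haar (by fun_prop)]
    have : ∀ V : U d, ∑ p, (V : Op (Fin d)) p a * star ((V : Op (Fin d)) j a)
        * ((V : Op (Fin d)) k b * star ((V : Op (Fin d)) p b))
        = (if a = b then 1 else 0) * ((V : Op (Fin d)) k b * star ((V : Op (Fin d)) j a)) := by
      intro V
      rw [← sum_star_mul_entry V a b, Finset.sum_mul]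
      exact Finset.sum_congr rfl fun p _ => by ring
    simp only [this]
    rw [integral_const_mul, integral_entry_mul]
    by_cases hab : a = b <;> simp [hab]
  have key : ∀ q k, (d : ℂ) * haarMoment ![a, b] ![a, b] ![q, k] ![j, l]
      + haarMoment ![a, b] ![a, b] ![k, q] ![j, l]
      = (if q = j then 1 else 0) * ((if k = l then 1 else 0) / d)
        + (if q = l then 1 else 0) * ((if a = b then 1 else 0) * (if k = j then 1 else 0) / d) := by
    intro q k
    have h := Finset.sum_congr (rfl : (Finset.univ : Finset (Fin d)) = _) fun p _ =>
      haarMoment_single ![a, b] ![a, b] ![p, k] ![j, l] p q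
    have e1 : ∀ p r : Fin d, Function.update ![p, k] 0 r = ![r, k] := by
      intro p r; ext t; fin_cases t <;> simp
    have e2 : ∀ p r : Fin d, Function.update ![p, k] 1 r = ![p, r] := by
      intro p r; ext t; fin_cases t <;> simp
    have e3 : ∀ r : Fin d, Function.update ![j, l] 0 r = ![r, l] := by
      intro r; ext t; fin_cases t <;> simp
    have e4 : ∀ r : Fin d, Function.update ![j, l] 1 r = ![j, r] := by
      intro r; ext t; fin_cases t <;> simp
    simp only [Fin.sum_univ_two, Matrix.cons_val_zero, Matrix.cons_val_one, e1, e2, e3, e4,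
      if_true, Finset.sum_add_distrib, Finset.sum_const, Finset.card_univ, Fintype.card_fin,
      nsmul_eq_mul, Finset.sum_ite_eq, Finset.mem_univ] at h
    rw [h, ← hA, ← hB]
    simp only [eq_comm (a := q), ite_mul, one_mul, zero_mul]
    congr 1 <;> split_ifs <;> simp
  have h1 := key i k
  have h2 := key k i
  rw [← hm, eq_div_iff sq_sub_one_ne_zero_of_two]
  have h3 : (d : ℂ) * (d : ℂ)⁻¹ = 1 := mul_inv_cancel₀ hd
  simp only [div_eq_mul_inv] at h1 h2 ⊢
  linear_combination (d : ℂ) * h1 - h2 + ((if i = j then 1 else 0) * (if k = l then 1 else 0)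
    + (if i = l then 1 else 0) * ((if a = b then 1 else 0) * (if k = j then 1 else 0))) * h3

theorem pureState_apply {d : ℕ} (V : U d) (a i j : Fin d) :
    pureState V a i j = (V : Op (Fin d)) i a * star ((V : Op (Fin d)) j a) := by
  simp [pureState, Matrix.mul_apply, Matrix.single_apply, ite_and]

@[fun_prop]
theorem continuous_pureState_apply {d : ℕ} (a i j : Fin d) :
    Continuous fun V : U d => pureState V a i j := by
  simp only [pureState_apply]
  fun_prop

theorem linearMap_eq_sum {d : ℕ} {M : Type*} [AddCommGroup M] [Module ℂ M]
    (f : Op (Fin d) →ₗ[ℂ] M) (X : Op (Fin d)) :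
    f X = ∑ i, ∑ j, X i j • f (Matrix.single i j 1) := by
  conv_lhs => rw [Matrix.matrix_eq_sum_single X]
  simp only [map_sum, ← map_smul, Matrix.smul_single, smul_eq_mul, mul_one]

theorem continuous_linearMap_pureState {d : ℕ} {m n : Type}
    (f : Op (Fin d) →ₗ[ℂ] Matrix m n ℂ) (a : Fin d) (p : m) (q : n) :
    Continuous fun V : U d => f (pureState V a) p q := by
  have : (fun V : U d => f (pureState V a) p q)
      = fun V => ∑ i, ∑ j, pureState V a i j * f (Matrix.single i j 1) p q := by
    ext V
    rw [linearMap_eq_sum f]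
    simp [Matrix.sum_apply]
  rw [this]
  fun_prop

/-- The second moment of Haar-random orthogonal states, for an arbitrary bilinear form. -/
theorem integral_bilin_pureState {d : ℕ} [d.AtLeastTwo]
    (β : Op (Fin d) →ₗ[ℂ] Op (Fin d) →ₗ[ℂ] ℂ) (a b : Fin d) :
    ∫ V, β (pureState V a) (pureState V b) ∂(haar d)
      = ((1 - (if a = b then 1 else 0) / d) * β 1 1 + ((if a = b then 1 else 0) - 1 / d)
        * ∑ i, ∑ j, β (Matrix.single i j 1) (Matrix.single j i 1)) / ((d : ℂ) ^ 2 - 1) := by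
  have expand : ∀ X Y : Op (Fin d), β X Y
      = ∑ i, ∑ j, ∑ k, ∑ l, X i j * Y k l * β (Matrix.single i j 1) (Matrix.single k l 1) := by
    intro X Y
    rw [linearMap_eq_sum β X]
    simp only [LinearMap.sum_apply, LinearMap.smul_apply, smul_eq_mul]
    refine Finset.sum_congr rfl fun i _ => Finset.sum_congr rfl fun j _ => ?_
    rw [linearMap_eq_sum (β (Matrix.single i j 1)) Y]
    simp only [Finset.mul_sum, smul_eq_mul, mul_assoc]
  have h1 : ∫ V, β (pureState V a) (pureState V b) ∂(haar d)
      = ∑ i, ∑ j, ∑ k, ∑ l, (∫ V : U d, (V : Op (Fin d)) i a * star ((V : Op (Fin d)) j a)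
        * ((V : Op (Fin d)) k b * star ((V : Op (Fin d)) l b)) ∂(haar d))
        * β (Matrix.single i j 1) (Matrix.single k l 1) := by
    simp only [expand (pureState _ _), pureState_apply]
    rw [integral_finsetSum _ fun p _ => integrable_haar (by fun_prop)]
    refine Finset.sum_congr rfl fun i _ => ?_
    rw [integral_finsetSum _ fun p _ => integrable_haar (by fun_prop)]
    refine Finset.sum_congr rfl fun j _ => ?_
    rw [integral_finsetSum _ fun p _ => integrable_haar (by fun_prop)]
    refine Finset.sum_congr rfl fun k _ => ?_
    rw [integral_finsetSum _ fun p _ => integrable_haar (by fun_prop)]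
    refine Finset.sum_congr rfl fun l _ => ?_
    rw [integral_mul_const]
  have h2 : β 1 1 = ∑ i, ∑ k, β (Matrix.single i i 1) (Matrix.single k k 1) := by
    rw [expand 1 1]
    simp [Matrix.one_apply]
  rw [h1, h2]
  simp only [integral_entry_mul_four, div_mul_eq_mul_div, add_mul, ← Finset.sum_div,
    Finset.sum_add_distrib]
  congr 2
  · simp [Finset.mul_sum]
  · simp only [Finset.mul_sum]
    refine Finset.sum_congr rfl fun i _ => Finset.sum_congr rfl fun j _ => ?_
    rw [Finset.sum_comm]
    simp

theorem integral_conj_haar {d : ℕ} [d.AtLeastTwo] (A : Op (Fin d)) (i j : Fin d) :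
    ∫ W : U d, ((W : Op (Fin d)) * A * (W : Op (Fin d))ᴴ) i j ∂(haar d)
      = if i = j then A.trace / d else 0 := by
  simp only [Matrix.mul_apply, Finset.sum_mul, Matrix.conjTranspose_apply]
  rw [integral_finsetSum _ fun p _ => integrable_haar (by fun_prop)]
  have h : ∀ l, ∫ W : U d, ∑ k, (W : Op (Fin d)) i k * A k l * star ((W : Op (Fin d)) j l) ∂(haar d)
      = ∑ k, A k l * ((if i = j then 1 else 0) * (if k = l then 1 else 0) / d) := by
    intro l
    rw [integral_finsetSum _ fun p _ => integrable_haar (by fun_prop)]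
    refine Finset.sum_congr rfl fun k _ => ?_
    rw [← integral_entry_mul, ← integral_const_mul]
    congr 1
    ext V
    ring
  simp only [h]
  by_cases hij : i = j
  · simp [hij, Matrix.trace, div_eq_mul_inv, Finset.sum_mul]
  · simp [hij]

/-! ### The alternative unitarity as a quadratic form -/

/-- The bilinear form `tr[E(X) E(Y)]`. -/
def outputForm {d : ℕ} (E : Op (Fin d) →ₗ[ℂ] Op (Fin d)) :
    Op (Fin d) →ₗ[ℂ] Op (Fin d) →ₗ[ℂ] ℂ :=
  LinearMap.mk₂ ℂ (fun X Y => (E X * E Y).trace)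
    (by intros; simp [add_mul]) (by intros; simp) (by intros; simp [mul_add]) (by intros; simp)

/-- The bilinear form `tr[E(X)] tr[E(Y)]`. -/
def traceForm {d : ℕ} (E : Op (Fin d) →ₗ[ℂ] Op (Fin d)) :
    Op (Fin d) →ₗ[ℂ] Op (Fin d) →ₗ[ℂ] ℂ :=
  LinearMap.mk₂ ℂ (fun X Y => (E X).trace * (E Y).trace)
    (by intros; simp [add_mul]) (by intros; simp [mul_assoc]) (by intros; simp [mul_add])
    (by intros; simp [mul_left_comm])

@[simp]
theorem outputForm_apply {d : ℕ} (E : Op (Fin d) →ₗ[ℂ] Op (Fin d)) (X Y : Op (Fin d)) :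
    outputForm E X Y = (E X * E Y).trace := rfl

@[simp]
theorem traceForm_apply {d : ℕ} (E : Op (Fin d) →ₗ[ℂ] Op (Fin d)) (X Y : Op (Fin d)) :
    traceForm E X Y = (E X).trace * (E Y).trace := rfl

/-- The sum of a bilinear form over pairs of dual matrix units. -/
def swapSum {d : ℕ} (β : Op (Fin d) →ₗ[ℂ] Op (Fin d) →ₗ[ℂ] ℂ) : ℂ :=
  ∑ i, ∑ j, β (Matrix.single i j 1) (Matrix.single j i 1)

/-- Maps that commute with the adjoint. -/
def IsHermPres {m n : Type} (E : Op m →ₗ[ℂ] Op n) : Prop := ∀ X, (E X)ᴴ = E Xᴴ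

theorem IsChannel.isHermPres {d : ℕ} {E : Op (Fin d) →ₗ[ℂ] Op (Fin d)} (hE : IsChannel E) :
    IsHermPres E := by
  obtain ⟨r, K, _, hK⟩ := hE
  intro X
  rw [hK, hK, Matrix.conjTranspose_sum]
  refine Finset.sum_congr rfl fun i _ => ?_
  simp [Matrix.conjTranspose_mul, mul_assoc]

theorem pureState_conjTranspose {d : ℕ} (V : U d) (a : Fin d) :
    (pureState V a)ᴴ = pureState V a := by
  simp [pureState, Matrix.conjTranspose_mul, mul_assoc]

theorem pureState_trace {d : ℕ} (V : U d) (a : Fin d) : (pureState V a).trace = 1 := by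
  have h := sum_star_mul_entry V a a
  simpa [Matrix.trace, pureState_apply] using h

theorem IsHermPres.pureState {d : ℕ} {E : Op (Fin d) →ₗ[ℂ] Op (Fin d)} (hE : IsHermPres E)
    (V : U d) (a : Fin d) : (E (pureState V a))ᴴ = E (pureState V a) := by
  rw [hE, pureState_conjTranspose]

theorem isHermPres_depolarizing (d : ℕ) : IsHermPres (depolarizing d) := by
  intro X
  simp [depolarizing, Matrix.trace_conjTranspose]

theorem IsHermPres.primed {d : ℕ} {E : Op (Fin d) →ₗ[ℂ] Op (Fin d)} (hE : IsHermPres E) :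
    IsHermPres (primed E) := by
  have h : IsHermPres (tracelessPart d) := by
    intro X
    simp [tracelessPart, Matrix.conjTranspose_sub, isHermPres_depolarizing d X]
  intro X
  simp only [UnitarityEstimation.primed, LinearMap.comp_apply, h _, hE _]

theorem continuous_bilin_pureState {d : ℕ} (β : Op (Fin d) →ₗ[ℂ] Op (Fin d) →ₗ[ℂ] ℂ)
    (a b : Fin d) : Continuous fun V => β (pureState V a) (pureState V b) := by
  have : (fun V : U d => β (pureState V a) (pureState V b)) = fun V =>
      ∑ i, ∑ j, pureState V a i j * ∑ k, ∑ l, pureState V b k l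
        * β (Matrix.single i j 1) (Matrix.single k l 1) := by
    ext V
    rw [linearMap_eq_sum β]
    simp only [LinearMap.sum_apply, LinearMap.smul_apply, smul_eq_mul]
    refine Finset.sum_congr rfl fun i _ => Finset.sum_congr rfl fun j _ => ?_
    rw [linearMap_eq_sum (β (Matrix.single i j 1))]
    simp
  rw [this]
  fun_prop

theorem integral_re_bilin_pureState {d : ℕ} [d.AtLeastTwo]
    (β : Op (Fin d) →ₗ[ℂ] Op (Fin d) →ₗ[ℂ] ℂ) (a b : Fin d) :
    ∫ V, (β (pureState V a) (pureState V b)).re ∂(haar d)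
      = (((1 - (if a = b then 1 else 0) / d) * β 1 1 + ((if a = b then 1 else 0) - 1 / d)
        * swapSum β) / ((d : ℂ) ^ 2 - 1)).re := by
  rw [swapSum, ← integral_bilin_pureState]
  exact integral_re (integrable_haar (continuous_bilin_pureState β a b))

/-- The form `tr[E'(X) E'(Y)]`, on traceless operators. -/
def centeredForm {d : ℕ} (E : Op (Fin d) →ₗ[ℂ] Op (Fin d)) :
    Op (Fin d) →ₗ[ℂ] Op (Fin d) →ₗ[ℂ] ℂ :=
  outputForm E - (1 / (d : ℂ)) • traceForm E

theorem centeredForm_apply {d : ℕ} (E : Op (Fin d) →ₗ[ℂ] Op (Fin d)) (X Y : Op (Fin d)) :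
    centeredForm E X Y = (E X * E Y).trace - 1 / d * ((E X).trace * (E Y).trace) := rfl

theorem outputForm_primed {d : ℕ} [d.AtLeastTwo] (E : Op (Fin d) →ₗ[ℂ] Op (Fin d))
    (X Y : Op (Fin d)) :
    outputForm (primed E) X Y = centeredForm E (tracelessPart d X) (tracelessPart d Y) := by
  have hd := natCast_ne_zero_of_two (d := d)
  simp only [outputForm_apply, centeredForm_apply, primed, LinearMap.comp_apply]
  generalize E (tracelessPart d X) = A
  generalize E (tracelessPart d Y) = B
  simp only [tracelessPart, depolarizing, LinearMap.sub_apply, LinearMap.id_coe, id_eq,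
    LinearMap.coe_mk, AddHom.coe_mk, sub_mul, mul_sub, Matrix.trace_sub, smul_mul_assoc,
    mul_smul_comm, one_mul, mul_one, Matrix.trace_smul, Matrix.trace_one, Fintype.card_fin,
    smul_eq_mul]
  field_simp
  ring

/-- Removing the trace changes only the diagonal matrix units, and these sum to the identity. -/
theorem swapSum_traceless {d : ℕ} [d.AtLeastTwo] (β : Op (Fin d) →ₗ[ℂ] Op (Fin d) →ₗ[ℂ] ℂ) :
    ∑ i, ∑ j, β (tracelessPart d (Matrix.single i j 1)) (tracelessPart d (Matrix.single j i 1))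
      = swapSum β - β 1 1 / d := by
  have hd := natCast_ne_zero_of_two (d := d)
  have h1 : ∀ i j : Fin d, β (tracelessPart d (Matrix.single i j 1))
      (tracelessPart d (Matrix.single j i 1))
      = β (Matrix.single i j 1) (Matrix.single j i 1)
        - (if i = j then 1 / (d : ℂ) * (β (Matrix.single i i 1) 1 + β 1 (Matrix.single i i 1)
          - 1 / d * β 1 1) else 0) := by
    intro i j
    by_cases hij : i = j
    · subst hij
      simp only [tracelessPart, depolarizing, LinearMap.sub_apply, LinearMap.id_coe, id_eq,
        LinearMap.coe_mk, AddHom.coe_mk, map_sub, map_smul, LinearMap.smul_apply, smul_eq_mul,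
        Matrix.trace_single_eq_same, if_true]
      ring
    · simp [tracelessPart, depolarizing, hij, Ne.symm hij]
  have h2 : ∑ i, β (Matrix.single i i 1) 1 = β 1 1 := by
    rw [← LinearMap.sum_apply, ← map_sum]
    congr 2
    ext a b
    simp [Matrix.sum_apply, Matrix.single_apply, Matrix.one_apply, ite_and]
  have h3 : ∑ i, β 1 (Matrix.single i i 1) = β 1 1 := by
    rw [← map_sum]
    congr 1
    ext a b
    simp [Matrix.sum_apply, Matrix.single_apply, Matrix.one_apply, ite_and]
  simp only [h1, Finset.sum_sub_distrib, Finset.sum_ite_eq, Finset.mem_univ, if_true,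
    ← Finset.mul_sum, Finset.sum_add_distrib, h2, h3, swapSum]
  simp
  field_simp
  ring

/-- Since `primed E` annihilates the identity, only the `swapSum` term of the second moment
survives. The prefactor `d / (d - 1)` cancels its coefficient `1 - 1 / d`. -/
theorem altUnitarity_eq {d : ℕ} [d.AtLeastTwo] {E : Op (Fin d) →ₗ[ℂ] Op (Fin d)}
    (hE : IsHermPres E) : altUnitarity E
      = ((swapSum (centeredForm E) - centeredForm E 1 1 / d) / ((d : ℂ) ^ 2 - 1)).re := by
  have hd := natCast_ne_zero_of_two (d := d)
  have h2 : 2 ≤ d := Nat.AtLeastTwo.prop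
  have hd1 : (d : ℂ) - 1 ≠ 0 := by
    rw [sub_ne_zero]
    norm_cast
    omega
  have h1 : ∀ V : U d, ((primed E (pureState V 0))ᴴ * primed E (pureState V 0)).trace
      = outputForm (primed E) (pureState V 0) (pureState V 0) := by
    intro V
    rw [hE.primed.pureState, outputForm_apply]
  have h3 : swapSum (outputForm (primed E)) = swapSum (centeredForm E) - centeredForm E 1 1 / d := by
    rw [← swapSum_traceless]
    simp only [swapSum, outputForm_primed]
  rw [altUnitarity]
  simp only [h1]
  rw [integral_re_bilin_pureState, h3, outputForm_apply, primed_one]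
  have h4 : ∀ z : ℂ, (d : ℝ) / (d - 1) * z.re = ((d : ℂ) / (d - 1) * z).re := by
    intro z
    rw [← Complex.re_ofReal_mul]
    push_cast
    rfl
  rw [h4]
  congr 1
  simp only [if_true, mul_zero, Matrix.trace_zero, zero_add]
  field_simp

theorem fin_zero_ne_one {d : ℕ} [d.AtLeastTwo] : (0 : Fin d) ≠ 1 := by
  have h2 : 2 ≤ d := Nat.AtLeastTwo.prop
  intro h
  have := congrArg Fin.val h
  rw [Fin.val_zero, Fin.val_one', Nat.mod_eq_of_lt (by omega)] at this
  omega

/-- The alternative unitarity in terms of a pair of orthogonal states. -/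
theorem altUnitarity_eq_integral {d : ℕ} [d.AtLeastTwo] {E : Op (Fin d) →ₗ[ℂ] Op (Fin d)}
    (hE : IsHermPres E) : altUnitarity E
      = ∫ V, (centeredForm E (pureState V 0) (pureState V 0)
          - centeredForm E (pureState V 0) (pureState V 1)).re ∂(haar d) := by
  have hd := natCast_ne_zero_of_two (d := d)
  simp only [Complex.sub_re]
  rw [integral_sub, integral_re_bilin_pureState, integral_re_bilin_pureState, altUnitarity_eq hE,
    ← Complex.sub_re, if_pos rfl, if_neg fin_zero_ne_one]
  · congr 1
    have := sq_sub_one_ne_zero_of_two (d := d)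
    field_simp
    ring
  · exact integrable_haar (Complex.continuous_re.comp (continuous_bilin_pureState _ _ _))
  · exact integrable_haar (Complex.continuous_re.comp (continuous_bilin_pureState _ _ _))

/-- Averaging over `W` replaces the second copy of the output by its trace times the maximally mixed
state, which leaves a second moment of `traceForm`. -/
theorem sIndex_eq {d : ℕ} [d.AtLeastTwo] {E : Op (Fin d) →ₗ[ℂ] Op (Fin d)} (hE : IsHermPres E) :
    sIndex E = ((1 / (d : ℂ)) * (((1 - 1 / d) * traceForm E 1 1 + (1 - 1 / d)
        * swapSum (traceForm E)) / ((d : ℂ) ^ 2 - 1))).re := by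
  have hd := natCast_ne_zero_of_two (d := d)
  have hinner : ∀ A : Op (Fin d),
      ∫ W : U d, (A * conjMap (W : Op (Fin d)) A).trace.re ∂(haar d)
        = (1 / (d : ℂ) * (A.trace * A.trace)).re := by
    intro A
    have hc : ∀ i j : Fin d, Continuous fun W : U d =>
        ((W : Op (Fin d)) * A * (W : Op (Fin d))ᴴ) i j := by
      intro i j
      simp only [Matrix.mul_apply, Matrix.conjTranspose_apply]
      fun_prop
    have h1 : ∫ W : U d, (A * conjMap (W : Op (Fin d)) A).trace ∂(haar d)
        = 1 / (d : ℂ) * (A.trace * A.trace) := by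
      simp only [Matrix.trace, Matrix.diag_apply, Matrix.mul_apply (M := A), conjMap,
        LinearMap.coe_mk, AddHom.coe_mk]
      rw [integral_finsetSum _ fun i _ => integrable_haar (by fun_prop)]
      have h2 : ∀ i, ∫ W : U d, ∑ j, A i j * ((W : Op (Fin d)) * A * (W : Op (Fin d))ᴴ) j i ∂(haar d)
          = A i i * (A.trace / d) := by
        intro i
        rw [integral_finsetSum _ fun i _ => integrable_haar (by fun_prop)]
        simp [integral_const_mul, integral_conj_haar]
      have hA : ∑ i, A i i = A.trace := rfl
      simp only [h2, ← Finset.sum_mul, hA]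
      ring
    have hcont : Continuous fun W : U d => (A * conjMap (W : Op (Fin d)) A).trace := by
      simp only [Matrix.trace, Matrix.diag_apply, Matrix.mul_apply (M := A), conjMap,
        LinearMap.coe_mk, AddHom.coe_mk]
      fun_prop
    rw [← h1]
    exact integral_re (integrable_haar hcont)
  have h3 : ∀ V : U d, 1 / (d : ℂ) * ((E (pureState V 0)).trace * (E (pureState V 0)).trace)
      = ((1 / (d : ℂ)) • traceForm E) (pureState V 0) (pureState V 0) := fun V => rfl
  unfold sIndex
  simp only [hE.pureState, hinner, h3]
  rw [integral_re_bilin_pureState, if_pos rfl]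
  congr 1
  have h4 : swapSum ((1 / (d : ℂ)) • traceForm E) = 1 / d * swapSum (traceForm E) := by
    simp [swapSum, Finset.mul_sum]
  rw [h4]
  simp only [LinearMap.smul_apply, smul_eq_mul]
  ring

/-- Both sides are linear in `swapSum` and in the value at `(1, 1)` of the two forms `outputForm`
and `traceForm`; the four coefficients agree. -/
theorem altUnitarity_identity {d : ℕ} [d.AtLeastTwo] {E : Op (Fin d) →ₗ[ℂ] Op (Fin d)}
    (hE : IsHermPres E) :
    altUnitarity E = purityIndex E - orthogonalityIndex E - (d : ℝ) / (d - 1) * sIndex E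
        + 1 / ((d : ℝ) - 1) * traceIndex E ^ 2 := by
  have hd := natCast_ne_zero_of_two (d := d)
  have h2 : 2 ≤ d := Nat.AtLeastTwo.prop
  have hd1 : (d : ℂ) - 1 ≠ 0 := by
    rw [sub_ne_zero]
    norm_cast
    omega
  have hp : purityIndex E = _ := integral_re_bilin_pureState (outputForm E) 0 0
  have ho : orthogonalityIndex E = _ := integral_re_bilin_pureState (outputForm E) 1 0
  have ht : traceIndex E ^ 2 = ((1 / (d : ℂ) ^ 2) * traceForm E 1 1).re := by
    have hreal : (((E 1).trace).re : ℂ) = (E 1).trace := by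
      rw [← Complex.conj_eq_iff_re, ← Complex.star_def, ← Matrix.trace_conjTranspose, hE,
        Matrix.conjTranspose_one]
    rw [traceIndex, map_smul, Matrix.trace_smul, traceForm_apply, ← hreal, smul_eq_mul]
    have : (1 / (d : ℂ)) = ((1 / d : ℝ) : ℂ) := by push_cast; rfl
    have h' : (1 / (d : ℂ) ^ 2) = ((1 / d ^ 2 : ℝ) : ℂ) := by push_cast; rfl
    simp only [this, h', ← Complex.ofReal_mul, Complex.ofReal_re]
    ring
  have h4 : ∀ z : ℂ, (d : ℝ) / (d - 1) * z.re = ((d : ℂ) / (d - 1) * z).re := by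
    intro z
    rw [← Complex.re_ofReal_mul]
    push_cast
    rfl
  have h5 : ∀ z : ℂ, 1 / ((d : ℝ) - 1) * z.re = (1 / ((d : ℂ) - 1) * z).re := by
    intro z
    rw [← Complex.re_ofReal_mul]
    push_cast
    rfl
  rw [hp, ho, ht, sIndex_eq hE, altUnitarity_eq hE, h4, h5, ← Complex.sub_re, ← Complex.sub_re,
    ← Complex.add_re, if_pos rfl, if_neg fin_zero_ne_one.symm]
  congr 1
  have h6 : swapSum (centeredForm E) = swapSum (outputForm E) - 1 / d * swapSum (traceForm E) := by
    simp [swapSum, centeredForm, Finset.mul_sum]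
  have h7 : centeredForm E 1 1 = outputForm E 1 1 - 1 / d * traceForm E 1 1 := rfl
  rw [h6, h7]
  have h8 : (d : ℂ) + 1 ≠ 0 := by exact_mod_cast Nat.succ_ne_zero d
  have h9 : (d : ℂ) ^ 2 - 1 = (d - 1) * (d + 1) := by ring
  rw [h9]
  generalize swapSum (outputForm E) = a
  generalize swapSum (traceForm E) = b
  generalize outputForm E 1 1 = c
  generalize traceForm E 1 1 = e
  field_simp
  ring

/-! ### Unital trace-preserving maps -/

/-- Here `centeredForm E 1 1 = d - d² / d = 0`, and the `swapSum` of the trace form is `d`. -/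
theorem altUnitarity_of_unital {d : ℕ} [d.AtLeastTwo] {E : Op (Fin d) →ₗ[ℂ] Op (Fin d)}
    (hE : IsHermPres E) (h1 : E 1 = 1) (htr : ∀ X, (E X).trace = X.trace) :
    altUnitarity E = ((swapSum (outputForm E) - 1) / ((d : ℂ) ^ 2 - 1)).re := by
  have hd := natCast_ne_zero_of_two (d := d)
  have h6 : swapSum (centeredForm E) = swapSum (outputForm E) - 1 := by
    have : swapSum (traceForm E) = d := by
      simp only [swapSum, traceForm_apply, htr]
      have : ∀ i j : Fin d, (Matrix.single i j (1 : ℂ)).trace * (Matrix.single j i (1 : ℂ)).trace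
          = if i = j then 1 else 0 := by
        intro i j
        by_cases hij : i = j
        · subst hij; simp
        · simp [hij, Matrix.trace_single_eq_of_ne]
      simp [this]
    have h7 : swapSum (centeredForm E)
        = swapSum (outputForm E) - 1 / d * swapSum (traceForm E) := by
      simp [swapSum, centeredForm, Finset.mul_sum]
    rw [h7, this]
    field_simp
  rw [altUnitarity_eq hE, h6, centeredForm_apply, h1]
  simp only [mul_one, Matrix.trace_one, Fintype.card_fin]
  congr 1
  field_simp
  ring

/-- The blocks of the Jamiołkowski state are the images of the matrix units, divided by `d`. -/
theorem unitarity_eq {d : ℕ} (E : Op (Fin d) →ₗ[ℂ] Op (Fin d)) :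
    unitarity E = (swapSum (outputForm E) / (d : ℂ) ^ 2).re := by
  have hj : ∀ p q, jamiolkowski E p q = 1 / d * E (Matrix.single p.2 q.2 1) p.1 q.1 := by
    intro p q
    have : (Matrix.of fun i j => (if i = p.2 ∧ j = q.2 then 1 / (d : ℂ) else 0))
        = (1 / (d : ℂ)) • Matrix.single p.2 q.2 1 := by
      ext i j
      simp [Matrix.single_apply, eq_comm]
    have h2 : jamiolkowski E p q
        = E (Matrix.of fun i j => (if i = p.2 ∧ j = q.2 then 1 / (d : ℂ) else 0)) p.1 q.1 := rfl
    rw [h2, this, map_smul]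
    rfl
  unfold unitarity
  congr 1
  simp only [Matrix.trace, Matrix.diag_apply, Matrix.mul_apply, hj, Fintype.sum_prod_type, swapSum,
    outputForm_apply, Finset.sum_div]
  have : ∀ f : Fin d → Fin d → Fin d → Fin d → ℂ,
      ∑ a, ∑ b, ∑ c, ∑ e, f a b c e = ∑ b, ∑ e, ∑ a, ∑ c, f a b c e := by
    intro f
    rw [Finset.sum_comm]
    refine Finset.sum_congr rfl fun b _ => ?_
    rw [Finset.sum_congr rfl fun a _ => Finset.sum_comm, Finset.sum_comm]
  rw [this]
  refine Finset.sum_congr rfl fun i _ => Finset.sum_congr rfl fun j _ => Finset.sum_congr rfl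
    fun a _ => Finset.sum_congr rfl fun b _ => ?_
  ring

theorem isHermPres_conjMap {d : ℕ} (A : Op (Fin d)) : IsHermPres (conjMap A) := by
  intro X
  simp [conjMap, Matrix.conjTranspose_mul, mul_assoc]

theorem conjMap_one {d : ℕ} (V : U d) : conjMap (V : Op (Fin d)) 1 = 1 := by
  have := Matrix.mem_unitaryGroup_iff.mp V.2
  rw [Matrix.star_eq_conjTranspose] at this
  simp [conjMap, this]

theorem conjMap_trace {d : ℕ} (V : U d) (X : Op (Fin d)) :
    (conjMap (V : Op (Fin d)) X).trace = X.trace := by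
  have := Matrix.mem_unitaryGroup_iff'.mp V.2
  rw [Matrix.star_eq_conjTranspose] at this
  simp only [conjMap, LinearMap.coe_mk, AddHom.coe_mk]
  rw [Matrix.trace_mul_comm, ← mul_assoc, this, one_mul]

theorem altUnitarity_depolarizing (d : ℕ) [d.AtLeastTwo] : altUnitarity (depolarizing d) = 0 := by
  have hd := natCast_ne_zero_of_two (d := d)
  rw [altUnitarity_of_unital (isHermPres_depolarizing d)]
  · have : swapSum (outputForm (depolarizing d)) = 1 := by
      have h1 : ∀ i j : Fin d, outputForm (depolarizing d) (Matrix.single i j 1)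
          (Matrix.single j i 1) = if i = j then 1 / (d : ℂ) else 0 := by
        intro i j
        by_cases hij : i = j
        · subst hij
          simp [depolarizing, hd]
        · simp [depolarizing, hij]
      simp only [swapSum, h1]
      simp [hd]
    simp [this]
  · simp [depolarizing, hd]
  · intro X
    simp [depolarizing, hd]

theorem outputForm_conjMap {d : ℕ} (V : U d) (X Y : Op (Fin d)) :
    outputForm (conjMap (V : Op (Fin d))) X Y = (X * Y).trace := by
  have hV := Matrix.mem_unitaryGroup_iff'.mp V.2
  rw [Matrix.star_eq_conjTranspose] at hV
  have : conjMap (V : Op (Fin d)) X * conjMap (V : Op (Fin d)) Y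
      = conjMap (V : Op (Fin d)) (X * Y) := by
    simp only [conjMap, LinearMap.coe_mk, AddHom.coe_mk]
    calc _ = (V : Op (Fin d)) * X * ((V : Op (Fin d))ᴴ * (V : Op (Fin d))) * Y
          * (V : Op (Fin d))ᴴ := by simp only [mul_assoc]
      _ = _ := by rw [hV, mul_one, mul_assoc (V : Op (Fin d)) X Y]
  rw [outputForm_apply, this, conjMap_trace]

theorem altUnitarity_conjMap {d : ℕ} [d.AtLeastTwo] (V : U d) :
    altUnitarity (conjMap (V : Op (Fin d))) = 1 := by
  rw [altUnitarity_of_unital (isHermPres_conjMap _) (conjMap_one V) (conjMap_trace V)]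
  have : swapSum (outputForm (conjMap (V : Op (Fin d)))) = d ^ 2 := by
    simp only [swapSum, outputForm_conjMap]
    simp [sq]
  rw [this, div_self sq_sub_one_ne_zero_of_two, Complex.one_re]

theorem shift_mem_unitaryGroup (d : ℕ) [NeZero d] :
    shift d ∈ Matrix.unitaryGroup (Fin d) ℂ := by
  rw [Matrix.mem_unitaryGroup_iff']
  ext i j
  simp [Matrix.mul_apply, shift, Matrix.one_apply, Matrix.star_apply, eq_comm]

theorem isHermPres_shiftMixture (d : ℕ) [NeZero d] (a b : ℝ) :
    IsHermPres (shiftMixture d a b) := by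
  intro X
  simp [shiftMixture, isHermPres_conjMap _ X]

/-- Each of the two unitary channels contributes `d²`. The cross terms are products of diagonal
entries of the shift, which vanish because `1 ≠ 0` modulo `d`. -/
theorem swapSum_shiftMixture (d : ℕ) [d.AtLeastTwo] (a b : ℝ) :
    swapSum (outputForm (shiftMixture d a b)) = (a ^ 2 + b ^ 2) * d ^ 2 := by
  have h10 : ∀ i : Fin d, i ≠ i + 1 := by
    intro i h
    have : (1 : Fin d) = 0 := by simpa using h.symm
    exact fin_zero_ne_one this.symm
  have hdiag : ∀ i, shift d i i = 0 := by
    intro i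
    simp [shift, h10 i]
  have hX := outputForm_conjMap (⟨shift d, shift_mem_unitaryGroup d⟩ : U d)
  simp only [outputForm_apply] at hX
  have h1 : ∀ i j : Fin d, (Matrix.single i j 1 * conjMap (shift d) (Matrix.single j i 1)).trace
      = 0 := by
    intro i j
    simp [conjMap, Matrix.trace, Matrix.mul_apply, Matrix.single_apply, ite_and, hdiag]
  have h2 : ∀ i j : Fin d, outputForm (shiftMixture d a b) (Matrix.single i j 1)
      (Matrix.single j i 1) = (a : ℂ) ^ 2 + (b : ℂ) ^ 2 := by
    intro i j
    have h3 : (conjMap (shift d) (Matrix.single i j 1) * Matrix.single j i 1).trace = 0 := by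
      rw [Matrix.trace_mul_comm, h1]
    simp only [outputForm_apply, shiftMixture, LinearMap.add_apply, LinearMap.smul_apply,
      LinearMap.id_coe, id_eq, add_mul, mul_add, smul_mul_smul_comm, Matrix.trace_add,
      Matrix.trace_smul, h1, h3, hX]
    simp [sq]
  simp only [swapSum, h2]
  simp
  ring

theorem altUnitarity_shiftMixture (d : ℕ) [d.AtLeastTwo] (a b : ℝ) (hab : a + b = 1) :
    altUnitarity (shiftMixture d a b) = ((a ^ 2 + b ^ 2) * d ^ 2 - 1) / ((d : ℝ) ^ 2 - 1) := by
  have hc : (a : ℂ) + b = 1 := by exact_mod_cast hab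
  have h1 := conjMap_one (⟨shift d, shift_mem_unitaryGroup d⟩ : U d)
  have h2 := conjMap_trace (⟨shift d, shift_mem_unitaryGroup d⟩ : U d)
  rw [altUnitarity_of_unital (isHermPres_shiftMixture d a b), swapSum_shiftMixture]
  · have : (((a : ℂ) ^ 2 + (b : ℂ) ^ 2) * d ^ 2 - 1) / ((d : ℂ) ^ 2 - 1)
        = ((((a ^ 2 + b ^ 2) * d ^ 2 - 1) / ((d : ℝ) ^ 2 - 1) : ℝ) : ℂ) := by
      push_cast
      rfl
    rw [this, Complex.ofReal_re]
  · simp only [shiftMixture, LinearMap.add_apply, LinearMap.smul_apply, LinearMap.id_coe, id_eq,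
      h1, ← add_smul, hc, one_smul]
  · intro X
    simp only [shiftMixture, LinearMap.add_apply, LinearMap.smul_apply, LinearMap.id_coe, id_eq,
      Matrix.trace_add, Matrix.trace_smul, h2, ← add_smul, hc, one_smul]

theorem unitarity_shiftMixture (d : ℕ) [d.AtLeastTwo] (a b : ℝ) :
    unitarity (shiftMixture d a b) = a ^ 2 + b ^ 2 := by
  rw [unitarity_eq, swapSum_shiftMixture, mul_div_assoc,
    div_self (pow_ne_zero 2 natCast_ne_zero_of_two), mul_one]
  exact_mod_cast rfl

theorem shiftMixture_gap (d : ℕ) [d.AtLeastTwo] (ε : ℝ) (hε : 0 < ε) :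
    altUnitarity (shiftMixture d (2 / 3 + ε) (1 / 3 - ε))
        - altUnitarity (shiftMixture d (2 / 3) (1 / 3))
      = (d : ℝ) ^ 2 / ((d : ℝ) ^ 2 - 1) *
        (unitarity (shiftMixture d (2 / 3 + ε) (1 / 3 - ε))
          - unitarity (shiftMixture d (2 / 3) (1 / 3))) ∧
    2 / 3 * ε ≤ altUnitarity (shiftMixture d (2 / 3 + ε) (1 / 3 - ε))
        - altUnitarity (shiftMixture d (2 / 3) (1 / 3)) := by
  have h2 : (2 : ℝ) ≤ d := by exact_mod_cast (Nat.AtLeastTwo.prop : 2 ≤ d)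
  have hpos : (0 : ℝ) < (d : ℝ) ^ 2 - 1 := by nlinarith
  have h1 : altUnitarity (shiftMixture d (2 / 3 + ε) (1 / 3 - ε))
        - altUnitarity (shiftMixture d (2 / 3) (1 / 3))
      = (d : ℝ) ^ 2 / ((d : ℝ) ^ 2 - 1) *
        (unitarity (shiftMixture d (2 / 3 + ε) (1 / 3 - ε))
          - unitarity (shiftMixture d (2 / 3) (1 / 3))) := by
    rw [altUnitarity_shiftMixture d _ _ (by ring), altUnitarity_shiftMixture d _ _ (by norm_num),
      unitarity_shiftMixture, unitarity_shiftMixture]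
    field_simp
    ring
  refine ⟨h1, ?_⟩
  rw [h1, unitarity_shiftMixture, unitarity_shiftMixture]
  have h3 : 1 ≤ (d : ℝ) ^ 2 / ((d : ℝ) ^ 2 - 1) := by
    rw [one_le_div hpos]
    linarith
  -- The two sides differ by `2 * ε ^ 2`.
  have h4 : 2 / 3 * ε ≤ (2 / 3 + ε) ^ 2 + (1 / 3 - ε) ^ 2 - ((2 / 3) ^ 2 + (1 / 3) ^ 2) := by
    nlinarith
  exact h4.trans (le_mul_of_one_le_left (le_trans (by positivity) h4) h3)

/-! ### Completely positive maps -/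

open scoped MatrixOrder in
theorem exists_factor_of_posSemidef {n : Type} [Fintype n] {A : Op n} (h : A.PosSemidef) :
    ∃ L : Op n, A = Lᴴ * L := by
  classical
  exact CStarAlgebra.nonneg_iff_eq_star_mul_self.mp (Matrix.nonneg_iff_posSemidef.mpr h)

theorem trace_mul_re_nonneg {n : Type} [Fintype n] {A B : Op n} (hA : A.PosSemidef)
    (hB : B.PosSemidef) : 0 ≤ (A * B).trace.re := by
  obtain ⟨L, rfl⟩ := exists_factor_of_posSemidef hA
  rw [mul_assoc, Matrix.trace_mul_comm]
  have h := (hB.mul_mul_conjTranspose_same L).trace_nonneg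
  exact (Complex.le_def.mp h).1

theorem isCP_posSemidef {m n : Type} [Fintype m] [Fintype n] {Φ : Op m →ₗ[ℂ] Op n} (h : IsCP Φ)
    {X : Op m} (hX : X.PosSemidef) : (Φ X).PosSemidef := by
  obtain ⟨r, K, hK⟩ := h
  rw [hK]
  exact Matrix.posSemidef_sum _ fun i _ => hX.mul_mul_conjTranspose_same (K i)

theorem isCP_of_fintype {m n ι : Type} [Fintype m] [Fintype ι] {Φ : Op m →ₗ[ℂ] Op n}
    (K : ι → Matrix n m ℂ) (h : ∀ X, Φ X = ∑ i, K i * X * (K i)ᴴ) : IsCP Φ := by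
  refine ⟨Fintype.card ι, fun i => K ((Fintype.equivFin ι).symm i), fun X => ?_⟩
  rw [h]
  exact Fintype.sum_equiv (Fintype.equivFin ι) _ _ fun i => by simp

open scoped Kronecker in
theorem amplify_of_kraus {m n ι a : Type} [Fintype m] [Fintype ι] [Fintype a] [DecidableEq a]
    {Φ : Op m →ₗ[ℂ] Op n} (K : ι → Matrix n m ℂ) (h : ∀ X, Φ X = ∑ i, K i * X * (K i)ᴴ)
    (M : Op (m × a)) : amplify a Φ M
      = ∑ i, (K i ⊗ₖ (1 : Op a)) * M * (K i ⊗ₖ (1 : Op a))ᴴ := by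
  ext p q
  simp only [amplify, LinearMap.coe_mk, AddHom.coe_mk, Matrix.of_apply, h, Matrix.sum_apply]
  refine Finset.sum_congr rfl fun i _ => ?_
  simp only [Matrix.mul_apply, Matrix.conjTranspose_apply, Matrix.kroneckerMap_apply,
    Fintype.sum_prod_type, Matrix.of_apply, Matrix.one_apply, star_mul']
  simp

theorem amplify_posSemidef {m n a : Type} [Fintype m] [Fintype n] [Fintype a] [DecidableEq a]
    {Φ : Op m →ₗ[ℂ] Op n} (hΦ : IsCP Φ) {M : Op (m × a)} (hM : M.PosSemidef) :
    (amplify a Φ M).PosSemidef := by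
  obtain ⟨r, K, hK⟩ := hΦ
  rw [amplify_of_kraus K hK]
  exact Matrix.posSemidef_sum _ fun i _ => hM.mul_mul_conjTranspose_same _

theorem amplify_trace {m n a : Type} [Fintype m] [Fintype n] [Fintype a]
    {Φ : Op m →ₗ[ℂ] Op n} (hΦ : ∀ X, (Φ X).trace = X.trace) (M : Op (m × a)) :
    (amplify a Φ M).trace = M.trace := by
  simp only [Matrix.trace, Matrix.diag_apply, Fintype.sum_prod_type_right]
  refine Finset.sum_congr rfl fun x _ => ?_
  exact hΦ (Matrix.of fun i j => M (i, x) (j, x))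

theorem withFailure_trace {d : ℕ} (E : Op (Fin d) →ₗ[ℂ] Op (Fin d)) (X : Op (Fin d)) :
    (withFailure E X).trace = X.trace := by
  simp only [Matrix.trace, Matrix.diag_apply, Fintype.sum_option]
  simp only [withFailure, LinearMap.coe_mk, AddHom.coe_mk, Matrix.of_apply, Matrix.trace,
    Matrix.diag_apply]
  ring

/-- An operator, regarded as mapping into the space extended by the failure state. -/
def padFailure {d : ℕ} (A : Op (Fin d)) : Matrix (Option (Fin d)) (Fin d) ℂ :=
  Matrix.of fun p j => match p with
    | some i => A i j
    | none => 0

theorem padFailure_mul_mul {d : ℕ} (A X B : Op (Fin d)) (p q : Option (Fin d)) :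
    (padFailure A * X * (padFailure B)ᴴ) p q = match p, q with
      | some i, some j => (A * X * Bᴴ) i j
      | _, _ => 0 := by
  rcases p with _ | i <;> rcases q with _ | j <;>
    simp [padFailure, Matrix.mul_apply, Matrix.conjTranspose_apply]

/-- If `1 - ∑ Kᵢ† Kᵢ = L† L`, then further Kraus operators that send the rows of `L` to the failure
state supply the missing trace. -/
theorem isCP_withFailure {d : ℕ} {E : Op (Fin d) →ₗ[ℂ] Op (Fin d)} (hE : IsChannel E) :
    IsCP (withFailure E) := by
  obtain ⟨r, K, hpos, hK⟩ := hE
  obtain ⟨L, hL⟩ := exists_factor_of_posSemidef hpos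
  refine isCP_of_fintype (ι := Fin r ⊕ Fin d)
    (Sum.elim (fun i => padFailure (K i)) (fun i => Matrix.of fun p j => match p with
      | some _ => 0
      | none => L i j)) fun X => ?_
  have h1 : X.trace - (E X).trace = ∑ j, (L * X * Lᴴ) j j := by
    have h3 : (L * X * Lᴴ).trace = X.trace - ∑ i, ((K i)ᴴ * K i * X).trace := by
      rw [Matrix.trace_mul_comm, ← mul_assoc, ← hL, sub_mul, one_mul, Matrix.trace_sub,
        Finset.sum_mul, Matrix.trace_sum]
    have h4 : (E X).trace = ∑ i, ((K i)ᴴ * K i * X).trace := by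
      rw [hK, Matrix.trace_sum]
      refine Finset.sum_congr rfl fun i _ => ?_
      rw [Matrix.trace_mul_comm, ← mul_assoc]
    rw [h4, ← h3]
    rfl
  clear hL hpos
  rw [Fintype.sum_sum_type]
  ext p q
  simp only [Sum.elim_inl, Sum.elim_inr, Matrix.add_apply, Matrix.sum_apply, padFailure_mul_mul]
  rcases p with _ | i <;> rcases q with _ | j
  · have h2 : withFailure E X none none = X.trace - (E X).trace := rfl
    rw [h2, h1]
    simp only [Finset.sum_const_zero, zero_add]
    rfl
  · have h2 : withFailure E X none (some j) = 0 := rfl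
    rw [h2]
    simp [Matrix.mul_apply, Matrix.conjTranspose_apply]
  · have h2 : withFailure E X (some i) none = 0 := rfl
    rw [h2]
    simp [Matrix.mul_apply, Matrix.conjTranspose_apply]
  · have h2 : withFailure E X (some i) (some j) = E X i j := rfl
    rw [h2, hK, Matrix.sum_apply]
    simp [Matrix.mul_apply, Matrix.conjTranspose_apply]

theorem isChannel_conjMap {d : ℕ} (V : U d) : IsChannel (conjMap (V : Op (Fin d))) := by
  refine ⟨1, fun _ => V, ?_, fun X => by simp [conjMap]⟩
  have := Matrix.mem_unitaryGroup_iff'.mp V.2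
  rw [Matrix.star_eq_conjTranspose] at this
  simp [this, Matrix.PosSemidef.zero]

theorem depolarizing_eq_sum (d : ℕ) (X : Op (Fin d)) : depolarizing d X
    = ∑ c : Fin d × Fin d, (1 / (d : ℂ)) • (Matrix.single c.1 c.2 1 * X
      * (Matrix.single c.1 c.2 (1 : ℂ))ᴴ) := by
  ext i j
  simp only [Fintype.sum_prod_type, Matrix.sum_apply, Matrix.smul_apply]
  by_cases hij : i = j
  · subst hij
    simp [depolarizing, Matrix.mul_apply, Matrix.single_apply, Matrix.trace, ite_and,
      div_eq_inv_mul, Finset.mul_sum]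
  · have : ∀ k l, (Matrix.single k l (1 : ℂ) * X * (Matrix.single k l (1 : ℂ))ᴴ : Op (Fin d)) i j
        = 0 := by
      intro k l
      simp only [Matrix.conjTranspose_single, Matrix.mul_apply, Matrix.single_apply]
      by_cases h1 : k = i
      · have h2 : k ≠ j := fun h => hij (h1.symm.trans h)
        simp [h2]
      · simp [h1]
    simp only [this]
    simp [depolarizing, hij]

theorem isChannel_depolarizing (d : ℕ) [NeZero d] : IsChannel (depolarizing d) := by
  have hd : (d : ℂ) ≠ 0 := Nat.cast_ne_zero.mpr (NeZero.ne d)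
  have hs : ((Real.sqrt (1 / d) : ℝ) : ℂ) * (Real.sqrt (1 / d) : ℝ) = 1 / d := by
    rw [← Complex.ofReal_mul, Real.mul_self_sqrt (by positivity)]
    push_cast
    rfl
  let e := Fintype.equivFin (Fin d × Fin d)
  refine ⟨_, fun i => ((Real.sqrt (1 / d) : ℝ) : ℂ) • Matrix.single (e.symm i).1 (e.symm i).2 1,
    ?_, fun X => ?_⟩
  · have h1 : ∑ i, (((Real.sqrt (1 / d) : ℝ) : ℂ)
        • Matrix.single (e.symm i).1 (e.symm i).2 (1 : ℂ))ᴴ * (((Real.sqrt (1 / d) : ℝ) : ℂ)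
        • Matrix.single (e.symm i).1 (e.symm i).2 (1 : ℂ)) = (1 : Op (Fin d)) := by
      rw [← Fintype.sum_equiv e (fun c => (((Real.sqrt (1 / d) : ℝ) : ℂ)
        • Matrix.single c.1 c.2 (1 : ℂ))ᴴ * (((Real.sqrt (1 / d) : ℝ) : ℂ)
        • Matrix.single c.1 c.2 (1 : ℂ))) _ fun c => by simp [e]]
      simp only [Matrix.conjTranspose_smul, smul_mul_smul_comm, Complex.star_def,
        Complex.conj_ofReal, hs, Matrix.conjTranspose_single, star_one,
        Matrix.single_mul_single_same, Fintype.sum_prod_type, mul_one, ← Finset.smul_sum]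
      have h2 : ∑ x : Fin d, Matrix.single x x (1 : ℂ) = 1 := by
        ext i j
        simp [Matrix.sum_apply, Matrix.single_apply, Matrix.one_apply, ite_and]
      simp only [h2, Finset.sum_const, Finset.card_univ, Fintype.card_fin]
      rw [← Nat.cast_smul_eq_nsmul ℂ, smul_smul, one_div_mul_cancel hd, one_smul]
    rw [h1, sub_self]
    exact Matrix.PosSemidef.zero
  · rw [depolarizing_eq_sum]
    refine Fintype.sum_equiv e _ _ fun c => ?_
    simp only [e, Equiv.symm_apply_apply, Matrix.conjTranspose_smul, smul_mul_assoc,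
      mul_smul_comm, smul_smul, Complex.star_def, Complex.conj_ofReal, hs]

theorem isChannel_shiftMixture (d : ℕ) [NeZero d] (a b : ℝ) (ha : 0 ≤ a) (hb : 0 ≤ b)
    (hab : a + b = 1) : IsChannel (shiftMixture d a b) := by
  have hs : ∀ x : ℝ, 0 ≤ x → ((Real.sqrt x : ℝ) : ℂ) * (Real.sqrt x : ℝ) = x := by
    intro x hx
    rw [← Complex.ofReal_mul, Real.mul_self_sqrt hx]
  refine ⟨2, ![((Real.sqrt a : ℝ) : ℂ) • 1, ((Real.sqrt b : ℝ) : ℂ) • shift d], ?_, fun X => ?_⟩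
  · have h := Matrix.mem_unitaryGroup_iff'.mp (shift_mem_unitaryGroup d)
    rw [Matrix.star_eq_conjTranspose] at h
    have hc : (a : ℂ) + b = 1 := by exact_mod_cast hab
    simp only [Fin.sum_univ_two, Matrix.cons_val_zero, Matrix.cons_val_one,
      Matrix.conjTranspose_smul, smul_mul_smul_comm, Complex.star_def, Complex.conj_ofReal,
      hs a ha, hs b hb, h, Matrix.conjTranspose_one, mul_one, ← add_smul, hc, one_smul, sub_self]
    exact Matrix.PosSemidef.zero
  · simp only [Fin.sum_univ_two, Matrix.cons_val_zero, Matrix.cons_val_one,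
      Matrix.conjTranspose_smul, smul_mul_assoc, mul_smul_comm, smul_smul, Complex.star_def,
      Complex.conj_ofReal, hs a ha, hs b hb, Matrix.conjTranspose_one, mul_one, one_mul]
    rfl

/-- The failure entry contains `tr X` independently of the channel, so `withFailure` is affine and
not linear in the channel; hence the condition on the weights. -/
theorem withFailure_mix {d : ℕ} (E F : Op (Fin d) →ₗ[ℂ] Op (Fin d)) (a b : ℂ) (hab : a + b = 1) :
    withFailure (a • E + b • F) = a • withFailure E + b • withFailure F := by
  ext X p q
  rcases p with _ | i <;> rcases q with _ | j
  · simp only [withFailure, LinearMap.coe_mk, AddHom.coe_mk, Matrix.of_apply, LinearMap.add_apply,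
      LinearMap.smul_apply, Matrix.trace_add, Matrix.trace_smul, Matrix.add_apply,
      Matrix.smul_apply, smul_eq_mul]
    linear_combination (-X.trace) * hab
  all_goals simp [withFailure]

theorem amplify_add {m n a : Type} (Φ Ψ : Op m →ₗ[ℂ] Op n) :
    amplify a (Φ + Ψ) = amplify a Φ + amplify a Ψ := rfl

theorem amplify_smul {m n a : Type} (c : ℂ) (Φ : Op m →ₗ[ℂ] Op n) :
    amplify a (c • Φ) = c • amplify a Φ := rfl

/-! ### Total probabilities -/

namespace CoherentAlgorithm

variable {d : ℕ} (A : CoherentAlgorithm d)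

/-- One step of the algorithm, including a call to the channel `E`. -/
def next (E : Op (Fin d) →ₗ[ℂ] Op (Fin d)) (ω : A.Seed) (t : ℕ)
    (σ : A.Mem → Op (Option (Fin d) × Fin A.anc)) : A.Mem → Op (Option (Fin d) × Fin A.anc) :=
  fun k' => amplify (Fin A.anc) (withFailure E) (∑ k, A.step ω t k k' (σ k))

/-- A normalized family of positive operators. -/
def IsState (σ : A.Mem → Op (Option (Fin d) × Fin A.anc)) : Prop :=
  (∀ k, (σ k).PosSemidef) ∧ ∑ k, (σ k).trace = 1

variable {A}

theorem IsState.next {E : Op (Fin d) →ₗ[ℂ] Op (Fin d)} (hE : IsChannel E) {ω : A.Seed} {t : ℕ}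
    {σ : A.Mem → Op (Option (Fin d) × Fin A.anc)} (hσ : A.IsState σ) :
    A.IsState (A.next E ω t σ) := by
  constructor
  · intro k'
    exact amplify_posSemidef (isCP_withFailure hE)
      (Matrix.posSemidef_sum _ fun k _ => isCP_posSemidef (A.step_cp ω t k k') (hσ.1 k))
  · simp only [CoherentAlgorithm.next, amplify_trace (withFailure_trace E), Matrix.trace_sum]
    rw [Finset.sum_comm]
    simp only [A.step_trace]
    exact hσ.2

/-- The outcome probabilities in a given final state. -/
def outProb (ω : A.Seed) (σ : A.Mem → Op (Option (Fin d) × Fin A.anc)) (k : A.Mem) (v : A.Out) :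
    ℝ := (A.povm ω k v * σ k).trace.re

theorem outProb_nonneg {ω : A.Seed} {σ : A.Mem → Op (Option (Fin d) × Fin A.anc)}
    (hσ : A.IsState σ) (k : A.Mem) (v : A.Out) : 0 ≤ outProb ω σ k v :=
  trace_mul_re_nonneg (A.povm_pos ω k v) (hσ.1 k)

theorem sum_outProb {ω : A.Seed} {σ : A.Mem → Op (Option (Fin d) × Fin A.anc)}
    (hσ : A.IsState σ) : ∑ k, ∑ v, outProb ω σ k v = 1 := by
  simp only [outProb, ← Complex.re_sum, ← Matrix.trace_sum, ← Finset.sum_mul, A.povm_sum, one_mul]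
  rw [Matrix.trace_sum, hσ.2, Complex.one_re]

theorem isState_state {E : Op (Fin d) →ₗ[ℂ] Op (Fin d)} (hE : IsChannel E) (ω : A.Seed) (t : ℕ) :
    A.IsState (A.state E ω t) := by
  induction t with
  | zero => exact ⟨A.init_pos ω, A.init_trace ω⟩
  | succ t ih => exact ih.next hE

end CoherentAlgorithm

/-- Summing over the last outcome first removes the last factor, although it depends on all earlier
outcomes. The case `c = 1` is the total probability; `c = chiSq e` occurs in the `χ²` bound. -/
theorem sum_adaptive_prod {O : Type} [Fintype O] (c : ℝ) (T : ℕ)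
    (f : (t : ℕ) → (Fin t → O) → O → ℝ) (hf : ∀ t h, ∑ v, f t h v = c) :
    ∑ h : Fin T → O, ∏ t : Fin T, f t (fun s => h ⟨s, s.isLt.trans t.isLt⟩) (h t) = c ^ T := by
  induction T with
  | zero => simp
  | succ T ih =>
    rw [← (Fin.snocEquiv fun _ => O).sum_comp, Fintype.sum_prod_type_right, pow_succ, ← ih,
      Finset.sum_mul]
    refine Finset.sum_congr rfl fun h _ => ?_
    rw [← hf T h, Finset.mul_sum]
    refine Finset.sum_congr rfl fun v _ => ?_
    rw [Fin.prod_univ_castSucc]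
    congr 1
    · refine Finset.prod_congr rfl fun t _ => ?_
      have h2 : ∀ (s : ℕ) (hs : s < T), (Fin.snocEquiv fun _ : Fin (T + 1) => O) (v, h)
          ⟨s, hs.trans (Nat.lt_succ_self T)⟩ = h ⟨s, hs⟩ := fun s hs =>
        Fin.snoc_castSucc (α := fun _ => O) v h ⟨s, hs⟩
      have h1 : (Fin.snocEquiv fun _ : Fin (T + 1) => O) (v, h) t.castSucc = h t := by
        simp [Fin.snocEquiv]
      rw [h1]
      congr 1
      ext s
      exact h2 s (s.isLt.trans t.isLt)
    · have h1 : (Fin.snocEquiv fun _ : Fin (T + 1) => O) (v, h) (Fin.last T) = v := by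
        simp [Fin.snocEquiv]
      rw [h1]
      congr 1
      ext s
      have : (⟨(s : ℕ), s.isLt.trans (Fin.last T).isLt⟩ : Fin (T + 1))
        = (⟨s, s.isLt⟩ : Fin T).castSucc := rfl
      rw [this]
      simp [Fin.snocEquiv]

namespace IncoherentAlgorithm

variable {d : ℕ} (A : IncoherentAlgorithm d)

/-- The outcome probabilities of one round. -/
def roundProb (E : Op (Fin d) →ₗ[ℂ] Op (Fin d)) (ω : A.Seed) (t : ℕ) (h : Fin t → A.Out)
    (v : A.Out) : ℝ :=
  (A.povm ω t h v * amplify (Fin A.anc) (withFailure E) (A.input ω t h)).trace.re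

theorem prob_eq (E : Op (Fin d) →ₗ[ℂ] Op (Fin d)) (ω : A.Seed) (h : Fin A.calls → A.Out) :
    A.prob E ω h = ∏ t : Fin A.calls, A.roundProb E ω t (A.past h t) (h t) := rfl

theorem roundProb_nonneg {E : Op (Fin d) →ₗ[ℂ] Op (Fin d)} (hE : IsChannel E) (ω : A.Seed) (t : ℕ)
    (h : Fin t → A.Out) (v : A.Out) : 0 ≤ A.roundProb E ω t h v :=
  trace_mul_re_nonneg (A.povm_pos ω t h v)
    (amplify_posSemidef (isCP_withFailure hE) (A.input_pos ω t h))

theorem sum_roundProb (E : Op (Fin d) →ₗ[ℂ] Op (Fin d)) (ω : A.Seed) (t : ℕ)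
    (h : Fin t → A.Out) : ∑ v, A.roundProb E ω t h v = 1 := by
  simp only [roundProb, ← Complex.re_sum, ← Matrix.trace_sum, ← Finset.sum_mul, A.povm_sum,
    one_mul, amplify_trace (withFailure_trace E), A.input_trace, Complex.one_re]

theorem prob_nonneg {E : Op (Fin d) →ₗ[ℂ] Op (Fin d)} (hE : IsChannel E) (ω : A.Seed)
    (h : Fin A.calls → A.Out) : 0 ≤ A.prob E ω h :=
  Finset.prod_nonneg fun _ _ => A.roundProb_nonneg hE _ _ _ _

theorem sum_prob (E : Op (Fin d) →ₗ[ℂ] Op (Fin d)) (ω : A.Seed) : ∑ h, A.prob E ω h = 1 := by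
  have := sum_adaptive_prod 1 A.calls (A.roundProb E ω) (A.sum_roundProb E ω)
  rw [one_pow] at this
  exact this

end IncoherentAlgorithm

/-! ### Distinguishing mixtures of two channels -/

/-- This turns a linear inequality for each value of the seed into one for success probabilities.
Integrability is automatic: the integral of a non-integrable function is zero, below `2 / 3`. -/
theorem le_of_integral_two_thirds {Ω : Type*} [MeasurableSpace Ω] {μ : Measure Ω}
    [IsProbabilityMeasure μ] {f g : Ω → ℝ} (hf : 2 / 3 ≤ ∫ ω, f ω ∂μ) (hg : 2 / 3 ≤ ∫ ω, g ω ∂μ)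
    {α β γ : ℝ} (hα : 0 ≤ α) (hβ : 0 ≤ β) (h : ∀ ω, α * f ω + β * g ω ≤ γ) :
    2 / 3 * (α + β) ≤ γ := by
  have int : ∀ {f : Ω → ℝ}, 2 / 3 ≤ ∫ ω, f ω ∂μ → Integrable f μ := by
    intro f hf
    by_contra hn
    rw [integral_undef hn] at hf
    norm_num at hf
  have h1 := integral_mono (((int hf).const_mul α).add ((int hg).const_mul β))
    (integrable_const γ) h
  simp only [Pi.add_apply] at h1
  rw [integral_add ((int hf).const_mul α) ((int hg).const_mul β), integral_const_mul,
    integral_const_mul, integral_const] at h1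
  rw [probReal_univ, one_smul] at h1
  nlinarith [mul_le_mul_of_nonneg_left hf hα, mul_le_mul_of_nonneg_left hg hβ]

/-- The average of a function of a list of independent biased bits. -/
def mixSum {M : Type*} [AddCommGroup M] [Module ℝ M] (p : ℝ) : ℕ → (List Bool → M) → M
  | 0, F => F []
  | t + 1, F => p • mixSum p t (fun l => F (true :: l))
      + (1 - p) • mixSum p t (fun l => F (false :: l))

theorem mixSum_map {M N : Type*} [AddCommGroup M] [Module ℝ M] [AddCommGroup N] [Module ℝ N]
    (p : ℝ) (L : M →ₗ[ℝ] N) (t : ℕ) (F : List Bool → M) :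
    L (mixSum p t F) = mixSum p t fun l => L (F l) := by
  induction t generalizing F with
  | zero => rfl
  | succ t ih => simp only [mixSum, map_add, map_smul, ih]

theorem mixSum_congr {M : Type*} [AddCommGroup M] [Module ℝ M] (p : ℝ) (t : ℕ)
    (F G : List Bool → M) (h : ∀ l, l.length = t → F l = G l) : mixSum p t F = mixSum p t G := by
  induction t generalizing F G with
  | zero => exact h [] rfl
  | succ t ih =>
    simp only [mixSum]
    rw [ih (fun l => F (true :: l)) (fun l => G (true :: l)) fun l hl => h _ (by simp [hl]),
      ih (fun l => F (false :: l)) (fun l => G (false :: l)) fun l hl => h _ (by simp [hl])]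

theorem mixSum_mono {p : ℝ} (h0 : 0 ≤ p) (h1 : p ≤ 1) (t : ℕ) {F G : List Bool → ℝ}
    (h : ∀ l, F l ≤ G l) : mixSum p t F ≤ mixSum p t G := by
  induction t generalizing F G with
  | zero => exact h []
  | succ t ih =>
    simp only [mixSum, smul_eq_mul]
    exact add_le_add (mul_le_mul_of_nonneg_left (ih fun l => h _) h0)
      (mul_le_mul_of_nonneg_left (ih fun l => h _) (by linarith))

/-- One plus the `χ²` divergence between biased bits with probabilities `2/3 + e` and `2/3`. -/
def chiSq (e : ℝ) : ℝ := 1 + 9 / 2 * e ^ 2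

theorem chiSq_nonneg (e : ℝ) : 0 ≤ chiSq e := by
  unfold chiSq
  positivity

/-- For one bit this is the Cauchy–Schwarz inequality, as `(2/3 + e)² / (2/3) + (1/3 - e)² / (1/3) =
chiSq e`. The factor multiplies over independent bits. -/
theorem mixSum_sq_le (e : ℝ) (t : ℕ) (q : List Bool → ℝ) :
    mixSum (2 / 3 + e) t q ^ 2 ≤ chiSq e ^ t * mixSum (2 / 3) t fun l => q l ^ 2 := by
  induction t generalizing q with
  | zero => simp [mixSum]
  | succ t ih =>
    have h1 := ih fun l => q (true :: l)
    have h2 := ih fun l => q (false :: l)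
    simp only [mixSum, smul_eq_mul]
    set a := mixSum (2 / 3 + e) t fun l => q (true :: l)
    set b := mixSum (2 / 3 + e) t fun l => q (false :: l)
    have h3 : ((2 / 3 + e) * a + (1 - (2 / 3 + e)) * b) ^ 2
        ≤ chiSq e * (2 / 3 * a ^ 2 + 1 / 3 * b ^ 2) := by
      unfold chiSq
      nlinarith [sq_nonneg ((2 / 3 + e) * b - 2 * (1 / 3 - e) * a)]
    refine h3.trans ?_
    rw [pow_succ' (chiSq e) t, mul_assoc]
    refine mul_le_mul_of_nonneg_left ?_ (chiSq_nonneg e)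
    linarith

/-- As `chiSq (4 * ε) = 1 + 72 * ε ^ 2`, the hypothesis bounds `72 * T * ε ^ 2` below by `log (4 /
3)`, which is at least `1 / 4`; and `1 / 288 = (1 / 4) / 72`. -/
theorem le_calls_of_chiSq {ε : ℝ} (hε : 0 < ε) (T : ℕ) (h : 4 / 3 ≤ chiSq (4 * ε) ^ T) :
    1 / 288 * ε⁻¹ ^ 2 ≤ (T : ℝ) := by
  have h1 : chiSq (4 * ε) ≤ Real.exp (72 * ε ^ 2) := by
    have := Real.add_one_le_exp (72 * ε ^ 2)
    unfold chiSq
    linarith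
  have h2 : 4 / 3 ≤ Real.exp (T * (72 * ε ^ 2)) := by
    rw [Real.exp_nat_mul]
    exact h.trans (pow_le_pow_left₀ (chiSq_nonneg _) h1 T)
  have h3 := Real.add_one_le_exp (-(T * (72 * ε ^ 2)))
  rw [Real.exp_neg] at h3
  have h4 : (Real.exp (T * (72 * ε ^ 2)))⁻¹ ≤ 3 / 4 := by
    rw [inv_le_comm₀ (by positivity) (by norm_num)]
    linarith
  have h5 : 1 / 4 ≤ T * (72 * ε ^ 2) := by linarith
  rw [inv_pow, ← div_eq_mul_inv, div_le_iff₀ (by positivity)]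
  linarith

/-- A shift of the bias by `4 * ε` moves the alternative unitarity by at least `8 / 3 * ε`, more
than twice the precision. -/
theorem shiftMixture_separated (d : ℕ) [d.AtLeastTwo] {ε : ℝ} (hε : 0 < ε) (v : ℝ)
    (h1 : |v - altUnitarity (shiftMixture d (2 / 3 + 4 * ε) (1 / 3 - 4 * ε))| ≤ ε)
    (h2 : |v - altUnitarity (shiftMixture d (2 / 3) (1 / 3))| ≤ ε) : False := by
  have h3 := (shiftMixture_gap d (4 * ε) (by linarith)).2
  rw [abs_le] at h1 h2
  linarith [h1.1, h2.2]

theorem depolarizing_separated (d : ℕ) [d.AtLeastTwo] {ε : ℝ} (hε : ε < 1 / 2) (V : U d) (v : ℝ)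
    (h1 : |v - altUnitarity (conjMap (V : Op (Fin d)))| ≤ ε)
    (h2 : |v - altUnitarity (depolarizing d)| ≤ ε) : False := by
  rw [altUnitarity_conjMap, abs_le] at h1
  rw [altUnitarity_depolarizing, abs_le] at h2
  linarith [h1.1, h2.2]

theorem shiftMixture_eq (d : ℕ) [NeZero d] (p b : ℝ) (hb : b = 1 - p) : shiftMixture d p b
    = (p : ℂ) • conjMap ((1 : U d) : Op (Fin d)) + ((1 - p : ℝ) : ℂ) • conjMap (shift d) := by
  subst hb
  have : conjMap ((1 : U d) : Op (Fin d)) = LinearMap.id := by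
    ext X i j
    simp [conjMap]
  rw [this]
  rfl

theorem isChannel_shift (d : ℕ) [NeZero d] : IsChannel (conjMap (shift d)) :=
  isChannel_conjMap (⟨shift d, shift_mem_unitaryGroup d⟩ : U d)

/-! ### The lower bound in the precision for coherent access. -/

namespace CoherentAlgorithm

variable {d : ℕ} (A : CoherentAlgorithm d)

/-- The probability that the output is within `ε` of `x`, for a given final state. -/
def accept (ω : A.Seed) (x ε : ℝ) :
    (A.Mem → Op (Option (Fin d) × Fin A.anc)) →ₗ[ℝ] ℝ where
  toFun σ := ∑ k, ∑ v, if |A.value ω k v - x| ≤ ε then outProb ω σ k v else 0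
  map_add' σ τ := by
    simp only [← Finset.sum_add_distrib, outProb, Pi.add_apply, mul_add, Matrix.trace_add,
      Complex.add_re]
    refine Finset.sum_congr rfl fun k _ => Finset.sum_congr rfl fun v _ => ?_
    split_ifs <;> simp
  map_smul' c σ := by
    simp only [Finset.smul_sum, outProb, Pi.smul_apply, Matrix.mul_smul, Matrix.trace_smul,
      Complex.smul_re, RingHom.id_apply]
    refine Finset.sum_congr rfl fun k _ => Finset.sum_congr rfl fun v _ => ?_
    split_ifs <;> simp

theorem accept_apply (ω : A.Seed) (x ε : ℝ) (σ : A.Mem → Op (Option (Fin d) × Fin A.anc)) :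
    A.accept ω x ε σ = ∑ k, ∑ v, if |A.value ω k v - x| ≤ ε then outProb ω σ k v else 0 := rfl

theorem successProb_eq (E : Op (Fin d) →ₗ[ℂ] Op (Fin d)) (x ε : ℝ) :
    A.successProb E x ε = ∫ ω, A.accept ω x ε (A.state E ω A.calls) ∂A.law := rfl

variable {A}

theorem accept_nonneg {ω : A.Seed} {σ : A.Mem → Op (Option (Fin d) × Fin A.anc)}
    (hσ : A.IsState σ) (x ε : ℝ) : 0 ≤ A.accept ω x ε σ := by
  refine Finset.sum_nonneg fun k _ => Finset.sum_nonneg fun v _ => ?_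
  split_ifs
  · exact outProb_nonneg hσ k v
  · exact le_rfl

theorem accept_add_le {ω : A.Seed} {σ : A.Mem → Op (Option (Fin d) × Fin A.anc)}
    (hσ : A.IsState σ) {x y ε : ℝ} (hxy : ∀ v : ℝ, |v - x| ≤ ε → |v - y| ≤ ε → False) :
    A.accept ω x ε σ + A.accept ω y ε σ ≤ 1 := by
  rw [← sum_outProb (ω := ω) hσ, accept_apply, accept_apply, ← Finset.sum_add_distrib]
  refine Finset.sum_le_sum fun k _ => ?_
  rw [← Finset.sum_add_distrib]
  refine Finset.sum_le_sum fun v _ => ?_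
  have h0 := outProb_nonneg (ω := ω) hσ k v
  split_ifs with h1 h2
  · exact (hxy _ h1 h2).elim
  all_goals linarith

variable (A) in
/-- The state after calls to the channels selected by a list of bits. -/
def stateList (E F : Op (Fin d) →ₗ[ℂ] Op (Fin d)) (ω : A.Seed) :
    List Bool → A.Mem → Op (Option (Fin d) × Fin A.anc)
  | [] => A.init ω
  | b :: l => A.next (if b then E else F) ω l.length (stateList E F ω l)

theorem isState_stateList {E F : Op (Fin d) →ₗ[ℂ] Op (Fin d)} (hE : IsChannel E)
    (hF : IsChannel F) (ω : A.Seed) (l : List Bool) : A.IsState (A.stateList E F ω l) := by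
  induction l with
  | nil => exact ⟨A.init_pos ω, A.init_trace ω⟩
  | cons b l ih =>
    refine ih.next ?_
    cases b
    · exact hF
    · exact hE

variable (A) in
/-- One step of the algorithm, as a linear map. -/
def nextLin (E : Op (Fin d) →ₗ[ℂ] Op (Fin d)) (ω : A.Seed) (t : ℕ) :
    (A.Mem → Op (Option (Fin d) × Fin A.anc)) →ₗ[ℝ]
      (A.Mem → Op (Option (Fin d) × Fin A.anc)) where
  toFun := A.next E ω t
  map_add' σ τ := by
    ext k' : 1
    simp only [next, Pi.add_apply, map_add, Finset.sum_add_distrib]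
  map_smul' c σ := by
    ext k' : 1
    simp only [next, Pi.smul_apply, LinearMap.map_smul_of_tower, ← Finset.smul_sum,
      RingHom.id_apply]

/-- Every call depends affinely on the channel, so calling a mixture amounts to choosing one of the
two channels by an independent bit at each call. The latest call is the head of the list, so the
length of the tail is its time. -/
theorem state_mix (E F : Op (Fin d) →ₗ[ℂ] Op (Fin d)) (p : ℝ) (ω : A.Seed) (t : ℕ) :
    A.state ((p : ℂ) • E + ((1 - p : ℝ) : ℂ) • F) ω t = mixSum p t (A.stateList E F ω) := by
  induction t with
  | zero => rfl
  | succ t ih =>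
    have h1 : A.state ((p : ℂ) • E + ((1 - p : ℝ) : ℂ) • F) ω (t + 1)
        = p • A.nextLin E ω t (A.state ((p : ℂ) • E + ((1 - p : ℝ) : ℂ) • F) ω t)
          + (1 - p) • A.nextLin F ω t (A.state ((p : ℂ) • E + ((1 - p : ℝ) : ℂ) • F) ω t) := by
      ext k' : 1
      change amplify _ (withFailure _) _ = p • amplify _ _ _ + (1 - p) • amplify _ _ _
      rw [withFailure_mix _ _ _ _ (by push_cast; ring), amplify_add, amplify_smul, amplify_smul]
      rfl
    rw [h1, ih, mixSum_map, mixSum_map]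
    simp only [mixSum]
    congr 2
    · exact mixSum_congr _ _ _ _ fun l hl => by subst hl; rfl
    · exact mixSum_congr _ _ _ _ fun l hl => by subst hl; rfl

/-- The acceptance probability `q` for a fixed list of bits lies in `[0, 1]`, so `q ^ 2 ≤ q` on the
right-hand side of `mixSum_sq_le`. -/
theorem accept_state_mix_le {E F : Op (Fin d) →ₗ[ℂ] Op (Fin d)} (hE : IsChannel E)
    (hF : IsChannel F) (e : ℝ) (ω : A.Seed) (t : ℕ) (x ε : ℝ) :
    A.accept ω x ε (A.state (((2 / 3 + e : ℝ) : ℂ) • E + ((1 - (2 / 3 + e) : ℝ) : ℂ) • F) ω t) ^ 2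
      ≤ chiSq e ^ t * A.accept ω x ε
        (A.state (((2 / 3 : ℝ) : ℂ) • E + ((1 - 2 / 3 : ℝ) : ℂ) • F) ω t) := by
  rw [state_mix, state_mix, mixSum_map, mixSum_map]
  refine (mixSum_sq_le e t _).trans (mul_le_mul_of_nonneg_left ?_ (pow_nonneg (chiSq_nonneg e) t))
  refine mixSum_mono (by norm_num) (by norm_num) t fun l => ?_
  have hs := isState_stateList hE hF ω l
  have h0 := accept_nonneg (ω := ω) hs x ε
  have h1 : A.accept ω x ε (A.stateList E F ω l) ≤ 1 := by
    rw [← sum_outProb (ω := ω) hs, accept_apply]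
    refine Finset.sum_le_sum fun k _ => Finset.sum_le_sum fun v _ => ?_
    split_ifs
    · exact le_rfl
    · exact outProb_nonneg hs k v
  nlinarith

/-- Without calls the final state does not depend on the channel, and the two success events are
disjoint: their probabilities cannot both be `2 / 3`. -/
theorem calls_ne_zero [d.AtLeastTwo] {ε : ℝ} (hε : ε < 1 / 2) (hA : A.Estimates altUnitarity ε) :
    A.calls ≠ 0 := by
  intro h0
  have h1 := hA _ (isChannel_conjMap (1 : U d))
  have h2 := hA _ (isChannel_depolarizing d)
  rw [successProb_eq] at h1 h2
  have h := le_of_integral_two_thirds h1 h2 zero_le_one zero_le_one (γ := 1) fun ω => by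
    have h3 := accept_add_le (ω := ω) (isState_state (isChannel_depolarizing d) ω A.calls)
      (depolarizing_separated d hε 1)
    rw [h0] at h3 ⊢
    rw [one_mul, one_mul]
    exact h3
  norm_num at h

theorem calls_lower_bound [d.AtLeastTwo] {ε : ℝ} (hε0 : 0 < ε) (hε : ε < 1 / 2)
    (hA : A.Estimates altUnitarity ε) : 1 / 288 * ε⁻¹ ^ 2 ≤ (A.calls : ℝ) := by
  -- Up to `1 / 12` the weight `1 / 3 - 4 * ε` is nonnegative. Beyond it, a single call suffices for
  -- the claim, since `144 / 288 ≤ 1`.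
  by_cases hε2 : ε ≤ 1 / 12
  · refine le_calls_of_chiSq hε0 _ ?_
    have h1 := hA _ (isChannel_shiftMixture d (2 / 3 + 4 * ε) (1 / 3 - 4 * ε) (by linarith)
      (by linarith) (by ring))
    have h2 := hA _ (isChannel_shiftMixture d (2 / 3) (1 / 3) (by norm_num) (by norm_num)
      (by norm_num))
    rw [successProb_eq] at h1 h2
    -- The bound on the square of the acceptance probability `a` is replaced by its tangent at `a =
    -- 2 / 3`, namely `4 / 3 * a ≤ 4 / 9 + a ^ 2`. It is then linear and can be integrated over the
    -- seed.
    have h := le_of_integral_two_thirds h1 h2 (α := 4 / 3) (β := chiSq (4 * ε) ^ A.calls)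
      (by norm_num) (pow_nonneg (chiSq_nonneg _) _) (γ := 4 / 9 + chiSq (4 * ε) ^ A.calls)
      fun ω => by
        have h3 := accept_add_le (ω := ω) (isState_state (isChannel_shiftMixture d (2 / 3) (1 / 3)
          (by norm_num) (by norm_num) (by norm_num)) ω A.calls)
          (shiftMixture_separated d hε0)
        have h4 := accept_state_mix_le (isChannel_conjMap (1 : U d)) (isChannel_shift d) (4 * ε)
          ω A.calls (altUnitarity (shiftMixture d (2 / 3 + 4 * ε) (1 / 3 - 4 * ε))) ε
        rw [← shiftMixture_eq d _ (1 / 3 - 4 * ε) (by ring),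
          ← shiftMixture_eq d _ (1 / 3) (by norm_num)] at h4
        have h5 := mul_le_mul_of_nonneg_left h3 (pow_nonneg (chiSq_nonneg (4 * ε)) A.calls)
        nlinarith [sq_nonneg (A.accept ω (altUnitarity (shiftMixture d (2 / 3 + 4 * ε)
          (1 / 3 - 4 * ε))) ε (A.state (shiftMixture d (2 / 3 + 4 * ε) (1 / 3 - 4 * ε)) ω A.calls)
          - 2 / 3)]
    linarith
  · have h1 : (1 : ℝ) ≤ A.calls := by
      exact_mod_cast Nat.one_le_iff_ne_zero.mpr (calls_ne_zero hε hA)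
    have h2 : ε⁻¹ ≤ 12 := by
      rw [inv_le_comm₀ hε0 (by norm_num)]
      linarith
    have h3 : 0 < ε⁻¹ := inv_pos.mpr hε0
    nlinarith

end CoherentAlgorithm

/-! ### The lower bound in the precision for incoherent access. -/

namespace IncoherentAlgorithm

variable {d : ℕ} {A : IncoherentAlgorithm d}

variable (A) in
/-- The probability that the output is within `ε` of `x`, given the seed. -/
def accept (E : Op (Fin d) →ₗ[ℂ] Op (Fin d)) (ω : A.Seed) (x ε : ℝ) : ℝ :=
  ∑ h : Fin A.calls → A.Out, if |A.value ω h - x| ≤ ε then A.prob E ω h else 0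

theorem successProb_eq (E : Op (Fin d) →ₗ[ℂ] Op (Fin d)) (x ε : ℝ) :
    A.successProb E x ε = ∫ ω, A.accept E ω x ε ∂A.law := rfl

theorem accept_nonneg {E : Op (Fin d) →ₗ[ℂ] Op (Fin d)} (hE : IsChannel E) (ω : A.Seed)
    (x ε : ℝ) : 0 ≤ A.accept E ω x ε := by
  refine Finset.sum_nonneg fun h _ => ?_
  split_ifs
  · exact A.prob_nonneg hE ω h
  · exact le_rfl

theorem accept_add_le {E : Op (Fin d) →ₗ[ℂ] Op (Fin d)} (hE : IsChannel E) (ω : A.Seed)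
    {x y ε : ℝ} (hxy : ∀ v : ℝ, |v - x| ≤ ε → |v - y| ≤ ε → False) :
    A.accept E ω x ε + A.accept E ω y ε ≤ 1 := by
  rw [← A.sum_prob E ω, accept, accept, ← Finset.sum_add_distrib]
  refine Finset.sum_le_sum fun h _ => ?_
  have h0 := A.prob_nonneg hE ω h
  split_ifs with h1 h2
  · exact (hxy _ h1 h2).elim
  all_goals linarith

theorem accept_le_one {E : Op (Fin d) →ₗ[ℂ] Op (Fin d)} (hE : IsChannel E) (ω : A.Seed)
    (x ε : ℝ) : A.accept E ω x ε ≤ 1 := by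
  rw [← A.sum_prob E ω, accept]
  refine Finset.sum_le_sum fun h _ => ?_
  split_ifs
  · exact le_rfl
  · exact A.prob_nonneg hE ω h

theorem roundProb_mix (E F : Op (Fin d) →ₗ[ℂ] Op (Fin d)) (p : ℝ) (ω : A.Seed) (t : ℕ)
    (h : Fin t → A.Out) (v : A.Out) :
    A.roundProb ((p : ℂ) • E + ((1 - p : ℝ) : ℂ) • F) ω t h v
      = p * A.roundProb E ω t h v + (1 - p) * A.roundProb F ω t h v := by
  unfold roundProb
  rw [withFailure_mix _ _ _ _ (by push_cast; ring), amplify_add, amplify_smul, amplify_smul]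
  simp only [LinearMap.add_apply, LinearMap.smul_apply, mul_add, Matrix.mul_smul,
    Matrix.trace_add, Matrix.trace_smul, Complex.add_re, smul_eq_mul, Complex.re_ofReal_mul]

/-- Here Cauchy–Schwarz is applied over the sequences of outcomes. In each round, the squared
probability for bias `2/3 + e` is at most the probability for bias `2/3` times a weight `R` of total
mass `chiSq e`; as this mass does not depend on the history, adaptivity has no effect. -/
theorem accept_mix_le {E F : Op (Fin d) →ₗ[ℂ] Op (Fin d)} (hE : IsChannel E)
    (hF : IsChannel F) (e : ℝ) (ω : A.Seed) (x ε : ℝ) :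
    A.accept (((2 / 3 + e : ℝ) : ℂ) • E + ((1 - (2 / 3 + e) : ℝ) : ℂ) • F) ω x ε ^ 2
      ≤ chiSq e ^ A.calls * A.accept
        (((2 / 3 : ℝ) : ℂ) • E + ((1 - 2 / 3 : ℝ) : ℂ) • F) ω x ε := by
  -- The coefficients are `(2/3 + e)² / (2/3)` and `(1/3 - e)² / (1/3)`.
  let R : (t : ℕ) → (Fin t → A.Out) → A.Out → ℝ := fun t h v =>
    3 / 2 * (2 / 3 + e) ^ 2 * A.roundProb E ω t h v + 3 * (1 / 3 - e) ^ 2 * A.roundProb F ω t h v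
  have hR0 : ∀ t h v, 0 ≤ R t h v := fun t h v => by
    have := A.roundProb_nonneg hE ω t h v
    have := A.roundProb_nonneg hF ω t h v
    positivity
  have hRs : ∀ t h, ∑ v, R t h v = chiSq e := by
    intro t h
    simp only [R, Finset.sum_add_distrib, ← Finset.mul_sum, A.sum_roundProb]
    unfold chiSq
    ring
  have hR := sum_adaptive_prod (chiSq e) A.calls R hRs
  have hround : ∀ t h v, A.roundProb (((2 / 3 + e : ℝ) : ℂ) • E
      + ((1 - (2 / 3 + e) : ℝ) : ℂ) • F) ω t h v ^ 2
      ≤ A.roundProb (((2 / 3 : ℝ) : ℂ) • E + ((1 - 2 / 3 : ℝ) : ℂ) • F) ω t h v * R t h v := by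
    intro t h v
    rw [roundProb_mix, roundProb_mix]
    have ha := A.roundProb_nonneg hE ω t h v
    have hb := A.roundProb_nonneg hF ω t h v
    have := mul_nonneg (mul_nonneg ha hb) (sq_nonneg ((2 / 3 + e) - 2 * (1 / 3 - e)))
    simp only [R]
    nlinarith
  have hP0 : ∀ h, 0 ≤ A.prob (((2 / 3 : ℝ) : ℂ) • E + ((1 - 2 / 3 : ℝ) : ℂ) • F) ω h := by
    intro h
    rw [prob_eq]
    refine Finset.prod_nonneg fun t _ => ?_
    rw [roundProb_mix]
    have := A.roundProb_nonneg hE ω t (A.past h t) (h t)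
    have := A.roundProb_nonneg hF ω t (A.past h t) (h t)
    norm_num
    positivity
  have key : A.accept (((2 / 3 + e : ℝ) : ℂ) • E + ((1 - (2 / 3 + e) : ℝ) : ℂ) • F) ω x ε ^ 2
      ≤ A.accept (((2 / 3 : ℝ) : ℂ) • E + ((1 - 2 / 3 : ℝ) : ℂ) • F) ω x ε
        * ∑ h : Fin A.calls → A.Out, ∏ t : Fin A.calls, R t (A.past h t) (h t) := by
    refine Finset.sum_sq_le_sum_mul_sum_of_sq_le_mul _ (fun h _ => ?_) (fun h _ => ?_)
      (fun h _ => ?_)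
    · split_ifs
      · exact hP0 h
      · exact le_rfl
    · exact Finset.prod_nonneg fun t _ => hR0 _ _ _
    · split_ifs
      · rw [prob_eq, prob_eq, ← Finset.prod_pow, ← Finset.prod_mul_distrib]
        exact Finset.prod_le_prod (fun t _ => sq_nonneg _) fun t _ => hround _ _ _
      · simp
  refine key.trans (le_of_eq ?_)
  rw [mul_comm]
  congr 1

theorem calls_ne_zero [d.AtLeastTwo] {ε : ℝ} (hε : ε < 1 / 2) (hA : A.Estimates altUnitarity ε) :
    A.calls ≠ 0 := by
  intro h0
  have h1 := hA _ (isChannel_conjMap (1 : U d))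
  have h2 := hA _ (isChannel_depolarizing d)
  rw [successProb_eq] at h1 h2
  have h := le_of_integral_two_thirds h1 h2 zero_le_one zero_le_one (γ := 1) fun ω => by
    have h3 := accept_add_le (A := A) (isChannel_depolarizing d) ω
      (depolarizing_separated d hε 1)
    have h4 : ∀ x, A.accept (conjMap ((1 : U d) : Op (Fin d))) ω x ε
        = A.accept (depolarizing d) ω x ε := by
      intro x
      refine Finset.sum_congr rfl fun h _ => ?_
      have : IsEmpty (Fin A.calls) := by rw [h0]; infer_instance
      rw [prob_eq, prob_eq, Finset.prod_of_isEmpty, Finset.prod_of_isEmpty]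
    rw [one_mul, one_mul, h4]
    exact h3
  norm_num at h

/-- The argument for coherent access, with `accept_mix_le` as the comparison of the two mixtures. -/
theorem calls_lower_bound_precision [d.AtLeastTwo] {ε : ℝ} (hε0 : 0 < ε) (hε : ε < 1 / 2)
    (hA : A.Estimates altUnitarity ε) : 1 / 288 * ε⁻¹ ^ 2 ≤ (A.calls : ℝ) := by
  by_cases hε2 : ε ≤ 1 / 12
  · refine le_calls_of_chiSq hε0 _ ?_
    have h1 := hA _ (isChannel_shiftMixture d (2 / 3 + 4 * ε) (1 / 3 - 4 * ε) (by linarith)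
      (by linarith) (by ring))
    have h2 := hA _ (isChannel_shiftMixture d (2 / 3) (1 / 3) (by norm_num) (by norm_num)
      (by norm_num))
    rw [successProb_eq] at h1 h2
    have h := le_of_integral_two_thirds h1 h2 (α := 4 / 3) (β := chiSq (4 * ε) ^ A.calls)
      (by norm_num) (pow_nonneg (chiSq_nonneg _) _) (γ := 4 / 9 + chiSq (4 * ε) ^ A.calls)
      fun ω => by
        have h3 := accept_add_le (A := A) (isChannel_shiftMixture d (2 / 3) (1 / 3)
          (by norm_num) (by norm_num) (by norm_num)) ω
          (shiftMixture_separated d hε0)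
        have h4 := accept_mix_le (A := A) (isChannel_conjMap (1 : U d)) (isChannel_shift d)
          (4 * ε) ω (altUnitarity (shiftMixture d (2 / 3 + 4 * ε) (1 / 3 - 4 * ε))) ε
        rw [← shiftMixture_eq d _ (1 / 3 - 4 * ε) (by ring),
          ← shiftMixture_eq d _ (1 / 3) (by norm_num)] at h4
        have h5 := mul_le_mul_of_nonneg_left h3 (pow_nonneg (chiSq_nonneg (4 * ε)) A.calls)
        nlinarith [sq_nonneg (A.accept (shiftMixture d (2 / 3 + 4 * ε) (1 / 3 - 4 * ε)) ω
          (altUnitarity (shiftMixture d (2 / 3 + 4 * ε) (1 / 3 - 4 * ε))) ε - 2 / 3)]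
    linarith
  · have h1 : (1 : ℝ) ≤ A.calls := by
      exact_mod_cast Nat.one_le_iff_ne_zero.mpr (calls_ne_zero hε hA)
    have h2 : ε⁻¹ ≤ 12 := by
      rw [inv_le_comm₀ hε0 (by norm_num)]
      linarith
    have h3 : 0 < ε⁻¹ := inv_pos.mpr hε0
    nlinarith

end IncoherentAlgorithm

/-! ### Distinguishing a random unitary channel from the depolarizing channel -/

theorem withFailure_conjMap {d : ℕ} (V : U d) (X : Op (Fin d)) :
    withFailure (conjMap (V : Op (Fin d))) X
      = padFailure (V : Op (Fin d)) * X * (padFailure (V : Op (Fin d)))ᴴ := by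
  ext p q
  rw [padFailure_mul_mul]
  rcases p with _ | i <;> rcases q with _ | j
  · simp only [withFailure, LinearMap.coe_mk, AddHom.coe_mk, Matrix.of_apply, conjMap_trace,
      sub_self]
  all_goals rfl

theorem depolarizing_trace {d : ℕ} [NeZero d] (X : Op (Fin d)) :
    (depolarizing d X).trace = X.trace := by
  have hd : (d : ℂ) ≠ 0 := Nat.cast_ne_zero.mpr (NeZero.ne d)
  simp [depolarizing, Matrix.trace_smul, hd]

theorem withFailure_depolarizing {d : ℕ} [NeZero d] (X : Op (Fin d)) :
    withFailure (depolarizing d) X = (1 / (d : ℂ)) • ∑ c : Fin d × Fin d,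
      padFailure (Matrix.single c.1 c.2 1) * X * (padFailure (Matrix.single c.1 c.2 1))ᴴ := by
  ext p q
  rw [Matrix.smul_apply, Matrix.sum_apply]
  simp only [padFailure_mul_mul]
  rcases p with _ | i <;> rcases q with _ | j
  · simp only [withFailure, LinearMap.coe_mk, AddHom.coe_mk, Matrix.of_apply, depolarizing_trace,
      sub_self, Finset.sum_const_zero, smul_zero]
  · simp [withFailure]
  · simp [withFailure]
  · simp only [withFailure, LinearMap.coe_mk, AddHom.coe_mk, Matrix.of_apply]
    rw [depolarizing_eq_sum, Matrix.sum_apply, Finset.smul_sum]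
    rfl

theorem trace_mul_conjTranspose_re {m n : Type} [Fintype m] [Fintype n] (A : Matrix m n ℂ) :
    (A * Aᴴ).trace.re = ∑ p : m × n, ‖A p.1 p.2‖ ^ 2 := by
  simp only [Matrix.trace, Matrix.diag_apply, Matrix.mul_apply, Matrix.conjTranspose_apply,
    Complex.re_sum, Fintype.sum_prod_type]
  refine Finset.sum_congr rfl fun i _ => Finset.sum_congr rfl fun j _ => ?_
  rw [← starRingEnd_apply, Complex.mul_conj, Complex.ofReal_re, Complex.normSq_eq_norm_sq]

/-- The coefficients of the amplitudes of a measurement after one call, as linear functionals of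
the Kraus operator. -/
def amplitude {d a : ℕ} (L : Op (Option (Fin d) × Fin a)) (R : Op (Fin d × Fin a))
    (p : (Option (Fin d) × Fin a) × (Fin d × Fin a)) (c : Fin d × Fin d) : ℂ :=
  ∑ x : Fin a, L p.1 (some c.1, x) * R (c.2, x) p.2

-- For an effect `Lᴴ L`, an input `R Rᴴ` and a Kraus operator `W`, the probability is the squared
-- Hilbert–Schmidt norm of `L (W ⊗ 1) R`, whose entries are linear forms in `W`.
open scoped Kronecker in
theorem trace_kraus_re {d a : ℕ} (L : Op (Option (Fin d) × Fin a)) (R : Op (Fin d × Fin a))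
    (W : Op (Fin d)) :
    (Lᴴ * L * ((padFailure W ⊗ₖ (1 : Op (Fin a))) * (R * Rᴴ)
      * (padFailure W ⊗ₖ (1 : Op (Fin a)))ᴴ)).trace.re
      = ∑ p, ‖∑ c, amplitude L R p c * W c.1 c.2‖ ^ 2 := by
  have h1 : (Lᴴ * L * ((padFailure W ⊗ₖ (1 : Op (Fin a))) * (R * Rᴴ)
      * (padFailure W ⊗ₖ (1 : Op (Fin a)))ᴴ)).trace
      = ((L * (padFailure W ⊗ₖ (1 : Op (Fin a))) * R)
        * (L * (padFailure W ⊗ₖ (1 : Op (Fin a))) * R)ᴴ).trace := by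
    rw [mul_assoc Lᴴ, Matrix.trace_mul_comm]
    simp only [Matrix.conjTranspose_mul, Matrix.mul_assoc]
  rw [h1, trace_mul_conjTranspose_re]
  refine Finset.sum_congr rfl fun p _ => ?_
  congr 2
  have h2 : ∀ (y : Fin d × Fin a), (L * (padFailure W ⊗ₖ (1 : Op (Fin a)))) p.1 y
      = ∑ i, L p.1 (some i, y.2) * W i y.1 := by
    intro y
    rw [Matrix.mul_apply, Fintype.sum_prod_type, Fintype.sum_option]
    simp [Matrix.kroneckerMap_apply, padFailure, Matrix.one_apply]
  rw [Matrix.mul_apply]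
  simp only [h2, amplitude, Fintype.sum_prod_type, Finset.sum_mul]
  rw [Finset.sum_comm (s := (Finset.univ : Finset (Fin d))) (t := (Finset.univ : Finset (Fin d)))]
  refine Finset.sum_congr rfl fun j _ => ?_
  rw [Finset.sum_comm]
  exact Finset.sum_congr rfl fun i _ => Finset.sum_congr rfl fun x _ => by ring

theorem trace_amplify_conjMap {d a : ℕ} (L : Op (Option (Fin d) × Fin a))
    (R : Op (Fin d × Fin a)) (V : U d) :
    (Lᴴ * L * amplify (Fin a) (withFailure (conjMap (V : Op (Fin d)))) (R * Rᴴ)).trace.re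
      = ∑ p, ‖∑ c, amplitude L R p c * (V : Op (Fin d)) c.1 c.2‖ ^ 2 := by
  rw [amplify_of_kraus (ι := Unit) (fun _ => padFailure (V : Op (Fin d)))
    (fun X => by rw [withFailure_conjMap]; simp), Fintype.sum_unique, trace_kraus_re]

/-- The Kraus operators are the matrix units divided by `√d`, and each matrix unit reads off one
coefficient of the linear forms. -/
theorem trace_amplify_depolarizing {d a : ℕ} [NeZero d] (L : Op (Option (Fin d) × Fin a))
    (R : Op (Fin d × Fin a)) :
    (Lᴴ * L * amplify (Fin a) (withFailure (depolarizing d)) (R * Rᴴ)).trace.re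
      = 1 / d * ∑ p, ∑ c, ‖amplitude L R p c‖ ^ 2 := by
  have hs : ((Real.sqrt (1 / d) : ℝ) : ℂ) * (Real.sqrt (1 / d) : ℝ) = 1 / d := by
    rw [← Complex.ofReal_mul, Real.mul_self_sqrt (by positivity)]
    push_cast
    rfl
  have h : ∀ X, withFailure (depolarizing d) X = ∑ c : Fin d × Fin d,
      padFailure (((Real.sqrt (1 / d) : ℝ) : ℂ) • Matrix.single c.1 c.2 1) * X
        * (padFailure (((Real.sqrt (1 / d) : ℝ) : ℂ) • Matrix.single c.1 c.2 1))ᴴ := by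
    intro X
    rw [withFailure_depolarizing, Finset.smul_sum, ← hs]
    refine Finset.sum_congr rfl fun c _ => ?_
    ext p q
    rw [Matrix.smul_apply, padFailure_mul_mul, padFailure_mul_mul]
    rcases p with _ | i <;> rcases q with _ | j
    · simp
    · simp
    · simp
    · simp only [Matrix.smul_mul, Matrix.conjTranspose_smul, Matrix.mul_smul, Matrix.smul_apply,
        smul_smul]
      simp
  rw [amplify_of_kraus _ h, Matrix.mul_sum, Matrix.trace_sum, Complex.re_sum]
  simp only [trace_kraus_re]
  rw [Finset.sum_comm, Finset.mul_sum]
  refine Finset.sum_congr rfl fun p _ => ?_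
  rw [Finset.mul_sum]
  refine Finset.sum_congr rfl fun c _ => ?_
  rw [Finset.sum_eq_single c]
  · simp only [Matrix.smul_apply, Matrix.single_apply_same, smul_eq_mul, mul_one, norm_mul,
      mul_pow, Complex.norm_real, Real.norm_eq_abs, sq_abs]
    rw [Real.sq_sqrt (by positivity), mul_comm]
  · intro b _ hb
    rw [Matrix.smul_apply, Matrix.single_apply_of_ne, smul_zero, mul_zero]
    exact fun h => hb (Prod.ext h.1.symm h.2.symm)
  · simp

theorem risingProd_le {d : ℕ} (hd : 0 < d) (T : ℕ) :
    ∏ i ∈ Finset.range T, ((d : ℝ) + i) ≤ d ^ T * Real.exp (T ^ 2 / d) := by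
  have hd' : (0 : ℝ) < d := Nat.cast_pos.mpr hd
  calc ∏ i ∈ Finset.range T, ((d : ℝ) + i)
      ≤ ∏ _i ∈ Finset.range T, (d * Real.exp (T / d)) := by
        refine Finset.prod_le_prod (fun i _ => by positivity) fun i hi => ?_
        have h1 := Real.add_one_le_exp ((T : ℝ) / d)
        have h2 : (i : ℝ) ≤ T := Nat.cast_le.mpr (Finset.mem_range.mp hi).le
        calc (d : ℝ) + i ≤ d * (T / d + 1) := by
              rw [mul_add, mul_div_cancel₀ _ hd'.ne']
              linarith
          _ ≤ _ := mul_le_mul_of_nonneg_left h1 hd'.le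
    _ = d ^ T * Real.exp (T ^ 2 / d) := by
        rw [Finset.prod_const, Finset.card_range, mul_pow, ← Real.exp_nat_mul]
        congr 2
        ring

namespace IncoherentAlgorithm

variable {d : ℕ} (A : IncoherentAlgorithm d)

/-- The point is that the same linear forms serve the depolarizing channel and every unitary
channel. -/
theorem exists_amplitude (ω : A.Seed) (t : ℕ) (h : Fin t → A.Out) (v : A.Out) :
    ∃ B : ((Option (Fin d) × Fin A.anc) × (Fin d × Fin A.anc)) → Fin d × Fin d → ℂ,
      (∀ V : U d, A.roundProb (conjMap (V : Op (Fin d))) ω t h v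
        = ∑ p, ‖∑ c, B p c * (V : Op (Fin d)) c.1 c.2‖ ^ 2) ∧
      ∀ [NeZero d], A.roundProb (depolarizing d) ω t h v = 1 / d * ∑ p, ∑ c, ‖B p c‖ ^ 2 := by
  obtain ⟨L, hL⟩ := exists_factor_of_posSemidef (A.povm_pos ω t h v)
  obtain ⟨R, hR⟩ := exists_factor_of_posSemidef (A.input_pos ω t h)
  have hR' : A.input ω t h = Rᴴ * Rᴴᴴ := by rw [hR, Matrix.conjTranspose_conjTranspose]
  refine ⟨amplitude L Rᴴ, fun V => ?_, ?_⟩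
  · rw [roundProb, hL, hR', trace_amplify_conjMap]
  · intro _
    rw [roundProb, hL, hR', trace_amplify_depolarizing]

theorem continuous_prob_conjMap (ω : A.Seed) (h : Fin A.calls → A.Out) :
    Continuous fun V : U d => A.prob (conjMap (V : Op (Fin d))) ω h := by
  simp only [prob_eq]
  refine continuous_finsetProd _ fun t _ => ?_
  obtain ⟨B, hB, -⟩ := A.exists_amplitude ω t (A.past h t) (h t)
  simp only [hB]
  exact continuous_finsetSum _ fun p _ => ((continuous_finsetSum _ fun c _ =>
    continuous_const.mul (continuous_unitary_entry _ _)).norm).pow 2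

/-- A fixed sequence of outcomes fixes all inputs and effects, so adaptivity plays no role.
Expanding the product of sums over the rounds leaves products of squared linear forms, to each of
which `prod_le_integral_prod_linear` applies. -/
theorem prob_depolarizing_le [NeZero d] (ω : A.Seed) (h : Fin A.calls → A.Out) :
    (d : ℝ) ^ A.calls * A.prob (depolarizing d) ω h ≤ (∏ i ∈ Finset.range A.calls, ((d : ℝ) + i))
      * ∫ V : U d, A.prob (conjMap (V : Op (Fin d))) ω h ∂haar d := by
  have hd : (d : ℝ) ≠ 0 := Nat.cast_ne_zero.mpr (NeZero.ne d)
  choose B hB hB' using fun t : Fin A.calls => A.exists_amplitude ω t (A.past h t) (h t)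
  simp only [prob_eq, hB, hB', Finset.prod_mul_distrib, Finset.prod_const, Finset.card_univ,
    Fintype.card_fin, Finset.prod_univ_sum, Fintype.piFinset_univ]
  rw [← mul_assoc, ← mul_pow, mul_one_div_cancel hd, one_pow, one_mul, integral_finsetSum,
    Finset.mul_sum]
  · refine Finset.sum_le_sum fun x _ => ?_
    have := prod_le_integral_prod_linear fun t => B t (x t)
    rwa [Finset.prod_univ_sum, Fintype.piFinset_univ] at this
  · exact fun x _ => integrable_haar (continuous_finsetProd _ fun t _ =>
      ((continuous_finsetSum _ fun c _ =>
        continuous_const.mul (continuous_unitary_entry _ _)).norm).pow 2)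

theorem continuous_accept_conjMap (ω : A.Seed) (x ε : ℝ) :
    Continuous fun V : U d => A.accept (conjMap (V : Op (Fin d))) ω x ε := by
  refine continuous_finsetSum _ fun h _ => ?_
  split_ifs
  · exact A.continuous_prob_conjMap ω h
  · exact continuous_const

theorem accept_depolarizing_le [NeZero d] (ω : A.Seed) (x ε : ℝ) :
    (d : ℝ) ^ A.calls * A.accept (depolarizing d) ω x ε
      ≤ (∏ i ∈ Finset.range A.calls, ((d : ℝ) + i))
        * ∫ V : U d, A.accept (conjMap (V : Op (Fin d))) ω x ε ∂haar d := by
  unfold accept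
  rw [integral_finsetSum, Finset.mul_sum, Finset.mul_sum]
  · refine Finset.sum_le_sum fun h _ => ?_
    split_ifs
    · exact A.prob_depolarizing_le ω h
    · simp
  · intro h _
    split_ifs
    · exact integrable_haar (A.continuous_prob_conjMap ω h)
    · exact integrable_zero _ _ _

theorem measurable_prob (E : Op (Fin d) →ₗ[ℂ] Op (Fin d)) (h : Fin A.calls → A.Out) :
    Measurable fun ω => A.prob E ω h := by
  unfold prob
  refine Finset.measurable_fun_prod _ fun t _ => Complex.measurable_re.comp ?_
  simp only [Matrix.trace, Matrix.diag_apply, Matrix.mul_apply]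
  refine Finset.measurable_fun_sum _ fun p _ => Finset.measurable_fun_sum _ fun q _ =>
    (A.povm_meas _ _ _ _ _).mul ?_
  simp only [amplify, LinearMap.coe_mk, AddHom.coe_mk, Matrix.of_apply]
  have key : ∀ ω, withFailure E (Matrix.of fun i j => A.input ω t (A.past h t) (i, q.2) (j, p.2))
      q.1 p.1 = ∑ i, ∑ j, A.input ω t (A.past h t) (i, q.2) (j, p.2)
        * withFailure E (Matrix.single i j 1) q.1 p.1 := by
    intro ω
    rw [linearMap_eq_sum (withFailure E)]
    simp only [Matrix.sum_apply, Matrix.smul_apply, Matrix.of_apply, smul_eq_mul]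
  simp only [key]
  exact Finset.measurable_fun_sum _ fun i _ => Finset.measurable_fun_sum _ fun j _ =>
    (A.input_meas _ _ _ _).mul_const _

theorem measurable_accept (E : Op (Fin d) →ₗ[ℂ] Op (Fin d)) (x ε : ℝ) :
    Measurable fun ω => A.accept E ω x ε := by
  refine Finset.measurable_fun_sum _ fun h _ => Measurable.ite ?_ (A.measurable_prob E h)
    measurable_const
  exact measurableSet_le ((A.value_meas h).sub_const x).abs measurable_const

variable {A}

/-- Each outcome is almost as likely for the average over random unitary channels as for the
depolarizing channel. Hence an estimate near `0`, frequent in the latter case, would be too frequent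
in the former. -/
theorem calls_lower_bound_dimension [d.AtLeastTwo] {ε : ℝ} (hε : ε < 1 / 2)
    (hA : A.Estimates altUnitarity ε) : √(d : ℝ) ≤ 2 * A.calls := by
  have hd0 : 0 < d := Nat.pos_of_ne_zero (NeZero.ne d)
  have hd : (0 : ℝ) < d := Nat.cast_pos.mpr hd0
  set r : ℝ := ∏ i ∈ Finset.range A.calls, ((d : ℝ) + i) with hr
  have hr0 : 0 < r := Finset.prod_pos fun i _ => by positivity
  have hmeas : Measurable (Function.uncurry fun (V : U d) (ω : A.Seed) =>
      A.accept (conjMap (V : Op (Fin d))) ω 1 ε) :=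
    measurable_uncurry_of_continuous_of_measurable
      (u := fun (V : U d) (ω : A.Seed) => A.accept (conjMap (V : Op (Fin d))) ω 1 ε)
      (fun ω => A.continuous_accept_conjMap ω 1 ε) fun V => A.measurable_accept _ 1 ε
  have hint : Integrable (Function.uncurry fun (V : U d) (ω : A.Seed) =>
      A.accept (conjMap (V : Op (Fin d))) ω 1 ε) ((haar d).prod A.law) := by
    refine Integrable.of_bound hmeas.aestronglyMeasurable 1 (Filter.Eventually.of_forall ?_)
    rintro ⟨V, ω⟩
    rw [Function.uncurry_apply_pair, Real.norm_eq_abs,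
      abs_of_nonneg (accept_nonneg (isChannel_conjMap V) ω 1 ε)]
    exact accept_le_one (isChannel_conjMap V) ω 1 ε
  have h1 := hA _ (isChannel_depolarizing d)
  rw [successProb_eq, altUnitarity_depolarizing] at h1
  -- The guarantee for each unitary is averaged over the group, and Fubini's theorem puts the
  -- integral over the seed outside.
  have h2 : 2 / 3 ≤ ∫ ω, ∫ V : U d, A.accept (conjMap (V : Op (Fin d))) ω 1 ε ∂haar d ∂A.law := by
    rw [← integral_integral_swap hint]
    have h3 : ∀ V : U d, 2 / 3 ≤ ∫ ω, A.accept (conjMap (V : Op (Fin d))) ω 1 ε ∂A.law := by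
      intro V
      have := hA _ (isChannel_conjMap V)
      rwa [successProb_eq, altUnitarity_conjMap] at this
    have h4 := integral_mono (integrable_const (2 / 3 : ℝ)) hint.integral_prod_left h3
    rwa [integral_const, probReal_univ, one_smul] at h4
  -- The weights are `d ^ A.calls` and the rising product `r`. The outcome is `2 * d ^ A.calls ≤ r`.
  have h := le_of_integral_two_thirds h1 h2 (pow_nonneg hd.le A.calls) hr0.le (γ := r) fun ω => by
    have h3 := A.accept_depolarizing_le ω 0 ε
    rw [← hr] at h3
    have h4 : ∫ V : U d, A.accept (conjMap (V : Op (Fin d))) ω 0 ε ∂haar d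
        + ∫ V : U d, A.accept (conjMap (V : Op (Fin d))) ω 1 ε ∂haar d ≤ 1 := by
      rw [← integral_add (integrable_haar (A.continuous_accept_conjMap ω 0 ε))
        (integrable_haar (A.continuous_accept_conjMap ω 1 ε))]
      have h5 := integral_mono ((integrable_haar (A.continuous_accept_conjMap ω 0 ε)).add
        (integrable_haar (A.continuous_accept_conjMap ω 1 ε))) (integrable_const (1 : ℝ))
        fun V => accept_add_le (A := A) (isChannel_conjMap V) ω fun v h6 h7 =>
          depolarizing_separated d hε V v (by rwa [altUnitarity_conjMap])
            (by rwa [altUnitarity_depolarizing])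
      rwa [integral_const, probReal_univ, one_smul] at h5
    nlinarith
  have h3 := risingProd_le hd0 A.calls
  rw [← hr] at h3
  have h4 : 2 ≤ Real.exp ((A.calls : ℝ) ^ 2 / d) := by
    have h5 : (d : ℝ) ^ A.calls * 2 ≤ d ^ A.calls * Real.exp ((A.calls : ℝ) ^ 2 / d) := by linarith
    exact le_of_mul_le_mul_left h5 (pow_pos hd _)
  -- This holds because `exp (1 / 2) < 2`, which is `exp 1 < 4`.
  have h5 : (1 : ℝ) / 2 ≤ (A.calls : ℝ) ^ 2 / d := by
    by_contra hlt
    have h6 : Real.exp ((A.calls : ℝ) ^ 2 / d) < Real.exp (1 / 2) :=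
      Real.exp_lt_exp.mpr (not_le.mp hlt)
    have h7 : Real.exp (1 / 2) ^ 2 = Real.exp 1 := by
      rw [← Real.exp_nat_mul]
      norm_num
    have h8 := Real.exp_one_lt_d9
    have h9 := Real.exp_pos (1 / 2)
    nlinarith
  rw [le_div_iff₀ hd] at h5
  rw [Real.sqrt_le_left (by positivity)]
  nlinarith

theorem calls_lower_bound [d.AtLeastTwo] {ε : ℝ} (hε0 : 0 < ε) (hε : ε < 1 / 2)
    (hA : A.Estimates altUnitarity ε) : 1 / 576 * (√(d : ℝ) + ε⁻¹ ^ 2) ≤ (A.calls : ℝ) := by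
  have h1 := calls_lower_bound_dimension hε hA
  have h2 := calls_lower_bound_precision hε0 hε hA
  have h3 : (0 : ℝ) ≤ A.calls := Nat.cast_nonneg _
  linarith

end IncoherentAlgorithm

/-! ### The swap operator and the swap test -/

/-- The swap operator `|i⟩|j⟩ ↦ |j⟩|i⟩`. -/
def swapOp (d : ℕ) : Op (Fin d × Fin d) :=
  Matrix.of fun p q => if q = p.swap then 1 else 0

theorem swapOp_mul {d : ℕ} (M : Op (Fin d × Fin d)) (p q : Fin d × Fin d) :
    (swapOp d * M) p q = M p.swap q := by
  rw [Matrix.mul_apply]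
  simp [swapOp]

theorem swapOp_mul_self (d : ℕ) : swapOp d * swapOp d = 1 := by
  ext p q
  rw [swapOp_mul, Matrix.one_apply]
  simp [swapOp, eq_comm]

theorem swapOp_conjTranspose (d : ℕ) : (swapOp d)ᴴ = swapOp d := by
  ext p q
  rw [Matrix.conjTranspose_apply]
  simp only [swapOp, Matrix.of_apply]
  by_cases h : q = p.swap
  · rw [if_pos h, if_pos (by rw [h, Prod.swap_swap]), star_one]
  · rw [if_neg h, if_neg (fun h' => h (by rw [h', Prod.swap_swap])), star_zero]

theorem swapOp_trace (d : ℕ) : (swapOp d).trace = d := by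
  simp only [Matrix.trace, Matrix.diag_apply, swapOp, Matrix.of_apply, Fintype.sum_prod_type,
    Prod.swap_prod_mk, Prod.mk.injEq]
  have : ∀ i j : Fin d, (if i = j ∧ j = i then (1 : ℂ) else 0) = if i = j then 1 else 0 :=
    fun i j => by simp [eq_comm]
  simp [this]

theorem posSemidef_one_add_mul {n : Type} [Fintype n] [DecidableEq n] {F : Op n} (h1 : Fᴴ = F)
    (h2 : F * F = 1) : (1 + F).PosSemidef := by
  have h : 1 + F = (1 / 2 : ℂ) • ((1 + F)ᴴ * (1 + F)) := by
    rw [Matrix.conjTranspose_add, Matrix.conjTranspose_one, h1, add_mul, mul_add, mul_add, h2]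
    simp only [one_mul, mul_one, smul_add]
    ext i j
    simp only [Matrix.add_apply, Matrix.smul_apply, smul_eq_mul]
    ring
  rw [h]
  refine (Matrix.posSemidef_conjTranspose_mul_self _).smul ?_
  rw [Complex.le_def]
  norm_num

theorem one_add_swapOp_posSemidef (d : ℕ) : (1 + swapOp d).PosSemidef :=
  posSemidef_one_add_mul (swapOp_conjTranspose d) (swapOp_mul_self d)

theorem one_sub_swapOp_posSemidef (d : ℕ) : (1 - swapOp d).PosSemidef := by
  rw [sub_eq_add_neg]
  refine posSemidef_one_add_mul ?_ ?_
  · rw [Matrix.conjTranspose_neg, swapOp_conjTranspose]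
  · rw [neg_mul_neg, swapOp_mul_self]

open scoped Kronecker in
theorem swapOp_eq_sum (d : ℕ) : swapOp d
    = ∑ i, ∑ j, Matrix.single i j (1 : ℂ) ⊗ₖ Matrix.single j i (1 : ℂ) := by
  ext p q
  simp only [Matrix.sum_apply, Matrix.kroneckerMap_apply, Matrix.single_apply, swapOp,
    Matrix.of_apply]
  rw [Finset.sum_eq_single p.1, Finset.sum_eq_single p.2]
  · rcases p with ⟨a, b⟩
    rcases q with ⟨x, y⟩
    by_cases h1 : b = x <;> by_cases h2 : a = y <;> simp [h1, h2, eq_comm]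
  · intro j _ hj
    simp [hj]
  · simp
  · intro i _ hi
    simp [hi]
  · simp

open scoped Kronecker in
theorem trace_swapOp_kronecker {d : ℕ} (A B : Op (Fin d)) :
    (swapOp d * (A ⊗ₖ B)).trace = (A * B).trace := by
  have h : ∀ p, (swapOp d * (A ⊗ₖ B)) p p = A p.2 p.1 * B p.1 p.2 := fun p => swapOp_mul _ _ _
  simp only [Matrix.trace, Matrix.diag_apply, h, Matrix.mul_apply, Fintype.sum_prod_type]
  exact Finset.sum_comm

/-- The normalized projection onto the symmetric (for even `r`) or antisymmetric (for odd `r`)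
subspace. -/
def swapState (d r : ℕ) : Op (Fin d × Fin d) :=
  if Even r then ((1 / (d * (d + 1)) : ℝ) : ℂ) • (1 + swapOp d)
  else ((1 / (d * (d - 1)) : ℝ) : ℂ) • (1 - swapOp d)

theorem swapState_posSemidef (d r : ℕ) : (swapState d r).PosSemidef := by
  unfold swapState
  split_ifs
  · exact (one_add_swapOp_posSemidef d).smul (by rw [Complex.zero_le_real]; positivity)
  · refine (one_sub_swapOp_posSemidef d).smul ?_
    rw [Complex.zero_le_real]
    rcases Nat.eq_zero_or_pos d with rfl | hd
    · simp
    · have : (1 : ℝ) ≤ d := by exact_mod_cast hd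
      have : (0 : ℝ) ≤ d - 1 := by linarith
      positivity

theorem natCast_sub_one_ne_zero (d : ℕ) [d.AtLeastTwo] : (d : ℂ) - 1 ≠ 0 := by
  have h2 : 2 ≤ d := Nat.AtLeastTwo.prop
  rw [sub_ne_zero]
  norm_cast
  omega

theorem natCast_add_one_ne_zero' (d : ℕ) : (d : ℂ) + 1 ≠ 0 := by
  exact_mod_cast Nat.succ_ne_zero d

theorem swapState_trace (d r : ℕ) [d.AtLeastTwo] : (swapState d r).trace = 1 := by
  have hd := natCast_ne_zero_of_two (d := d)
  have h1 := natCast_sub_one_ne_zero d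
  have h2 := natCast_add_one_ne_zero' d
  unfold swapState
  split_ifs <;>
  · rw [Matrix.trace_smul]
    simp only [Matrix.trace_add, Matrix.trace_sub, Matrix.trace_one, swapOp_trace,
      Fintype.card_prod, Fintype.card_fin, smul_eq_mul]
    push_cast
    field_simp
    try ring

/-- The difference is proportional to the traceless part of the swap operator. Expanding the latter
as `∑ Eᵢⱼ ⊗ Eⱼᵢ` is what turns an average over these inputs into a `swapSum`. -/
theorem swapState_sub (d : ℕ) [d.AtLeastTwo] : swapState d 0 - swapState d 1
    = (2 / ((d : ℂ) ^ 2 - 1)) • (swapOp d - (1 / (d : ℂ)) • 1) := by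
  have hd := natCast_ne_zero_of_two (d := d)
  have h1 := natCast_sub_one_ne_zero d
  have h2 := natCast_add_one_ne_zero' d
  have h3 : (d : ℂ) ^ 2 - 1 ≠ 0 := by
    rw [show (d : ℂ) ^ 2 - 1 = (d - 1) * (d + 1) by ring]
    exact mul_ne_zero h1 h2
  simp only [swapState, Even.zero, if_true, Nat.not_even_one, if_false]
  ext p q
  simp only [Matrix.sub_apply, Matrix.smul_apply, Matrix.add_apply, smul_eq_mul]
  push_cast
  rw [show (d : ℂ) ^ 2 - 1 = (d - 1) * (d + 1) by ring]
  field_simp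
  ring

theorem swapState_even_odd (d r : ℕ) : swapState d (2 * r) = swapState d 0 ∧
    swapState d (2 * r + 1) = swapState d 1 := by
  simp [swapState]

/-- The isometry that adds the failure state to the main system. -/
def failurePad (d : ℕ) : Matrix (Option (Fin d) × Fin d) (Fin d × Fin d) ℂ :=
  Matrix.of fun p q => if p = (some q.1, q.2) then 1 else 0

theorem failurePad_isometry (d : ℕ) : (failurePad d)ᴴ * failurePad d = 1 := by
  ext p q
  rw [Matrix.mul_apply]
  simp only [Matrix.conjTranspose_apply, failurePad, Matrix.of_apply, Matrix.one_apply]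
  rw [Finset.sum_eq_single (some p.1, p.2)]
  · by_cases h : p = q
    · simp [h]
    · have : ¬ (some p.1, p.2) = (some q.1, q.2) := fun h' => h (by
        simp only [Prod.mk.injEq, Option.some.injEq] at h'
        exact Prod.ext h'.1 h'.2)
      rw [if_neg h, if_neg this, mul_zero]
  · intro x _ hx
    simp [hx]
  · simp

theorem failurePad_compress {d : ℕ} (E : Op (Fin d) →ₗ[ℂ] Op (Fin d)) (M : Op (Fin d × Fin d)) :
    (failurePad d)ᴴ * amplify (Fin d) (withFailure E) M * failurePad d
      = amplify (Fin d) E M := by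
  ext p q
  rw [Matrix.mul_apply, Finset.sum_eq_single (some q.1, q.2)]
  · rw [Matrix.mul_apply, Finset.sum_eq_single (some p.1, p.2)]
    · simp [failurePad, amplify, withFailure]
    · intro x _ hx
      simp [failurePad, hx]
    · simp
  · intro x _ hx
    simp [failurePad, hx]
  · simp

/-- The swap test, with an additional outcome for a failed call. -/
def swapTest (d : ℕ) : Fin 3 → Op (Option (Fin d) × Fin d) :=
  ![failurePad d * ((1 / 2 : ℂ) • (1 + swapOp d)) * (failurePad d)ᴴ,
    failurePad d * ((1 / 2 : ℂ) • (1 - swapOp d)) * (failurePad d)ᴴ,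
    1 - failurePad d * (failurePad d)ᴴ]

theorem swapTest_posSemidef (d : ℕ) (o : Fin 3) : (swapTest d o).PosSemidef := by
  have h2 : (0 : ℂ) ≤ 1 / 2 := by
    rw [Complex.le_def]
    norm_num
  fin_cases o
  · exact ((one_add_swapOp_posSemidef d).smul h2).mul_mul_conjTranspose_same _
  · exact ((one_sub_swapOp_posSemidef d).smul h2).mul_mul_conjTranspose_same _
  · have h : ∀ Q : Op (Option (Fin d) × Fin d), Qᴴ = Q → Q * Q = Q → (1 - Q).PosSemidef := by
      intro Q h1 h3
      have : 1 - Q = (1 - Q)ᴴ * (1 - Q) := by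
        rw [Matrix.conjTranspose_sub, Matrix.conjTranspose_one, h1, sub_mul, mul_sub, mul_sub, h3]
        simp
      rw [this]
      exact Matrix.posSemidef_conjTranspose_mul_self _
    refine h _ ?_ ?_
    · rw [Matrix.conjTranspose_mul, Matrix.conjTranspose_conjTranspose]
    · rw [Matrix.mul_assoc, ← Matrix.mul_assoc (failurePad d)ᴴ, failurePad_isometry,
        Matrix.one_mul]

theorem swapTest_sum (d : ℕ) : ∑ o, swapTest d o = 1 := by
  rw [Fin.sum_univ_three]
  simp only [swapTest, Matrix.cons_val_zero, Matrix.cons_val_one, Matrix.cons_val]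
  rw [← Matrix.add_mul, ← Matrix.mul_add]
  have : (1 / 2 : ℂ) • (1 + swapOp d) + (1 / 2 : ℂ) • (1 - swapOp d) = 1 := by
    rw [← smul_add, add_add_sub_cancel, ← two_smul ℂ (1 : Op (Fin d × Fin d)), smul_smul]
    norm_num
  rw [this, Matrix.mul_one, add_sub_cancel]

/-- The values of the outcomes of the swap test. -/
def swapValue (d : ℕ) : Fin 3 → ℝ := ![1 - 1 / d, -(1 + 1 / d), 0]

theorem swapValue_sq_le (d : ℕ) [d.AtLeastTwo] (o : Fin 3) : swapValue d o ^ 2 ≤ 9 / 4 := by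
  have h2 : (2 : ℝ) ≤ d := by exact_mod_cast (Nat.AtLeastTwo.prop : 2 ≤ d)
  have h3 : 1 / (d : ℝ) ≤ 1 / 2 := one_div_le_one_div_of_le (by norm_num) h2
  have h4 : 0 ≤ 1 / (d : ℝ) := by positivity
  unfold swapValue
  generalize 1 / (d : ℝ) = x at *
  fin_cases o <;> norm_num <;> nlinarith

/-- The outcomes carry the eigenvalues `±1` of the swap operator, shifted by `-1 / d`. The shift
implements the removal of the trace; a failure counts zero. -/
theorem sum_swapValue_smul_swapTest (d : ℕ) : ∑ o, (swapValue d o : ℂ) • swapTest d o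
    = failurePad d * (swapOp d - (1 / (d : ℂ)) • 1) * (failurePad d)ᴴ := by
  rw [Fin.sum_univ_three]
  simp only [swapTest, swapValue, Matrix.cons_val_zero, Matrix.cons_val_one, Matrix.cons_val,
    Complex.ofReal_zero, zero_smul, add_zero]
  have h : ∀ (a : ℂ) (X : Op (Fin d × Fin d)), a • (failurePad d * X * (failurePad d)ᴴ)
      = failurePad d * (a • X) * (failurePad d)ᴴ := fun a X => by
    rw [Matrix.mul_smul, Matrix.smul_mul]
  rw [h, h, ← Matrix.add_mul, ← Matrix.mul_add]
  congr 2
  ext p q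
  simp only [Matrix.sub_apply, Matrix.smul_apply, Matrix.add_apply, smul_eq_mul]
  push_cast
  ring

/-! ### Two consecutive calls on the two halves of a state. -/

/-- The exchange of the main system and the ancilla, where a failed call is replaced by the
maximally mixed state. -/
def swapRecover (d : ℕ) : Op (Option (Fin d) × Fin d) →ₗ[ℂ] Op (Fin d × Fin d) where
  toFun M := Matrix.of fun p q => M (some p.2, p.1) (some q.2, q.1)
    + if p.2 = q.2 then 1 / (d : ℂ) * M (none, p.1) (none, q.1) else 0
  map_add' M N := by
    ext p q
    simp only [Matrix.of_apply, Matrix.add_apply]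
    split_ifs <;> ring
  map_smul' c M := by
    ext p q
    simp only [Matrix.of_apply, Matrix.smul_apply, smul_eq_mul, RingHom.id_apply]
    split_ifs <;> ring

theorem swapRecover_apply {d : ℕ} (M : Op (Option (Fin d) × Fin d)) (p q : Fin d × Fin d) :
    swapRecover d M p q = M (some p.2, p.1) (some q.2, q.1)
      + if p.2 = q.2 then 1 / (d : ℂ) * M (none, p.1) (none, q.1) else 0 := rfl

theorem swapRecover_trace {d : ℕ} [NeZero d] (M : Op (Option (Fin d) × Fin d)) :
    (swapRecover d M).trace = M.trace := by
  have hd : (d : ℂ) ≠ 0 := Nat.cast_ne_zero.mpr (NeZero.ne d)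
  simp only [Matrix.trace, Matrix.diag_apply, swapRecover_apply, if_true, Fintype.sum_prod_type,
    Fintype.sum_option, Finset.sum_add_distrib, Finset.sum_const, Finset.card_univ,
    Fintype.card_fin, nsmul_eq_mul]
  rw [add_comm, Finset.sum_comm]
  congr 1
  exact Finset.sum_congr rfl fun a _ => by field_simp

theorem isCP_swapRecover (d : ℕ) : IsCP (swapRecover d) := by
  have hs : ((Real.sqrt (1 / d) : ℝ) : ℂ) * (Real.sqrt (1 / d) : ℝ) = 1 / d := by
    rw [← Complex.ofReal_mul, Real.mul_self_sqrt (by positivity)]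
    push_cast
    rfl
  have key : ∀ (f g : Fin d × Fin d → Option (Fin d) × Fin d) (a b : Fin d × Fin d → ℂ)
      (X : Op (Option (Fin d) × Fin d)) (p q : Fin d × Fin d),
      ((Matrix.of fun p x => if x = f p then a p else 0 : Matrix (Fin d × Fin d) _ ℂ) * X
        * (Matrix.of fun p x => if x = g p then b p else 0 : Matrix (Fin d × Fin d) _ ℂ)ᴴ) p q
        = a p * X (f p) (g q) * star (b q) := by
    intro f g a b X p q
    simp only [Matrix.mul_apply, Matrix.conjTranspose_apply, Matrix.of_apply]
    rw [Finset.sum_eq_single (g q)]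
    · rw [Finset.sum_eq_single (f p)]
      · simp
      · intro x _ hx
        simp [hx]
      · simp
    · intro x _ hx
      simp [hx]
    · simp
  -- One Kraus operator exchanges the two systems after a success. The other ones replace a failure
  -- by a basis state `c`, with amplitude `√(1 / d)`.
  refine isCP_of_fintype (ι := Option (Fin d)) (fun c => match c with
    | none => Matrix.of fun p x => if x = (some p.2, p.1) then 1 else 0
    | some c => Matrix.of fun p x => if x = (none, p.1) then
        (if p.2 = c then ((Real.sqrt (1 / d) : ℝ) : ℂ) else 0) else 0) fun X => ?_
  ext p q
  rw [Fintype.sum_option, swapRecover_apply, Matrix.add_apply, Matrix.sum_apply]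
  congr 1
  · rw [key (fun p => (some p.2, p.1)) (fun p => (some p.2, p.1)) (fun _ => 1) (fun _ => 1)]
    simp
  · have h1 := fun c => key (fun p => (none, p.1)) (fun p => (none, p.1))
      (fun p => if p.2 = c then ((Real.sqrt (1 / d) : ℝ) : ℂ) else 0)
      (fun p => if p.2 = c then ((Real.sqrt (1 / d) : ℝ) : ℂ) else 0) X p q
    rw [Finset.sum_congr rfl fun c _ => h1 c, Finset.sum_eq_single p.2]
    · by_cases h : p.2 = q.2
      · rw [if_pos h, if_pos rfl, if_pos h.symm, ← hs, Complex.star_def, Complex.conj_ofReal]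
        ring
      · rw [if_neg h, if_neg (Ne.symm h), star_zero, mul_zero]
    · intro c _ hc
      rw [if_neg (Ne.symm hc)]
      ring
    · simp

/-- The joint output of two calls, on the main system and the ancilla. -/
def pairCall {d : ℕ} (E : Op (Fin d) →ₗ[ℂ] Op (Fin d)) :
    Op (Fin d × Fin d) →ₗ[ℂ] Op (Option (Fin d) × Fin d) :=
  amplify (Fin d) (withFailure E) ∘ₗ swapRecover d ∘ₗ amplify (Fin d) (withFailure E)

open scoped Kronecker in
theorem amplify_kronecker {m n a : Type} (Φ : Op m →ₗ[ℂ] Op n) (X : Op m) (Y : Op a) :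
    amplify a Φ (X ⊗ₖ Y) = Φ X ⊗ₖ Y := by
  ext p q
  have : (Matrix.of fun i j => (X ⊗ₖ Y) (i, p.2) (j, q.2)) = Y p.2 q.2 • X := by
    ext i j
    simp [Matrix.kroneckerMap_apply, mul_comm]
  simp only [amplify, LinearMap.coe_mk, AddHom.coe_mk, Matrix.of_apply]
  rw [this, map_smul, Matrix.smul_apply, Matrix.kroneckerMap_apply, smul_eq_mul, mul_comm]

open scoped Kronecker in
theorem swapRecover_kronecker {d : ℕ} (E : Op (Fin d) →ₗ[ℂ] Op (Fin d)) (X Y : Op (Fin d)) :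
    swapRecover d (withFailure E X ⊗ₖ Y)
      = Y ⊗ₖ (E X + ((X.trace - (E X).trace) / d) • (1 : Op (Fin d))) := by
  ext p q
  rw [swapRecover_apply]
  simp only [Matrix.kroneckerMap_apply, withFailure, LinearMap.coe_mk, AddHom.coe_mk,
    Matrix.of_apply, Matrix.add_apply, Matrix.smul_apply, Matrix.one_apply, smul_eq_mul]
  split_ifs <;> ring

theorem trace_pairCall {d : ℕ} (E : Op (Fin d) →ₗ[ℂ] Op (Fin d)) (M : Op (Fin d × Fin d)) :
    (failurePad d * (swapOp d - (1 / (d : ℂ)) • 1) * (failurePad d)ᴴ * pairCall E M).trace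
      = ((swapOp d - (1 / (d : ℂ)) • 1) * amplify (Fin d) E
        (swapRecover d (amplify (Fin d) (withFailure E) M))).trace := by
  rw [← failurePad_compress, pairCall, LinearMap.comp_apply, LinearMap.comp_apply,
    Matrix.mul_assoc, Matrix.mul_assoc, Matrix.trace_mul_comm, Matrix.mul_assoc]

-- After a failed first call the maximally mixed state takes its place, and `swapOp d - 1 / d` has
-- trace zero against `A ⊗ 1`. So failures of the first call drop out; those of the second have
-- value zero.
open scoped Kronecker in
theorem trace_pairCall_kronecker {d : ℕ} [d.AtLeastTwo] (E : Op (Fin d) →ₗ[ℂ] Op (Fin d))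
    (X Y : Op (Fin d)) :
    (failurePad d * (swapOp d - (1 / (d : ℂ)) • 1) * (failurePad d)ᴴ
      * pairCall E (X ⊗ₖ Y)).trace = centeredForm E Y X := by
  have hd := natCast_ne_zero_of_two (d := d)
  rw [trace_pairCall, amplify_kronecker, swapRecover_kronecker, amplify_kronecker, sub_mul,
    Matrix.trace_sub, trace_swapOp_kronecker, Matrix.smul_mul, Matrix.one_mul, Matrix.trace_smul,
    Matrix.trace_kronecker, centeredForm_apply, mul_add, Matrix.trace_add, Matrix.trace_add,
    Matrix.mul_smul, Matrix.mul_one, Matrix.trace_smul, Matrix.trace_smul, Matrix.trace_one,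
    Fintype.card_fin]
  simp only [smul_eq_mul]
  field_simp
  ring

/-- The expected value of the swap test after two calls. -/
def swapMean {d : ℕ} (E : Op (Fin d) →ₗ[ℂ] Op (Fin d)) : Op (Fin d × Fin d) →ₗ[ℂ] ℂ :=
  Matrix.traceLinearMap _ ℂ ℂ ∘ₗ LinearMap.mulLeft ℂ
    (failurePad d * (swapOp d - (1 / (d : ℂ)) • 1) * (failurePad d)ᴴ) ∘ₗ pairCall E

theorem swapMean_apply {d : ℕ} (E : Op (Fin d) →ₗ[ℂ] Op (Fin d)) (M : Op (Fin d × Fin d)) :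
    swapMean E M = (failurePad d * (swapOp d - (1 / (d : ℂ)) • 1) * (failurePad d)ᴴ
      * pairCall E M).trace := rfl

-- The swap operator yields `swapSum` of the centered form and the identity yields its value at `(1,
-- 1)`, the combination of `altUnitarity_eq`. The prefactor `2 / (d² - 1)` explains the factor two.
open scoped Kronecker in
theorem swapMean_sub {d : ℕ} [d.AtLeastTwo] {E : Op (Fin d) →ₗ[ℂ] Op (Fin d)}
    (hE : IsHermPres E) :
    (swapMean E (swapState d 0)).re - (swapMean E (swapState d 1)).re = 2 * altUnitarity E := by
  rw [← Complex.sub_re, ← map_sub, swapState_sub, map_smul, map_sub, map_smul, swapOp_eq_sum,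
    ← Matrix.one_kronecker_one, altUnitarity_eq hE]
  simp only [map_sum, swapMean_apply, trace_pairCall_kronecker, swapSum, smul_eq_mul]
  rw [Finset.sum_comm, ← Complex.re_ofReal_mul]
  congr 1
  push_cast
  ring

/-! ### Sums of independent rounds -/

theorem trace_mul_eq_re {n : Type} [Fintype n] {A B : Op n} (hA : A.PosSemidef)
    (hB : B.PosSemidef) : (A * B).trace = ((A * B).trace.re : ℂ) := by
  obtain ⟨L, rfl⟩ := exists_factor_of_posSemidef hA
  rw [mul_assoc, Matrix.trace_mul_comm]
  have h := (hB.mul_mul_conjTranspose_same L).trace_nonneg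
  exact Complex.ext rfl (Complex.le_def.mp h).2.symm

theorem isCP_sum {m n ι : Type} [Fintype m] [Fintype ι] {Φ : ι → Op m →ₗ[ℂ] Op n}
    (h : ∀ i, IsCP (Φ i)) : IsCP (∑ i, Φ i) := by
  choose r K hK using h
  refine isCP_of_fintype (ι := Σ i, Fin (r i)) (fun x => K x.1 x.2) fun X => ?_
  rw [LinearMap.sum_apply, Fintype.sum_sigma]
  exact Finset.sum_congr rfl fun i _ => hK i X

theorem isCP_zero {m n : Type} [Fintype m] : IsCP (0 : Op m →ₗ[ℂ] Op n) :=
  ⟨0, fun i => i.elim0, fun X => by simp⟩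

/-- The measurement of an effect `M`, followed by the preparation of `ρ`. -/
def measurePrepare {m n : Type} [Fintype m] (M : Op m) (ρ : Op n) : Op m →ₗ[ℂ] Op n :=
  (Matrix.traceLinearMap m ℂ ℂ ∘ₗ LinearMap.mulLeft ℂ M).smulRight ρ

theorem measurePrepare_apply {m n : Type} [Fintype m] (M X : Op m) (ρ : Op n) :
    measurePrepare M ρ X = (M * X).trace • ρ := rfl

theorem isCP_measurePrepare {m n : Type} [Fintype m] [Fintype n] {M : Op m} {ρ : Op n}
    (hM : M.PosSemidef) (hρ : ρ.PosSemidef) : IsCP (measurePrepare M ρ) := by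
  obtain ⟨L, rfl⟩ := exists_factor_of_posSemidef hM
  obtain ⟨R, rfl⟩ := exists_factor_of_posSemidef hρ
  refine isCP_of_fintype (ι := m × n) (fun x => Matrix.vecMulVec (fun i => star (R x.2 i)) (L x.1))
    fun X => ?_
  ext i j
  have h1 : ∀ x : m × n, (Matrix.vecMulVec (fun i => star (R x.2 i)) (L x.1) * X
      * (Matrix.vecMulVec (fun i => star (R x.2 i)) (L x.1))ᴴ) i j
      = (L * X * Lᴴ) x.1 x.1 * (star (R x.2 i) * R x.2 j) := by
    intro x
    simp only [Matrix.mul_apply, Matrix.vecMulVec_apply, Matrix.conjTranspose_apply,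
      Finset.sum_mul, star_mul', star_star]
    exact Finset.sum_congr rfl fun a _ => Finset.sum_congr rfl fun b _ => by ring
  rw [Matrix.sum_apply, measurePrepare_apply, mul_assoc, Matrix.trace_mul_comm, Matrix.smul_apply,
    Finset.sum_congr rfl fun x _ => h1 x, Fintype.sum_prod_type, smul_eq_mul, Matrix.trace,
    Finset.sum_mul, Matrix.mul_apply]
  simp only [← Finset.mul_sum, Matrix.conjTranspose_apply, Matrix.diag_apply]

/-- A weight with total mass one under which `g` has mean `m` and variance at most `V`. -/
structure MeanVariance {K : Type} [Fintype K] (w g : K → ℝ) (m V : ℝ) : Prop where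
  nonneg : ∀ k, 0 ≤ w k
  total : ∑ k, w k = 1
  mean : ∑ k, w k * (g k - m) = 0
  variance : ∑ k, w k * (g k - m) ^ 2 ≤ V

theorem meanVariance_of_sq_le {O : Type} [Fintype O] {q x : O → ℝ} {V : ℝ} (h0 : ∀ o, 0 ≤ q o)
    (h1 : ∑ o, q o = 1) (hx : ∀ o, x o ^ 2 ≤ V) : MeanVariance q x (∑ o, q o * x o) V := by
  set μ := ∑ o, q o * x o with hμ
  refine ⟨h0, h1, ?_, ?_⟩
  · simp only [mul_sub, Finset.sum_sub_distrib, ← Finset.sum_mul, h1, one_mul, ← hμ, sub_self]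
  · have h2 : ∑ o, q o * (x o - μ) ^ 2 = ∑ o, q o * x o ^ 2 - μ ^ 2 := by
      have : ∀ o, q o * (x o - μ) ^ 2 = q o * x o ^ 2 - 2 * μ * (q o * x o) + μ ^ 2 * q o :=
        fun o => by ring
      simp only [this, Finset.sum_add_distrib, Finset.sum_sub_distrib, ← Finset.mul_sum, h1, ← hμ]
      ring
    rw [h2]
    have h3 : ∑ o, q o * x o ^ 2 ≤ ∑ o, q o * V :=
      Finset.sum_le_sum fun o _ => mul_le_mul_of_nonneg_left (hx o) (h0 o)
    rw [← Finset.sum_mul, h1, one_mul] at h3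
    nlinarith [sq_nonneg μ]

theorem MeanVariance.prod {K O : Type} [Fintype K] [Fintype O] {w g : K → ℝ} {q x : O → ℝ}
    {m μ V W : ℝ} (hw : MeanVariance w g m V) (hq : MeanVariance q x μ W) :
    MeanVariance (fun p : K × O => w p.1 * q p.2) (fun p => g p.1 + x p.2) (m + μ) (V + W) := by
  have key : ∀ (a : K → ℝ) (b : O → ℝ), ∑ p : K × O, a p.1 * b p.2 = (∑ k, a k) * ∑ o, b o :=
    fun a b => by rw [Fintype.sum_prod_type, Finset.sum_mul_sum]
  refine ⟨fun p => mul_nonneg (hw.nonneg _) (hq.nonneg _), ?_, ?_, ?_⟩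
  · rw [key, hw.total, hq.total, one_mul]
  · have : ∀ p : K × O, w p.1 * q p.2 * (g p.1 + x p.2 - (m + μ))
        = (w p.1 * (g p.1 - m)) * q p.2 + w p.1 * (q p.2 * (x p.2 - μ)) := fun p => by ring
    simp only [this, Finset.sum_add_distrib]
    rw [key (fun k => w k * (g k - m)) q, key w fun o => q o * (x o - μ), hw.mean, hq.mean]
    ring
  · have : ∀ p : K × O, w p.1 * q p.2 * (g p.1 + x p.2 - (m + μ)) ^ 2
        = (w p.1 * (g p.1 - m) ^ 2) * q p.2 + 2 * ((w p.1 * (g p.1 - m)) * (q p.2 * (x p.2 - μ)))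
          + w p.1 * (q p.2 * (x p.2 - μ) ^ 2) := fun p => by ring
    simp only [this, Finset.sum_add_distrib, ← Finset.mul_sum]
    rw [key (fun k => w k * (g k - m) ^ 2) q, key w fun o => q o * (x o - μ) ^ 2,
      key (fun k => w k * (g k - m)) fun o => q o * (x o - μ), hw.mean, hw.total, hq.total]
    have h1 := hw.variance
    have h2 := hq.variance
    linarith

theorem MeanVariance.sum_sub_sq_le {K : Type} [Fintype K] {w g : K → ℝ} {m V : ℝ}
    (hw : MeanVariance w g m V) (M : ℝ) : ∑ k, w k * (g k - M) ^ 2 ≤ V + (m - M) ^ 2 := by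
  have h : ∀ k, w k * (g k - M) ^ 2
      = w k * (g k - m) ^ 2 + 2 * (m - M) * (w k * (g k - m)) + (m - M) ^ 2 * w k :=
    fun k => by ring
  simp only [h, Finset.sum_add_distrib, ← Finset.mul_sum, hw.mean, hw.total]
  linarith [hw.variance]

/-- The centre `M` may differ from the mean `m`: for the incoherent estimator the mean given the
random unitaries still fluctuates about the target. -/
theorem MeanVariance.chebyshev {K : Type} [Fintype K] {w g : K → ℝ} {m V : ℝ}
    (hw : MeanVariance w g m V) {c ε μ M : ℝ} (hε : 0 < ε) (hμ : μ = c * M) :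
    1 - c ^ 2 * (V + (m - M) ^ 2) / ε ^ 2 ≤ ∑ k, if |c * g k - μ| ≤ ε then w k else 0 := by
  subst hμ
  have h1 : ∀ k, w k - c ^ 2 / ε ^ 2 * (w k * (g k - M) ^ 2)
      ≤ if |c * g k - c * M| ≤ ε then w k else 0 := by
    intro k
    have h0 := hw.nonneg k
    split_ifs with h
    · have : 0 ≤ c ^ 2 / ε ^ 2 * (w k * (g k - M) ^ 2) := by positivity
      linarith
    · have h2 : ε ^ 2 ≤ c ^ 2 * (g k - M) ^ 2 := by
        rw [← mul_pow, ← sq_abs (c * (g k - M)), mul_sub]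
        exact pow_le_pow_left₀ hε.le (not_le.mp h).le 2
      have h3 : w k * 1 ≤ w k * (c ^ 2 * (g k - M) ^ 2 / ε ^ 2) := by
        refine mul_le_mul_of_nonneg_left ?_ h0
        rwa [one_le_div (by positivity)]
      have h4 : w k * (c ^ 2 * (g k - M) ^ 2 / ε ^ 2)
          = c ^ 2 / ε ^ 2 * (w k * (g k - M) ^ 2) := by ring
      linarith
  have h2 := Finset.sum_le_sum fun k (_ : k ∈ Finset.univ) => h1 k
  rw [Finset.sum_sub_distrib, ← Finset.mul_sum, hw.total] at h2
  have h3 := mul_le_mul_of_nonneg_left (hw.sum_sub_sq_le M) (by positivity : 0 ≤ c ^ 2 / ε ^ 2)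
  have h4 : c ^ 2 / ε ^ 2 * (V + (m - M) ^ 2) = c ^ 2 * (V + (m - M) ^ 2) / ε ^ 2 := by ring
  linarith

/-! ### An algorithm with coherent access -/

/-- Record the outcome `o` of round `r`. -/
def record {N : ℕ} {O : Type} (r : ℕ) (k : Fin N → O) (o : O) : Fin N → O :=
  fun s => if s.val = r then o else k s

/-- The contribution of outcome `o` of round `s`; there is no measurement before round `1`. -/
def roundValue (d : ℕ) : ℕ → Fin 3 → ℝ
  | 0, _ => 0
  | s + 1, o => (-1) ^ s * swapValue d o

theorem roundValue_sq_le (d : ℕ) [d.AtLeastTwo] (s : ℕ) (o : Fin 3) :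
    roundValue d s o ^ 2 ≤ 9 / 4 := by
  cases s with
  | zero => norm_num [roundValue]
  | succ s =>
    rw [roundValue, mul_pow, ← pow_mul, mul_comm s, pow_mul]
    norm_num
    have := swapValue_sq_le d o
    norm_num at this
    exact this

/-- The sum of the contributions of the rounds before round `r`. -/
def partialValue (d : ℕ) {N : ℕ} (r : ℕ) (k : Fin N → Fin 3) : ℝ :=
  ∑ s : Fin N, if s.val < r then roundValue d s (k s) else 0

theorem partialValue_record (d : ℕ) {N r : ℕ} (hr : r < N) (k : Fin N → Fin 3) (o : Fin 3) :
    partialValue d (r + 1) (record r k o) = partialValue d r k + roundValue d r o := by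
  unfold partialValue record
  rw [← Finset.sum_erase_add _ _ (Finset.mem_univ (⟨r, hr⟩ : Fin N)),
    ← Finset.sum_erase_add (a := (⟨r, hr⟩ : Fin N)) _
      (fun s : Fin N => if s.val < r then roundValue d s (k s) else 0) (Finset.mem_univ _)]
  simp only [lt_self_iff_false, if_false, add_zero, Nat.lt_succ_self, if_true]
  congr 1
  refine Finset.sum_congr rfl fun s hs => ?_
  have hne : s.val ≠ r := fun h => (Finset.mem_erase.mp hs).1 (Fin.ext h)
  rw [if_neg hne]
  refine if_congr ⟨fun h => ?_, fun h => ?_⟩ rfl rfl <;> omega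

/-- Even steps measure and prepare, odd steps exchange system and ancilla. -/
def estimatorStep (d N : ℕ) (t : ℕ) (k k' : Fin N → Fin 3) :
    Op (Option (Fin d) × Fin d) →ₗ[ℂ] Op (Fin d × Fin d) :=
  if Even t then
    ∑ o, if k' = record (t / 2) k o then measurePrepare (swapTest d o) (swapState d (t / 2)) else 0
  else if k' = k then swapRecover d else 0

theorem isCP_estimatorStep (d N t : ℕ) (k k' : Fin N → Fin 3) :
    IsCP (estimatorStep d N t k k') := by
  unfold estimatorStep
  split_ifs
  · refine isCP_sum fun o => ?_
    split_ifs
    · exact isCP_measurePrepare (swapTest_posSemidef d o) (swapState_posSemidef d _)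
    · exact isCP_zero
  · exact isCP_swapRecover d
  · exact isCP_zero

theorem sum_trace_estimatorStep (d N t : ℕ) [d.AtLeastTwo] (k : Fin N → Fin 3)
    (X : Op (Option (Fin d) × Fin d)) : ∑ k', (estimatorStep d N t k k' X).trace = X.trace := by
  unfold estimatorStep
  split_ifs
  · simp only [LinearMap.sum_apply, Matrix.trace_sum]
    rw [Finset.sum_comm]
    have h : ∀ o, ∑ k', ((if k' = record (t / 2) k o then
        measurePrepare (swapTest d o) (swapState d (t / 2)) else 0) X).trace
        = (swapTest d o * X).trace := by
      intro o
      rw [Finset.sum_eq_single (record (t / 2) k o)]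
      · rw [if_pos rfl, measurePrepare_apply, Matrix.trace_smul, swapState_trace, smul_eq_mul,
          mul_one]
      · intro k' _ hk
        rw [if_neg hk]
        simp
      · simp
    simp only [h]
    rw [← Matrix.trace_sum, ← Finset.sum_mul, swapTest_sum, one_mul]
  · rw [Finset.sum_eq_single k]
    · rw [if_pos rfl, swapRecover_trace]
    · intro k' _ hk
      rw [if_neg hk]
      simp
    · simp

/-- A fixed initial state. -/
def failureState (d : ℕ) [NeZero d] : Op (Option (Fin d) × Fin d) :=
  Matrix.diagonal (Pi.single (none, 0) 1)

theorem failureState_posSemidef (d : ℕ) [NeZero d] : (failureState d).PosSemidef := by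
  refine Matrix.PosSemidef.diagonal fun x => ?_
  by_cases h : x = (none, 0)
  · subst h
    simp
  · simp [h]

theorem failureState_trace (d : ℕ) [NeZero d] : (failureState d).trace = 1 := by
  simp [failureState, Matrix.trace_diagonal]

/-- The estimator that applies the swap test to the joint output of two calls on normalized
projections onto the symmetric and the antisymmetric subspace. -/
def coherentEstimator (d N : ℕ) [d.AtLeastTwo] : CoherentAlgorithm d where
  calls := 2 * N
  anc := d
  Mem := Fin N → Fin 3
  Out := Fin 3
  Seed := Unit
  law := Measure.dirac ()
  init _ k := if k = 0 then failureState d else 0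
  init_pos _ k := by
    split_ifs
    · exact failureState_posSemidef d
    · exact Matrix.PosSemidef.zero
  init_trace _ := by
    rw [Finset.sum_eq_single 0]
    · rw [if_pos rfl, failureState_trace]
    · intro k _ hk
      rw [if_neg hk, Matrix.trace_zero]
    · simp
  init_meas _ _ _ := measurable_const
  step _ := estimatorStep d N
  step_cp _ := isCP_estimatorStep d N
  step_trace _ t := sum_trace_estimatorStep d N t
  step_meas _ _ _ _ _ _ := measurable_const
  povm _ _ := swapTest d
  povm_pos _ _ := swapTest_posSemidef d
  povm_sum _ _ := swapTest_sum d
  povm_meas _ _ _ _ := measurable_const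
  -- Rounds `0, …, N - 1` are recorded in the memory and the final POVM is round `N`. Round `0`
  -- measures the arbitrary initial state and has value zero, so `N` rounds of two calls remain.
  value _ k v := (1 / N : ℝ) * (partialValue d N k + roundValue d N v)
  value_meas _ _ := measurable_const

/-- The normalized state measured in round `r`. -/
def roundState {d : ℕ} [NeZero d] (E : Op (Fin d) →ₗ[ℂ] Op (Fin d)) :
    ℕ → Op (Option (Fin d) × Fin d)
  | 0 => failureState d
  | r + 1 => pairCall E (swapState d r)

theorem roundState_posSemidef {d : ℕ} [NeZero d] {E : Op (Fin d) →ₗ[ℂ] Op (Fin d)}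
    (hE : IsChannel E) (r : ℕ) : (roundState E r).PosSemidef := by
  cases r with
  | zero => exact failureState_posSemidef d
  | succ r =>
    exact amplify_posSemidef (isCP_withFailure hE) (isCP_posSemidef (isCP_swapRecover d)
      (amplify_posSemidef (isCP_withFailure hE) (swapState_posSemidef d r)))

theorem roundState_trace {d : ℕ} [d.AtLeastTwo] (E : Op (Fin d) →ₗ[ℂ] Op (Fin d)) (r : ℕ) :
    (roundState E r).trace = 1 := by
  cases r with
  | zero => exact failureState_trace d
  | succ r =>
    rw [roundState, pairCall, LinearMap.comp_apply, LinearMap.comp_apply,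
      amplify_trace (withFailure_trace E), swapRecover_trace, amplify_trace (withFailure_trace E),
      swapState_trace]

/-- The probability of outcome `o` in round `r`. -/
def testProb {d : ℕ} [NeZero d] (E : Op (Fin d) →ₗ[ℂ] Op (Fin d)) (r : ℕ) (o : Fin 3) : ℝ :=
  (swapTest d o * roundState E r).trace.re

theorem meanVariance_testProb {d : ℕ} [d.AtLeastTwo] {E : Op (Fin d) →ₗ[ℂ] Op (Fin d)}
    (hE : IsChannel E) (r : ℕ) : MeanVariance (testProb E r) (roundValue d r)
      (∑ o, testProb E r o * roundValue d r o) (9 / 4) := by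
  refine meanVariance_of_sq_le (fun o => trace_mul_re_nonneg (swapTest_posSemidef d o)
    (roundState_posSemidef hE r)) ?_ (roundValue_sq_le d r)
  simp only [testProb, ← Complex.re_sum, ← Matrix.trace_sum, ← Finset.sum_mul]
  rw [swapTest_sum, one_mul, roundState_trace, Complex.one_re]

theorem testProb_mean_succ {d : ℕ} [NeZero d] (E : Op (Fin d) →ₗ[ℂ] Op (Fin d)) (r : ℕ) :
    ∑ o, testProb E (r + 1) o * roundValue d (r + 1) o
      = (-1) ^ r * (swapMean E (swapState d r)).re := by
  rw [swapMean_apply, ← sum_swapValue_smul_swapTest, Finset.sum_mul, Matrix.trace_sum,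
    Complex.re_sum, Finset.mul_sum]
  refine Finset.sum_congr rfl fun o _ => ?_
  rw [Matrix.smul_mul, Matrix.trace_smul, smul_eq_mul, Complex.re_ofReal_mul]
  simp only [testProb, roundValue, roundState]
  ring

/-- Round `0` contributes nothing. Of the other `2 * m` rounds, every pair of a symmetric and an
antisymmetric input, with opposite signs, contributes twice the alternative unitarity. -/
theorem sum_testProb_mean {d : ℕ} [d.AtLeastTwo] {E : Op (Fin d) →ₗ[ℂ] Op (Fin d)}
    (hE : IsHermPres E) (m : ℕ) : ∑ r ∈ Finset.range (2 * m + 1),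
      ∑ o, testProb E r o * roundValue d r o = 2 * m * altUnitarity E := by
  induction m with
  | zero => simp [roundValue]
  | succ m ih =>
    rw [show 2 * (m + 1) + 1 = 2 * m + 1 + 1 + 1 by ring, Finset.sum_range_succ,
      Finset.sum_range_succ, ih, testProb_mean_succ, testProb_mean_succ,
      (swapState_even_odd d m).1, (swapState_even_odd d m).2, pow_succ, pow_mul, neg_one_sq,
      one_pow]
    have := swapMean_sub hE
    push_cast
    linarith

/-- The distribution of the memory after `r` rounds. -/
def memoryWeight {d : ℕ} [NeZero d] (E : Op (Fin d) →ₗ[ℂ] Op (Fin d)) (N : ℕ) :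
    ℕ → (Fin N → Fin 3) → ℝ
  | 0, k => if k = 0 then 1 else 0
  | r + 1, k' => ∑ k, ∑ o, if k' = record r k o then memoryWeight E N r k * testProb E r o else 0

/-- The states of the estimator. -/
def estimatorState {d : ℕ} [d.AtLeastTwo] (E : Op (Fin d) →ₗ[ℂ] Op (Fin d)) (N t : ℕ) :
    (Fin N → Fin 3) → Op (Option (Fin d) × Fin d) :=
  (coherentEstimator d N).state E () t

theorem estimatorState_zero {d : ℕ} [d.AtLeastTwo] (E : Op (Fin d) →ₗ[ℂ] Op (Fin d)) (N : ℕ)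
    (k : Fin N → Fin 3) : estimatorState E N 0 k = if k = 0 then failureState d else 0 := rfl

theorem estimatorState_succ {d : ℕ} [d.AtLeastTwo] (E : Op (Fin d) →ₗ[ℂ] Op (Fin d)) (N t : ℕ)
    (k' : Fin N → Fin 3) : estimatorState E N (t + 1) k' = amplify (Fin d) (withFailure E)
      (∑ k, estimatorStep d N t k k' (estimatorState E N t k)) := rfl

/-- Measuring and preparing afresh destroys all correlations: after each pair of calls the state is
the classical distribution of the memory times a fixed state, and the rounds are independent. -/
theorem estimatorState_eq {d : ℕ} [d.AtLeastTwo] {E : Op (Fin d) →ₗ[ℂ] Op (Fin d)}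
    (hE : IsChannel E) (N r : ℕ) (k : Fin N → Fin 3) :
    estimatorState E N (2 * r) k
      = (memoryWeight E N r k : ℂ) • roundState E r := by
  induction r generalizing k with
  | zero =>
    simp only [Nat.mul_zero, estimatorState_zero, memoryWeight, roundState]
    split_ifs <;> simp
  | succ r ih =>
    have h1 : ∀ k', estimatorState E N (2 * r + 1) k'
        = amplify (Fin d) (withFailure E)
          ((memoryWeight E N (r + 1) k' : ℂ) • swapState d r) := by
      intro k'
      rw [estimatorState_succ]
      congr 1
      simp only [memoryWeight, Complex.ofReal_sum, Finset.sum_smul]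
      refine Finset.sum_congr rfl fun k _ => ?_
      rw [ih, estimatorStep, if_pos (even_two_mul r), Nat.mul_div_cancel_left r two_pos,
        LinearMap.sum_apply]
      refine Finset.sum_congr rfl fun o _ => ?_
      split_ifs
      · rw [measurePrepare_apply, Matrix.mul_smul, Matrix.trace_smul,
          trace_mul_eq_re (swapTest_posSemidef d o) (roundState_posSemidef hE r), testProb]
        push_cast
        rfl
      · simp
    rw [show 2 * (r + 1) = 2 * r + 1 + 1 by ring, estimatorState_succ, Finset.sum_eq_single k]
    · rw [h1, estimatorStep, if_neg (by simp), if_pos rfl, map_smul, map_smul, map_smul]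
      rfl
    · intro k' _ hk
      rw [estimatorStep, if_neg (by simp), if_neg hk.symm]
      rfl
    · simp

theorem coherentEstimator_prob {d : ℕ} [d.AtLeastTwo] {E : Op (Fin d) →ₗ[ℂ] Op (Fin d)}
    (hE : IsChannel E) (N : ℕ) (k : Fin N → Fin 3) (v : Fin 3) :
    (coherentEstimator d N).prob E () k v = memoryWeight E N N k * testProb E N v := by
  change (swapTest d v * estimatorState E N (2 * N) k).trace.re = _
  rw [estimatorState_eq hE, Matrix.mul_smul, Matrix.trace_smul, smul_eq_mul, Complex.re_ofReal_mul]
  rfl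

theorem meanVariance_memoryWeight {d : ℕ} [d.AtLeastTwo] {E : Op (Fin d) →ₗ[ℂ] Op (Fin d)}
    (hE : IsChannel E) (N r : ℕ) (hr : r ≤ N) : MeanVariance (memoryWeight E N r)
      (partialValue d r) (∑ s ∈ Finset.range r, ∑ o, testProb E s o * roundValue d s o)
      (r * (9 / 4)) := by
  induction r with
  | zero =>
    refine ⟨fun k => ?_, ?_, ?_, ?_⟩
    · simp only [memoryWeight]
      split_ifs <;> norm_num
    all_goals simp [memoryWeight, partialValue]
  | succ r ih =>
    have h := (ih (by omega)).prod (meanVariance_testProb hE r)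
    -- The distribution of the memory after round `r` is the image, under `record`, of a product
    -- distribution.
    have key : ∀ F : (Fin N → Fin 3) → ℝ, ∑ k', memoryWeight E N (r + 1) k' * F k'
        = ∑ p : (Fin N → Fin 3) × Fin 3, memoryWeight E N r p.1 * testProb E r p.2
          * F (record r p.1 p.2) := by
      intro F
      simp only [memoryWeight, Finset.sum_mul, Fintype.sum_prod_type]
      rw [Finset.sum_comm]
      refine Finset.sum_congr rfl fun k _ => ?_
      rw [Finset.sum_comm]
      refine Finset.sum_congr rfl fun o _ => ?_
      rw [Finset.sum_eq_single (record r k o)]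
      · rw [if_pos rfl]
      · intro k' _ hk
        rw [if_neg hk, zero_mul]
      · simp
    have hg := fun k o => partialValue_record d (show r < N by omega) k o
    refine ⟨fun k' => ?_, ?_, ?_, ?_⟩
    · simp only [memoryWeight]
      refine Finset.sum_nonneg fun k _ => Finset.sum_nonneg fun o _ => ?_
      split_ifs
      · exact h.nonneg (k, o)
      · exact le_rfl
    · have h1 := key fun _ => 1
      simp only [mul_one] at h1
      rw [h1, h.total]
    · rw [key, Finset.sum_range_succ]
      simp only [hg]
      exact h.mean
    · rw [key fun k' => (partialValue d (r + 1) k' - _) ^ 2, Finset.sum_range_succ]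
      simp only [hg]
      refine h.variance.trans (le_of_eq ?_)
      push_cast
      ring

theorem coherentEstimator_successProb {d : ℕ} [d.AtLeastTwo] {E : Op (Fin d) →ₗ[ℂ] Op (Fin d)}
    (hE : IsChannel E) {m : ℕ} (hm : 0 < m) {ε : ℝ} (hε : 0 < ε) (hmε : 8 ≤ m * ε ^ 2) :
    2 / 3 ≤ (coherentEstimator d (2 * m)).successProb E (altUnitarity E) ε := by
  have h := (meanVariance_memoryWeight hE (2 * m) (2 * m) le_rfl).prod
    (meanVariance_testProb hE (2 * m))
  rw [← Finset.sum_range_succ, sum_testProb_mean hE.isHermPres] at h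
  have hm0 : (0 : ℝ) < m := Nat.cast_pos.mpr hm
  have hm1 : (1 : ℝ) ≤ m := by exact_mod_cast hm
  have h1 := h.chebyshev (c := 1 / ((2 * m : ℕ) : ℝ)) (ε := ε) (μ := altUnitarity E)
    (M := 2 * m * altUnitarity E) hε (by
      push_cast
      field_simp)
  rw [sub_self, zero_pow two_ne_zero, add_zero] at h1
  have h2 : (coherentEstimator d (2 * m)).successProb E (altUnitarity E) ε
      = ∑ k : Fin (2 * m) → Fin 3, ∑ v : Fin 3,
        if |1 / ((2 * m : ℕ) : ℝ) * (partialValue d (2 * m) k + roundValue d (2 * m) v)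
          - altUnitarity E| ≤ ε then memoryWeight E (2 * m) (2 * m) k * testProb E (2 * m) v
        else 0 := by
    unfold CoherentAlgorithm.successProb
    refine (integral_dirac _ ()).trans ?_
    refine Finset.sum_congr rfl fun k _ => Finset.sum_congr rfl fun v _ => ?_
    exact if_congr Iff.rfl (coherentEstimator_prob hE (2 * m) k v) rfl
  rw [h2, ← Fintype.sum_prod_type (f := fun p : (Fin (2 * m) → Fin 3) × Fin 3 =>
    if |1 / ((2 * m : ℕ) : ℝ) * (partialValue d (2 * m) p.1 + roundValue d (2 * m) p.2)
          - altUnitarity E| ≤ ε then memoryWeight E (2 * m) (2 * m) p.1 * testProb E (2 * m) p.2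
        else 0)]
  refine le_trans ?_ h1
  -- The `2 * m + 1 ≤ 3 * m` rounds have variance at most `9 / 4` each, so the average has variance
  -- at most `27 / (16 * m)`, below `ε ^ 2 / 3`.
  have h3 : (1 / ((2 * m : ℕ) : ℝ)) ^ 2 * (((2 * m : ℕ) : ℝ) * (9 / 4) + 9 / 4) / ε ^ 2 ≤ 1 / 3 := by
    push_cast
    rw [div_le_iff₀ (by positivity), div_pow, one_pow, one_div_mul_eq_div,
      div_le_iff₀ (by positivity)]
    nlinarith [mul_le_mul_of_nonneg_left hmε hm0.le]
  linarith

theorem exists_coherentAlgorithm (d : ℕ) [d.AtLeastTwo] (ε : ℝ) (h0 : 0 < ε) (h1 : ε ≤ 1) :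
    ∃ A : CoherentAlgorithm d, (A.calls : ℝ) ≤ 36 * ε⁻¹ ^ 2 ∧ (A.anc : ℝ) ≤ 36 * d ∧
      A.Estimates altUnitarity ε := by
  have hinv : 1 ≤ ε⁻¹ ^ 2 := one_le_pow₀ ((one_le_inv₀ h0).mpr h1)
  -- There are `4 * m` calls, and `36 = 4 * (8 + 1)`; rounding up is absorbed because `ε ≤ 1`.
  set m := ⌈8 * ε⁻¹ ^ 2⌉₊ with hm
  have hm0 : 0 < m := Nat.ceil_pos.mpr (by positivity)
  have hm1 : 8 * ε⁻¹ ^ 2 ≤ m := Nat.le_ceil _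
  have hm2 : (m : ℝ) < 8 * ε⁻¹ ^ 2 + 1 := Nat.ceil_lt_add_one (by positivity)
  refine ⟨coherentEstimator d (2 * m), ?_, ?_, fun E hE => ?_⟩
  · change ((2 * (2 * m) : ℕ) : ℝ) ≤ _
    push_cast
    linarith
  · change (d : ℝ) ≤ _
    have : (0 : ℝ) ≤ d := Nat.cast_nonneg d
    linarith
  · refine coherentEstimator_successProb hE hm0 h0 ?_
    have h2 := mul_le_mul_of_nonneg_right hm1 (sq_nonneg ε)
    rwa [mul_assoc, ← mul_pow, inv_mul_cancel₀ h0.ne', one_pow, mul_one] at h2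

/-! ### Statistics of independent samples -/

theorem MeanVariance.comp_equiv {K K' : Type} [Fintype K] [Fintype K'] {w g : K → ℝ} {m V : ℝ}
    (hw : MeanVariance w g m V) (e : K' ≃ K) : MeanVariance (fun k => w (e k)) (fun k => g (e k))
      m V := by
  refine ⟨fun k => hw.nonneg _, ?_, ?_, ?_⟩
  · rw [e.sum_comp w, hw.total]
  · rw [e.sum_comp fun k => w k * (g k - m), hw.mean]
  · rw [e.sum_comp fun k => w k * (g k - m) ^ 2]
    exact hw.variance

theorem MeanVariance.congr {K : Type} [Fintype K] {w g w' g' : K → ℝ} {m V : ℝ}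
    (hw : MeanVariance w g m V) (h1 : ∀ k, w' k = w k) (h2 : ∀ k, g' k = g k) :
    MeanVariance w' g' m V := by
  rwa [funext h1, funext h2]

theorem MeanVariance.pi_fin {K : Type} [Fintype K] (n : ℕ) {w g : Fin n → K → ℝ}
    {m V : Fin n → ℝ} (h : ∀ i, MeanVariance (w i) (g i) (m i) (V i)) :
    MeanVariance (fun k : Fin n → K => ∏ i, w i (k i)) (fun k => ∑ i, g i (k i)) (∑ i, m i)
      (∑ i, V i) := by
  induction n with
  | zero => exact ⟨by simp, by simp, by simp, by simp⟩
  | succ n ih =>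
    have h1 := (h 0).prod (ih fun i => h i.succ)
    rw [← Fin.sum_univ_succ, ← Fin.sum_univ_succ] at h1
    refine (h1.comp_equiv (Fin.consEquiv fun _ => K).symm).congr (fun k => ?_) fun k => ?_
    · rw [Fin.prod_univ_succ]
      rfl
    · rw [Fin.sum_univ_succ]
      rfl

theorem MeanVariance.pi {ι K : Type} [Fintype ι] [DecidableEq ι] [Fintype K] {w g : ι → K → ℝ}
    {m V : ι → ℝ} (h : ∀ i, MeanVariance (w i) (g i) (m i) (V i)) :
    MeanVariance (fun k : ι → K => ∏ i, w i (k i)) (fun k => ∑ i, g i (k i)) (∑ i, m i)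
      (∑ i, V i) := by
  let e := Fintype.equivFin ι
  have h1 := MeanVariance.pi_fin _ fun i => h (e.symm i)
  rw [e.symm.sum_comp m, e.symm.sum_comp V] at h1
  refine (h1.comp_equiv (e.arrowCongr (Equiv.refl K))).congr (fun k => ?_) fun k => ?_
  · rw [← e.symm.prod_comp]
    rfl
  · rw [← e.symm.sum_comp]
    rfl

theorem MeanVariance.const_mul {K : Type} [Fintype K] {w g : K → ℝ} {m V : ℝ}
    (hw : MeanVariance w g m V) (c : ℝ) :
    MeanVariance w (fun k => c * g k) (c * m) (c ^ 2 * V) := by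
  refine ⟨hw.nonneg, hw.total, ?_, ?_⟩
  · have : ∀ k, w k * (c * g k - c * m) = c * (w k * (g k - m)) := fun k => by ring
    simp only [this, ← Finset.mul_sum, hw.mean, mul_zero]
  · have : ∀ k, w k * (c * g k - c * m) ^ 2 = c ^ 2 * (w k * (g k - m) ^ 2) := fun k => by ring
    simp only [this, ← Finset.mul_sum]
    exact mul_le_mul_of_nonneg_left hw.variance (sq_nonneg c)

theorem MeanVariance.sum_mul_eq {K : Type} [Fintype K] {w g : K → ℝ} {m V : ℝ}
    (hw : MeanVariance w g m V) : ∑ k, w k * g k = m := by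
  have h := hw.mean
  simp only [mul_sub, Finset.sum_sub_distrib, ← Finset.sum_mul, hw.total, one_mul] at h
  linarith

theorem MeanVariance.sum_sq_le {K : Type} [Fintype K] {w g : K → ℝ} {m V : ℝ}
    (hw : MeanVariance w g m V) : ∑ k, w k * g k ^ 2 ≤ m ^ 2 + V := by
  have h := hw.sum_sub_sq_le 0
  simp only [sub_zero] at h
  linarith

theorem meanVariance_of_moments {K : Type} [Fintype K] {w g : K → ℝ} {V : ℝ} (h0 : ∀ k, 0 ≤ w k)
    (h1 : ∑ k, w k = 1) (h2 : ∑ k, w k * g k ^ 2 ≤ V) :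
    MeanVariance w g (∑ k, w k * g k) V := by
  set μ := ∑ k, w k * g k with hμ
  refine ⟨h0, h1, ?_, ?_⟩
  · simp only [mul_sub, Finset.sum_sub_distrib, ← Finset.sum_mul, h1, one_mul, ← hμ, sub_self]
  · have : ∀ k, w k * (g k - μ) ^ 2 = w k * g k ^ 2 - 2 * μ * (w k * g k) + μ ^ 2 * w k :=
      fun k => by ring
    simp only [this, Finset.sum_add_distrib, Finset.sum_sub_distrib, ← Finset.mul_sum, h1, ← hμ]
    nlinarith [sq_nonneg μ]

/-- The difference of the averages of `w` over two samples, where `none` counts zero. -/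
def sampleDiff {d m : ℕ} (w : Fin d → ℝ) (k : Fin m × Fin 2 → Option (Fin d)) : ℝ :=
  (1 / m : ℝ) * ∑ x, (-1) ^ x.2.val * (k x).elim 0 w

/-- The distribution of two independent samples of size `m`. -/
def sampleWeight {d m : ℕ} (P : Fin 2 → Option (Fin d) → ℝ)
    (k : Fin m × Fin 2 → Option (Fin d)) : ℝ := ∏ x, P x.2 (k x)

theorem meanVariance_sampleDiff {d m : ℕ} (hm : 0 < m) {P : Fin 2 → Option (Fin d) → ℝ}
    (h0 : ∀ c o, 0 ≤ P c o) (h1 : ∀ c, ∑ o, P c o = 1) (w : Fin d → ℝ) :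
    MeanVariance (sampleWeight (m := m) P) (sampleDiff w)
      (∑ b, w b * (P 0 (some b) - P 1 (some b)))
      (1 / m * ∑ b, w b ^ 2 * (P 0 (some b) + P 1 (some b))) := by
  have hm' : (m : ℝ) ≠ 0 := Nat.cast_ne_zero.mpr hm.ne'
  have h2 := (MeanVariance.pi fun x : Fin m × Fin 2 => meanVariance_of_moments (h0 x.2) (h1 x.2)
    (g := fun o => (-1) ^ x.2.val * o.elim 0 w) le_rfl).const_mul (1 / m)
  have hA : ∑ b, w b * (P 0 (some b) - P 1 (some b))
      = 1 / m * ∑ x : Fin m × Fin 2, ∑ o, P x.2 o * ((-1) ^ x.2.val * o.elim 0 w) := by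
    simp only [Fintype.sum_prod_type, Fin.sum_univ_two, Fintype.sum_option, Option.elim_none,
      Option.elim_some, Finset.sum_const, Finset.card_univ, Fintype.card_fin, nsmul_eq_mul]
    rw [← mul_assoc, one_div_mul_cancel hm', one_mul]
    simp only [mul_zero, zero_add, Fin.val_zero, Fin.val_one, pow_zero, pow_one, one_mul]
    rw [← Finset.sum_add_distrib]
    exact Finset.sum_congr rfl fun b _ => by ring
  have hB : 1 / m * ∑ b, w b ^ 2 * (P 0 (some b) + P 1 (some b)) = (1 / m) ^ 2
      * ∑ x : Fin m × Fin 2, ∑ o, P x.2 o * ((-1) ^ x.2.val * o.elim 0 w) ^ 2 := by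
    simp only [Fintype.sum_prod_type, Fin.sum_univ_two, Fintype.sum_option, Option.elim_none,
      Option.elim_some, Finset.sum_const, Finset.card_univ, Fintype.card_fin, nsmul_eq_mul]
    have : (1 / (m : ℝ)) ^ 2 * m = 1 / m := by field_simp
    rw [← mul_assoc, this]
    congr 1
    simp only [mul_zero, zero_add, Fin.val_zero, Fin.val_one, pow_zero, pow_one, one_mul, ne_eq,
      OfNat.ofNat_ne_zero, not_false_eq_true, zero_pow]
    rw [← Finset.sum_add_distrib]
    exact Finset.sum_congr rfl fun b _ => by ring
  rw [hA, hB]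
  exact h2

theorem sampleDiff_eq_sum {d m : ℕ} (w : Fin d → ℝ) (k : Fin m × Fin 2 → Option (Fin d)) :
    sampleDiff w k = ∑ b, w b * sampleDiff (Pi.single b 1) k := by
  simp only [sampleDiff, Finset.mul_sum]
  rw [Finset.sum_comm]
  refine Finset.sum_congr rfl fun x _ => ?_
  cases k x with
  | none => simp
  | some o =>
    simp only [Option.elim_some]
    rw [Finset.sum_eq_single o]
    · rw [Pi.single_eq_same]
      ring
    · intro b _ hb
      rw [Pi.single_eq_of_ne hb.symm]
      ring
    · simp

/-- The bilinear statistic of two pairs of samples. -/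
def pairStatistic {d m : ℕ} (K : Fin d → Fin d → ℝ)
    (k : (Fin m × Fin 2 → Option (Fin d)) × (Fin m × Fin 2 → Option (Fin d))) : ℝ :=
  sampleDiff (fun b => sampleDiff (K b) k.2) k.1

/-- A bound for the second moment of `pairStatistic`. -/
def pairVariance {d : ℕ} (m : ℕ) (K : Fin d → Fin d → ℝ) (δ r : Fin d → ℝ) : ℝ :=
  (∑ b, ∑ c, K b c * δ b * δ c) ^ 2 + 1 / m * ∑ c, (∑ b, K b c * δ b) ^ 2 * r c
    + 1 / m * ∑ b, ((∑ c, K b c * δ c) ^ 2 + 1 / m * ∑ c, K b c ^ 2 * r c) * r b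

/-- The two pairs of samples are independent, so the mean is the quadratic form of `K` at `δ`, with
no diagonal bias. Given the second pair, the statistic is a `sampleDiff` of the first, with weights
that are themselves `sampleDiff`s of the second; `meanVariance_sampleDiff` applies twice. -/
theorem meanVariance_pairStatistic {d m : ℕ} (hm : 0 < m) {P : Fin 2 → Option (Fin d) → ℝ}
    (h0 : ∀ c o, 0 ≤ P c o) (h1 : ∀ c, ∑ o, P c o = 1) (K : Fin d → Fin d → ℝ)
    {δ r : Fin d → ℝ} (hδ : ∀ b, δ b = P 0 (some b) - P 1 (some b))
    (hr : ∀ b, r b = P 0 (some b) + P 1 (some b)) :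
    MeanVariance (fun k : (Fin m × Fin 2 → Option (Fin d)) × (Fin m × Fin 2 → Option (Fin d)) =>
        sampleWeight P k.1 * sampleWeight P k.2) (pairStatistic K)
      (∑ b, ∑ c, K b c * δ b * δ c) (pairVariance m K δ r) := by
  have hs : ∀ w : Fin d → ℝ, MeanVariance (sampleWeight (m := m) P) (sampleDiff w)
      (∑ b, w b * δ b) (1 / m * ∑ b, w b ^ 2 * r b) := fun w => by
    simp only [hδ, hr]
    exact meanVariance_sampleDiff hm h0 h1 w
  have hlin : ∀ k : Fin m × Fin 2 → Option (Fin d), ∑ b, sampleDiff (K b) k * δ b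
      = sampleDiff (fun c => ∑ b, K b c * δ b) k := by
    intro k
    rw [sampleDiff_eq_sum fun c => ∑ b, K b c * δ b]
    simp only [Finset.sum_mul]
    rw [Finset.sum_comm]
    refine Finset.sum_congr rfl fun b _ => ?_
    rw [sampleDiff_eq_sum (K b), Finset.sum_mul]
    exact Finset.sum_congr rfl fun c _ => by ring
  have hmean : ∑ k : (Fin m × Fin 2 → Option (Fin d)) × (Fin m × Fin 2 → Option (Fin d)),
      sampleWeight P k.1 * sampleWeight P k.2 * pairStatistic K k
      = ∑ b, ∑ c, K b c * δ b * δ c := by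
    rw [Fintype.sum_prod_type_right]
    have : ∀ k' : Fin m × Fin 2 → Option (Fin d), ∑ k : Fin m × Fin 2 → Option (Fin d),
        sampleWeight P k * sampleWeight P k' * pairStatistic K (k, k')
        = sampleWeight P k' * sampleDiff (fun c => ∑ b, K b c * δ b) k' := by
      intro k'
      rw [← hlin, ← (hs fun b => sampleDiff (K b) k').sum_mul_eq, Finset.mul_sum]
      exact Finset.sum_congr rfl fun k _ => by rw [pairStatistic]; ring
    simp only [this]
    rw [(hs _).sum_mul_eq]
    simp only [Finset.sum_mul]
    exact Finset.sum_comm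
  rw [← hmean]
  have htot := (hs 0).total
  have hnon := (hs 0).nonneg
  refine meanVariance_of_moments (fun k => mul_nonneg (hnon _) (hnon _)) ?_ ?_
  · rw [Fintype.sum_prod_type, ← Finset.sum_mul_sum, htot, one_mul]
  · rw [Fintype.sum_prod_type_right]
    have hr0 : ∀ b, 0 ≤ r b := fun b => by
      rw [hr]
      exact add_nonneg (h0 _ _) (h0 _ _)
    have h2 : ∀ k' : Fin m × Fin 2 → Option (Fin d), ∑ k : Fin m × Fin 2 → Option (Fin d),
        sampleWeight P k * sampleWeight P k' * pairStatistic K (k, k') ^ 2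
        ≤ sampleWeight P k' * sampleDiff (fun c => ∑ b, K b c * δ b) k' ^ 2
          + 1 / m * ∑ b, sampleWeight P k' * sampleDiff (K b) k' ^ 2 * r b := by
      intro k'
      have h3 := mul_le_mul_of_nonneg_left (hs fun b => sampleDiff (K b) k').sum_sq_le (hnon k')
      rw [hlin, mul_add] at h3
      refine le_trans (le_of_eq ?_) (h3.trans (le_of_eq ?_))
      · rw [Finset.mul_sum]
        exact Finset.sum_congr rfl fun k _ => by rw [pairStatistic]; ring
      · congr 1
        rw [mul_left_comm, Finset.mul_sum (a := sampleWeight P k')]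
        congr 1
        exact Finset.sum_congr rfl fun b _ => by ring
    refine (Finset.sum_le_sum fun k' _ => h2 k').trans ?_
    rw [Finset.sum_add_distrib, ← Finset.mul_sum, Finset.sum_comm]
    simp only [← Finset.sum_mul]
    have h4 := (hs fun c => ∑ b, K b c * δ b).sum_sq_le
    have h5 : ∑ c, (∑ b, K b c * δ b) * δ c = ∑ b, ∑ c, K b c * δ b * δ c := by
      simp only [Finset.sum_mul]
      exact Finset.sum_comm
    rw [h5] at h4
    have h6 : ∑ b, (∑ k', sampleWeight P k' * sampleDiff (m := m) (K b) k' ^ 2) * r b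
        ≤ ∑ b, ((∑ c, K b c * δ c) ^ 2 + 1 / m * ∑ c, K b c ^ 2 * r c) * r b :=
      Finset.sum_le_sum fun b _ => mul_le_mul_of_nonneg_right (hs (K b)).sum_sq_le (hr0 b)
    have h7 := mul_le_mul_of_nonneg_left h6 (by positivity : (0 : ℝ) ≤ 1 / m)
    rw [pairVariance]
    exact add_le_add h4 h7

/-! ### The variance for the purity kernel with samples of size `√d`. -/

/-- The kernel of the unbiased estimator of the purity of the traceless part. -/
def purityKernel (d : ℕ) (b c : Fin d) : ℝ := (d + 1) / 2 * ((if b = c then 1 else 0) - 1 / d)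

theorem sum_purityKernel_mul {d : ℕ} (δ : Fin d → ℝ) (b : Fin d) :
    ∑ c, purityKernel d b c * δ c = (d + 1) / 2 * (δ b - (∑ c, δ c) / d) := by
  simp only [purityKernel, mul_assoc, sub_mul, ← Finset.mul_sum, Finset.sum_sub_distrib, ite_mul,
    one_mul, zero_mul, Finset.sum_ite_eq, Finset.mem_univ, if_true]
  ring

theorem purityKernel_symm {d : ℕ} (b c : Fin d) : purityKernel d b c = purityKernel d c b := by
  simp only [purityKernel, eq_comm]

theorem sum_sum_purityKernel {d : ℕ} (δ : Fin d → ℝ) :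
    ∑ b, ∑ c, purityKernel d b c * δ b * δ c
      = (d + 1) / 2 * (∑ b, δ b ^ 2 - (∑ b, δ b) ^ 2 / d) := by
  have h : ∀ b, ∑ c, purityKernel d b c * δ b * δ c
      = (d + 1) / 2 * (δ b ^ 2 - δ b * ((∑ c, δ c) / d)) := by
    intro b
    have : ∀ c, purityKernel d b c * δ b * δ c = δ b * (purityKernel d b c * δ c) :=
      fun c => by ring
    simp only [this, ← Finset.mul_sum, sum_purityKernel_mul]
    ring
  simp only [h, ← Finset.mul_sum, Finset.sum_sub_distrib, ← Finset.sum_mul]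
  ring

-- The variance bound consists of the squared mean, two equal terms with `1 / m` and a term with `1
-- / m²`. With `R = ∑ r²` and `q = 1 / d`, the bound `1 / m² ≤ q` brings each below `(d + 1)²` times
-- a combination of `R²` and `q²`, and `(d + 1)² q²` is at most `9 / 4`. This is where samples of
-- size `√d` are enough.
set_option maxHeartbeats 1000000 in
theorem pairVariance_purityKernel_le {d m : ℕ} (hd : 2 ≤ d) (hm : d ≤ m ^ 2) {δ r : Fin d → ℝ}
    (hδ : ∀ b, |δ b| ≤ r b) (hr : ∑ b, r b ≤ 2) :
    (∑ b, ∑ c, purityKernel d b c * δ b * δ c) ^ 2 ≤ (d + 1) ^ 2 * (∑ b, r b ^ 2) ^ 2 + 2 ∧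
    pairVariance m (purityKernel d) δ r ≤ (d + 1) ^ 2 * (∑ b, r b ^ 2) ^ 2 + 2 := by
  have hr0 : ∀ b, 0 ≤ r b := fun b => (abs_nonneg _).trans (hδ b)
  have hd2 : (2 : ℝ) ≤ d := by exact_mod_cast hd
  have hd0 : (0 : ℝ) < d := by linarith
  have hm2 : (d : ℝ) ≤ m ^ 2 := by exact_mod_cast hm
  have hm0 : (0 : ℝ) < m := by
    rcases Nat.eq_zero_or_pos m with rfl | h
    · simp at hm2
      linarith
    · exact_mod_cast h
  set D := ∑ b, δ b ^ 2 with hD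
  set R := ∑ b, r b ^ 2 with hR
  set s := ∑ b, δ b with hs
  have hR0 : 0 ≤ R := Finset.sum_nonneg fun b _ => sq_nonneg _
  have hDR : D ≤ R := Finset.sum_le_sum fun b _ => by
    rw [← sq_abs (δ b)]
    exact pow_le_pow_left₀ (abs_nonneg _) (hδ b) 2
  have hsD : s ^ 2 / d ≤ D := by
    rw [div_le_iff₀ hd0, mul_comm]
    have := sq_sum_le_card_mul_sum_sq (s := (Finset.univ : Finset (Fin d))) (f := δ)
    rwa [Finset.card_univ, Fintype.card_fin] at this
  have hs0 : 0 ≤ s ^ 2 / d := by positivity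
  have hq : 1 / (d : ℝ) ≤ 1 / 2 := one_div_le_one_div_of_le (by norm_num) hd2
  have hq0 : 0 < 1 / (d : ℝ) := by positivity
  have hmq : 1 / (m : ℝ) ^ 2 ≤ 1 / d := one_div_le_one_div_of_le hd0 hm2
  set q := 1 / (d : ℝ) with hqdef
  have hQ : ((d : ℝ) + 1) ^ 2 * q ^ 2 ≤ 9 / 4 := by
    have : ((d : ℝ) + 1) * q = 1 + q := by
      rw [hqdef]
      field_simp
    rw [← mul_pow, this]
    have := pow_le_pow_left₀ (by linarith) (by linarith : 1 + q ≤ 3 / 2) 2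
    linarith
  have hmean : (∑ b, ∑ c, purityKernel d b c * δ b * δ c) ^ 2 ≤ (d + 1) ^ 2 / 4 * R ^ 2 := by
    rw [sum_sum_purityKernel, mul_pow, div_pow]
    norm_num only
    refine mul_le_mul_of_nonneg_left ?_ (by positivity)
    exact pow_le_pow_left₀ (by linarith) (by linarith) 2
  have hRq : R * q ≤ (R ^ 2 + q ^ 2) / 2 := by nlinarith [sq_nonneg (R - q)]
  have hcross : 1 / m * ∑ c, (∑ b, purityKernel d c b * δ b) ^ 2 * r c
      ≤ (d + 1) ^ 2 / 8 * (R * (R + q)) := by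
    have h1 : ∀ c, 1 / m * ((∑ b, purityKernel d c b * δ b) ^ 2 * r c)
        ≤ ((d + 1) / 2 * (δ c - s / d)) ^ 2 * ((R + q) / 2) := by
      intro c
      rw [sum_purityKernel_mul, ← hs]
      -- The arithmetic–geometric mean inequality, using `r c ^ 2 ≤ R` and `1 / m² ≤ q`.
      have h2 : 1 / m * r c ≤ (R + q) / 2 := by
        have h3 : r c ^ 2 ≤ R :=
          Finset.single_le_sum (f := fun b => r b ^ 2) (fun b _ => sq_nonneg _) (Finset.mem_univ c)
        have h4 : (1 / (m : ℝ)) ^ 2 ≤ q := by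
          rw [div_pow, one_pow]
          exact hmq
        nlinarith [sq_nonneg (1 / (m : ℝ) - r c)]
      have := mul_le_mul_of_nonneg_left h2 (sq_nonneg (((d : ℝ) + 1) / 2 * (δ c - s / d)))
      linarith
    rw [Finset.mul_sum]
    refine (Finset.sum_le_sum fun c _ => h1 c).trans ?_
    rw [← Finset.sum_mul]
    have h2 : ∑ c, ((d + 1) / 2 * (δ c - s / d)) ^ 2 = (d + 1) ^ 2 / 4 * (D - s ^ 2 / d) := by
      have h3 : ∀ c, (((d : ℝ) + 1) / 2 * (δ c - s / d)) ^ 2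
          = (d + 1) ^ 2 / 4 * (δ c ^ 2 - 2 * (s / d) * δ c + s ^ 2 / d ^ 2) := fun c => by ring
      simp only [h3, ← Finset.mul_sum, Finset.sum_add_distrib, Finset.sum_sub_distrib, ← hs, ← hD,
        Finset.sum_const, Finset.card_univ, Fintype.card_fin, nsmul_eq_mul]
      field_simp
      ring
    rw [h2]
    have h3 : (D - s ^ 2 / d) * (R + q) ≤ R * (R + q) :=
      mul_le_mul_of_nonneg_right (by linarith) (by linarith)
    have h4 := mul_le_mul_of_nonneg_left h3 (by positivity : 0 ≤ ((d : ℝ) + 1) ^ 2 / 8)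
    linarith
  have hdiag : 1 / m * ∑ b, (1 / m * ∑ c, purityKernel d b c ^ 2 * r c) * r b
      ≤ (d + 1) ^ 2 / 4 * (q * (R + 4 * q ^ 2)) := by
    have h1 : ∀ b c, purityKernel d b c ^ 2 * r c * r b
        ≤ (d + 1) ^ 2 / 4 * ((if b = c then 1 else 0) * (r c * r b) + q ^ 2 * (r c * r b)) := by
      intro b c
      have h2 : purityKernel d b c ^ 2 ≤ (d + 1) ^ 2 / 4 * ((if b = c then 1 else 0) + q ^ 2) := by
        rw [purityKernel, mul_pow, div_pow]
        norm_num only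
        refine mul_le_mul_of_nonneg_left ?_ (by positivity)
        rw [← hqdef]
        split_ifs <;> nlinarith
      have := mul_le_mul_of_nonneg_right h2 (mul_nonneg (hr0 c) (hr0 b))
      linarith
    have h2 : ∑ b, ∑ c, purityKernel d b c ^ 2 * r c * r b
        ≤ (d + 1) ^ 2 / 4 * (R + q ^ 2 * (∑ b, r b) ^ 2) := by
      refine (Finset.sum_le_sum fun b _ => Finset.sum_le_sum fun c _ => h1 b c).trans ?_
      simp only [← Finset.mul_sum, Finset.sum_add_distrib, ite_mul, one_mul, zero_mul,
        Finset.sum_ite_eq, Finset.mem_univ, if_true]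
      refine le_of_eq ?_
      congr 2
      · exact Finset.sum_congr rfl fun b _ => (sq (r b)).symm
      · congr 1
        simp only [← Finset.sum_mul]
        rw [← Finset.mul_sum, sq]
    have h3 : (∑ b, r b) ^ 2 ≤ 4 := by
      have := Finset.sum_nonneg fun b (_ : b ∈ Finset.univ) => hr0 b
      nlinarith
    have h4 : ∑ b, ∑ c, purityKernel d b c ^ 2 * r c * r b
        ≤ (d + 1) ^ 2 / 4 * (R + 4 * q ^ 2) := by
      refine h2.trans (mul_le_mul_of_nonneg_left ?_ (by positivity))
      nlinarith [sq_nonneg q]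
    have h5 : 1 / m * ∑ b, (1 / m * ∑ c, purityKernel d b c ^ 2 * r c) * r b
        = 1 / (m : ℝ) ^ 2 * ∑ b, ∑ c, purityKernel d b c ^ 2 * r c * r b := by
      simp only [Finset.mul_sum, Finset.sum_mul]
      refine Finset.sum_congr rfl fun b _ => Finset.sum_congr rfl fun c _ => ?_
      field_simp
    rw [h5]
    have h6 : 0 ≤ (d + 1) ^ 2 / 4 * (R + 4 * q ^ 2) := by positivity
    calc _ ≤ 1 / (m : ℝ) ^ 2 * ((d + 1) ^ 2 / 4 * (R + 4 * q ^ 2)) :=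
          mul_le_mul_of_nonneg_left h4 (by positivity)
      _ ≤ q * ((d + 1) ^ 2 / 4 * (R + 4 * q ^ 2)) := mul_le_mul_of_nonneg_right hmq h6
      _ = _ := by ring
  have hQ0 : 0 ≤ ((d : ℝ) + 1) ^ 2 := sq_nonneg _
  have hQR := mul_nonneg hQ0 (sq_nonneg R)
  clear_value R D s q
  constructor
  · linarith
  · have hsym : ∑ c, (∑ b, purityKernel d b c * δ b) ^ 2 * r c
        = ∑ c, (∑ b, purityKernel d c b * δ b) ^ 2 * r c :=
      Finset.sum_congr rfl fun c _ => by
        rw [Finset.sum_congr rfl fun b _ => by rw [purityKernel_symm b c]]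
    have hsplit : 1 / m * ∑ b, ((∑ c, purityKernel d b c * δ c) ^ 2
        + 1 / m * ∑ c, purityKernel d b c ^ 2 * r c) * r b
        = 1 / m * ∑ c, (∑ b, purityKernel d c b * δ b) ^ 2 * r c
          + 1 / m * ∑ b, (1 / m * ∑ c, purityKernel d b c ^ 2 * r c) * r b := by
      simp only [add_mul, Finset.sum_add_distrib, mul_add]
    rw [pairVariance, hsym, hsplit]
    have h1 : R * (R + q) ≤ (3 * R ^ 2 + q ^ 2) / 2 := by linarith
    have h2 : q * (R + 4 * q ^ 2) ≤ R ^ 2 / 2 + q ^ 2 / 2 + 2 * q ^ 2 := by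
      have h5 := mul_le_mul_of_nonneg_left hq (sq_nonneg q)
      linarith
    have h3 := mul_le_mul_of_nonneg_left h1 hQ0
    have h4 := mul_le_mul_of_nonneg_left h2 hQ0
    linarith

/-! ### Measurements in a random basis -/

theorem single_posSemidef {n : Type} [Fintype n] [DecidableEq n] (b : n) :
    (Matrix.single b b (1 : ℂ)).PosSemidef := by
  have h : Matrix.single b b (1 : ℂ) = (Matrix.single b b (1 : ℂ))ᴴ * Matrix.single b b 1 := by
    simp
  rw [h]
  exact Matrix.posSemidef_conjTranspose_mul_self _

theorem sum_single_eq_one {n : Type} [Fintype n] [DecidableEq n] :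
    ∑ b : n, Matrix.single b b (1 : ℂ) = 1 := by
  ext i j
  simp [Matrix.sum_apply, Matrix.single_apply, Matrix.one_apply, ite_and]

/-- The measurement in the basis given by the columns of a unitary matrix, with an additional
outcome for a failed call. -/
def basisEffect {d : ℕ} (W : U d) : Option (Fin d) → Op (Option (Fin d))
  | some b =>
    padFailure (W : Op (Fin d)) * Matrix.single b b (1 : ℂ) * (padFailure (W : Op (Fin d)))ᴴ
  | none => Matrix.single none none (1 : ℂ)

theorem basisEffect_posSemidef {d : ℕ} (W : U d) (o : Option (Fin d)) :
    (basisEffect W o).PosSemidef := by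
  cases o with
  | none => exact single_posSemidef _
  | some b => exact (single_posSemidef b).mul_mul_conjTranspose_same _

theorem sum_basisEffect {d : ℕ} (W : U d) : ∑ o, basisEffect W o = 1 := by
  have h2 := Matrix.mem_unitaryGroup_iff.mp W.2
  rw [Matrix.star_eq_conjTranspose] at h2
  rw [Fintype.sum_option]
  simp only [basisEffect]
  rw [← Matrix.sum_mul, ← Matrix.mul_sum, sum_single_eq_one]
  ext p q
  rw [Matrix.add_apply, padFailure_mul_mul]
  rcases p with _ | i <;> rcases q with _ | j
  · simp
  · simp
  · simp
  · simp [Matrix.one_apply, h2]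

theorem continuous_basisEffect {d : ℕ} (o p q : Option (Fin d)) :
    Continuous fun W : U d => basisEffect W o p q := by
  cases o with
  | none => exact continuous_const
  | some b =>
    simp only [basisEffect, padFailure_mul_mul]
    rcases p with _ | i <;> rcases q with _ | j
    · exact continuous_const
    · exact continuous_const
    · exact continuous_const
    · simp only [Matrix.mul_apply, Matrix.conjTranspose_apply]
      fun_prop

/-- The first or second basis vector. -/
def inputIndex (d : ℕ) [NeZero d] (c : Fin 2) : Fin d := if c = 0 then 0 else 1

/-- The outcome distribution of a measurement in the random basis `s.2` on the output of one of
two random orthogonal states given by `s.1`. -/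
def outcomeProb {d : ℕ} [NeZero d] (E : Op (Fin d) →ₗ[ℂ] Op (Fin d)) (s : U d × U d) (c : Fin 2)
    (o : Option (Fin d)) : ℝ :=
  (basisEffect s.2 o * withFailure E (pureState s.1 (inputIndex d c))).trace.re

theorem pureState_posSemidef {d : ℕ} (V : U d) (a : Fin d) : (pureState V a).PosSemidef :=
  (single_posSemidef a).mul_mul_conjTranspose_same _

theorem outcomeProb_nonneg {d : ℕ} [NeZero d] {E : Op (Fin d) →ₗ[ℂ] Op (Fin d)}
    (hE : IsChannel E) (s : U d × U d) (c : Fin 2) (o : Option (Fin d)) :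
    0 ≤ outcomeProb E s c o :=
  trace_mul_re_nonneg (basisEffect_posSemidef _ _)
    (isCP_posSemidef (isCP_withFailure hE) (pureState_posSemidef _ _))

theorem sum_outcomeProb {d : ℕ} [NeZero d] (E : Op (Fin d) →ₗ[ℂ] Op (Fin d)) (s : U d × U d)
    (c : Fin 2) : ∑ o, outcomeProb E s c o = 1 := by
  simp only [outcomeProb, ← Complex.re_sum, ← Matrix.trace_sum, ← Finset.sum_mul]
  rw [sum_basisEffect, one_mul, withFailure_trace, pureState_trace, Complex.one_re]

theorem continuous_outcomeProb {d : ℕ} [NeZero d] (E : Op (Fin d) →ₗ[ℂ] Op (Fin d)) (c : Fin 2)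
    (o : Option (Fin d)) : Continuous fun s : U d × U d => outcomeProb E s c o := by
  refine Complex.continuous_re.comp ?_
  simp only [Matrix.trace, Matrix.diag_apply, Matrix.mul_apply]
  exact continuous_finsetSum _ fun p _ => continuous_finsetSum _ fun q _ =>
    ((continuous_basisEffect o p q).comp continuous_snd).mul
      ((continuous_linearMap_pureState (withFailure E) _ q p).comp continuous_fst)

theorem outcomeProb_some {d : ℕ} [NeZero d] (E : Op (Fin d) →ₗ[ℂ] Op (Fin d)) (s : U d × U d)
    (c : Fin 2) (b : Fin d) : outcomeProb E s c (some b)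
      = (E (pureState s.1 (inputIndex d c)) * pureState s.2 b).trace.re := by
  have h : ∀ (X : Op (Fin d)) (W : Op (Fin d)), (padFailure W)ᴴ * withFailure E X * padFailure W
      = Wᴴ * E X * W := by
    intro X W
    ext i j
    simp only [Matrix.mul_apply, Fintype.sum_option, Matrix.conjTranspose_apply]
    simp [padFailure, withFailure]
  have h1 : ∀ X : Op (Fin d), (basisEffect s.2 (some b) * withFailure E X).trace
      = (E X * pureState s.2 b).trace := by
    intro X
    calc (basisEffect s.2 (some b) * withFailure E X).trace
        = (Matrix.single b b 1 * ((padFailure (s.2 : Op (Fin d)))ᴴ * withFailure E X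
          * padFailure (s.2 : Op (Fin d)))).trace := by
          simp only [basisEffect]
          rw [Matrix.mul_assoc, Matrix.mul_assoc, Matrix.trace_mul_comm, Matrix.mul_assoc]
      _ = (E X * pureState s.2 b).trace := by
          rw [h, pureState, Matrix.trace_mul_comm]
          simp only [Matrix.mul_assoc]
          rw [Matrix.trace_mul_comm]
          simp only [Matrix.mul_assoc]
  rw [outcomeProb, h1]

theorem sum_pureState {d : ℕ} (W : U d) : ∑ b, pureState W b = 1 := by
  have h2 := Matrix.mem_unitaryGroup_iff.mp W.2
  rw [Matrix.star_eq_conjTranspose] at h2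
  simp only [pureState]
  rw [← Matrix.sum_mul, ← Matrix.mul_sum, sum_single_eq_one, mul_one, h2]

/-- The failure probability is a diagonal entry of a positive semidefinite matrix. -/
theorem IsChannel.trace_le_one {d : ℕ} {E : Op (Fin d) →ₗ[ℂ] Op (Fin d)} (hE : IsChannel E)
    (V : U d) (a : Fin d) : (E (pureState V a)).trace.re ≤ 1 := by
  have h := (isCP_posSemidef (isCP_withFailure hE) (pureState_posSemidef V a)).diag_nonneg
    (i := none)
  have h1 : withFailure E (pureState V a) none none
      = (pureState V a).trace - (E (pureState V a)).trace := rfl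
  rw [h1, pureState_trace, Complex.le_def] at h
  simpa using h.1

theorem IsChannel.posSemidef {d : ℕ} {E : Op (Fin d) →ₗ[ℂ] Op (Fin d)} (hE : IsChannel E)
    {X : Op (Fin d)} (hX : X.PosSemidef) : (E X).PosSemidef := by
  obtain ⟨r, K, -, hK⟩ := hE
  exact isCP_posSemidef ⟨r, K, hK⟩ hX

/-- The weighted power mean inequality for fourth powers. -/
theorem sum_pow_four_le {ι : Type*} (s : Finset ι) {a c : ι → ℝ} (ha : ∀ i, 0 ≤ a i)
    (hc : ∀ i, 0 ≤ c i) (hac : ∀ i, c i = 0 → a i = 0) (hs : ∑ i ∈ s, c i ≤ 1) :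
    (∑ i ∈ s, a i) ^ 4 ≤ ∑ i ∈ s, a i ^ 4 / c i ^ 3 := by
  have h0 : 0 ≤ ∑ i ∈ s, c i := Finset.sum_nonneg fun i _ => hc i
  -- Cauchy–Schwarz with weights `c`, used twice: here for the square, then for the fourth power.
  have h1 : (∑ i ∈ s, a i) ^ 2 ≤ (∑ i ∈ s, c i) * ∑ i ∈ s, a i ^ 2 / c i := by
    refine Finset.sum_sq_le_sum_mul_sum_of_sq_le_mul _ (fun i _ => hc i)
      (fun i _ => div_nonneg (sq_nonneg _) (hc i)) fun i _ => ?_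
    by_cases h : c i = 0
    · rw [hac i h, h]
      simp
    · rw [mul_div_cancel₀ _ h]
  have h2 : (∑ i ∈ s, a i ^ 2 / c i) ^ 2 ≤ (∑ i ∈ s, c i) * ∑ i ∈ s, a i ^ 4 / c i ^ 3 := by
    refine Finset.sum_sq_le_sum_mul_sum_of_sq_le_mul _ (fun i _ => hc i)
      (fun i _ => div_nonneg (pow_nonneg (ha i) 4) (pow_nonneg (hc i) 3)) fun i _ => ?_
    by_cases h : c i = 0
    · rw [hac i h, h]
      simp
    · refine le_of_eq ?_
      field_simp
  have h3 : 0 ≤ ∑ i ∈ s, a i ^ 2 / c i :=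
    Finset.sum_nonneg fun i _ => div_nonneg (sq_nonneg _) (hc i)
  have h4 : 0 ≤ ∑ i ∈ s, a i ^ 4 / c i ^ 3 :=
    Finset.sum_nonneg fun i _ => div_nonneg (pow_nonneg (ha i) 4) (pow_nonneg (hc i) 3)
  have h5 : (∑ i ∈ s, a i) ^ 2 ≤ ∑ i ∈ s, a i ^ 2 / c i :=
    h1.trans (mul_le_of_le_one_left h3 hs)
  calc (∑ i ∈ s, a i) ^ 4 = ((∑ i ∈ s, a i) ^ 2) ^ 2 := by ring
    _ ≤ (∑ i ∈ s, a i ^ 2 / c i) ^ 2 := pow_le_pow_left₀ (sq_nonneg _) h5 2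
    _ ≤ _ := h2.trans (mul_le_of_le_one_left h4 hs)

/-- Writing `X = Lᴴ L` makes the probability a sum of squared matrix elements of `W`, one for each
row of `L`, with weights `c i` of total at most one. The power mean inequality reduces its fourth
moment to the eighth moments of these matrix elements. -/
theorem integral_trace_mul_pureState_pow_four_le {d : ℕ} [NeZero d] {X : Op (Fin d)}
    (hX : X.PosSemidef) (htr : X.trace.re ≤ 1) (b : Fin d) :
    ∫ W : U d, (X * pureState W b).trace.re ^ 4 ∂haar d ≤ 24 / d ^ 4 := by
  obtain ⟨L, rfl⟩ := exists_factor_of_posSemidef hX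
  set c : Fin d → ℝ := fun i => ∑ j, ‖L i j‖ ^ 2 with hc
  set a : U d → Fin d → ℝ := fun W i =>
    ‖∑ k, ∑ j, L i k * (Pi.single b 1 : Fin d → ℂ) j * (W : Op (Fin d)) k j‖ ^ 2 with ha
  have hc0 : ∀ i, 0 ≤ c i := fun i => Finset.sum_nonneg fun j _ => sq_nonneg _
  have hsum : ∑ i, c i ≤ 1 := by
    rw [Matrix.trace_mul_comm, trace_mul_conjTranspose_re, Fintype.sum_prod_type] at htr
    exact htr
  have heq : ∀ W : U d, (Lᴴ * L * pureState W b).trace.re = ∑ i, a W i := by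
    intro W
    have h1 : (Lᴴ * L * pureState W b).trace
        = ((L * (W : Op (Fin d)) * Matrix.single b b 1)
          * (L * (W : Op (Fin d)) * Matrix.single b b 1)ᴴ).trace := by
      have h2 : Matrix.single b b (1 : ℂ) = Matrix.single b b 1 * (Matrix.single b b (1 : ℂ))ᴴ := by
        simp
      have h3 : pureState W b = (W : Op (Fin d)) * Matrix.single b b 1
          * ((W : Op (Fin d)) * Matrix.single b b 1)ᴴ := by
        conv_lhs => rw [pureState, h2]
        simp only [Matrix.conjTranspose_mul, Matrix.mul_assoc]
      rw [h3, mul_assoc, Matrix.trace_mul_comm]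
      simp only [Matrix.conjTranspose_mul, Matrix.mul_assoc]
    rw [h1, trace_mul_conjTranspose_re, Fintype.sum_prod_type]
    refine Finset.sum_congr rfl fun i _ => ?_
    rw [Finset.sum_eq_single b]
    · simp only [ha]
      congr 2
      rw [Matrix.mul_single_apply_same, mul_one, Matrix.mul_apply]
      refine Finset.sum_congr rfl fun k _ => ?_
      rw [Finset.sum_eq_single b]
      · simp
      · intro j _ hj
        simp [hj]
      · simp
    · intro j _ hj
      simp [Matrix.mul_apply, hj.symm]
    · simp
  have hac : ∀ W i, c i = 0 → a W i = 0 := by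
    intro W i hi
    have h1 : ∀ k, L i k = 0 := fun k => by
      have := (Finset.sum_eq_zero_iff_of_nonneg fun j _ => sq_nonneg ‖L i j‖).mp hi k
        (Finset.mem_univ k)
      simpa using this
    simp [ha, h1]
  have hcont : ∀ i, Continuous fun W : U d => a W i := by
    intro i
    simp only [ha]
    fun_prop
  have hmom : ∀ i, ∫ W : U d, a W i ^ 4 ∂haar d ≤ 24 * c i ^ 4 / d ^ 4 := by
    intro i
    have h := integral_norm_pow_eight_le (d := d) (fun k => L i k) (Pi.single b 1)
    have h1 : ∑ j, ‖(Pi.single b 1 : Fin d → ℂ) j‖ ^ 2 = 1 := by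
      rw [Finset.sum_eq_single b]
      · simp
      · intro j _ hj
        simp [hj]
      · simp
    rw [h1, mul_one] at h
    simp only [ha, ← pow_mul]
    exact h
  have hcont4 : ∀ i, Continuous fun W : U d => a W i ^ 4 / c i ^ 3 :=
    fun i => ((hcont i).pow 4).div_const _
  simp only [heq]
  calc ∫ W : U d, (∑ i, a W i) ^ 4 ∂haar d
      ≤ ∫ W : U d, ∑ i, a W i ^ 4 / c i ^ 3 ∂haar d := by
        refine integral_mono (integrable_haar ((continuous_finsetSum _ fun i _ => hcont i).pow 4))
          (integrable_haar (continuous_finsetSum _ fun i _ => hcont4 i))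
          fun W => ?_
        exact sum_pow_four_le _ (fun i => sq_nonneg _) hc0 (hac W) hsum
    _ = ∑ i, (∫ W : U d, a W i ^ 4 ∂haar d) / c i ^ 3 := by
        rw [integral_finsetSum _ fun i _ => integrable_haar (hcont4 i)]
        simp only [integral_div]
    _ ≤ ∑ i, 24 / d ^ 4 * c i := by
        refine Finset.sum_le_sum fun i _ => ?_
        refine (div_le_div_of_nonneg_right (hmom i) (pow_nonneg (hc0 i) 3)).trans ?_
        by_cases h : c i = 0
        · rw [h]
          simp
        · refine le_of_eq ?_
          have : (d : ℝ) ≠ 0 := Nat.cast_ne_zero.mpr (NeZero.ne d)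
          field_simp
    _ ≤ 24 / d ^ 4 := by
        rw [← Finset.mul_sum]
        exact mul_le_of_le_one_right (by positivity) hsum

theorem trace_mul_re_sq {n : Type} [Fintype n] {A B : Op n} (hA : Aᴴ = A) (hB : Bᴴ = B) :
    (A * B).trace.re ^ 2 = ((A * B).trace * (A * B).trace).re := by
  have h : star (A * B).trace = (A * B).trace := by
    rw [← Matrix.trace_conjTranspose, Matrix.conjTranspose_mul, hA, hB, Matrix.trace_mul_comm]
  have h1 : (A * B).trace.im = 0 := Complex.conj_eq_iff_im.mp h
  rw [Complex.mul_re, h1]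
  ring

/-- Each of the `d` basis states is Haar-distributed and contributes `(tr A² + (tr A)²) / (d (d +
1))`. -/
theorem integral_sum_trace_sq {d : ℕ} [d.AtLeastTwo] {A : Op (Fin d)} (hA : Aᴴ = A) :
    ∫ W : U d, ∑ b, (A * pureState W b).trace.re ^ 2 ∂haar d
      = ((A * A).trace + A.trace * A.trace).re / (d + 1) := by
  let f : Op (Fin d) →ₗ[ℂ] ℂ := Matrix.traceLinearMap _ ℂ ℂ ∘ₗ LinearMap.mulLeft ℂ A
  have hf : ∀ X, f X = (A * X).trace := fun _ => rfl
  have h1 : ∀ (W : U d) (b : Fin d), (A * pureState W b).trace.re ^ 2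
      = (f.smulRight f (pureState W b) (pureState W b)).re := by
    intro W b
    rw [trace_mul_re_sq hA (pureState_conjTranspose W b)]
    rfl
  have hsw : swapSum (f.smulRight f) = (A * A).trace := by
    have h2 : ∀ i j : Fin d, f (Matrix.single i j 1) = A j i := fun i j => by
      rw [hf, Matrix.trace_mul_single]
      simp
    simp only [swapSum, LinearMap.smulRight_apply, LinearMap.smul_apply, h2, smul_eq_mul,
      Matrix.trace, Matrix.diag_apply, Matrix.mul_apply]
    exact Finset.sum_congr rfl fun i _ => Finset.sum_congr rfl fun j _ => mul_comm _ _
  have h11 : f.smulRight f 1 1 = A.trace * A.trace := by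
    simp only [LinearMap.smulRight_apply, LinearMap.smul_apply, hf, mul_one, smul_eq_mul]
  have hcont : ∀ b, Continuous fun W : U d => (f.smulRight f (pureState W b) (pureState W b)).re :=
    fun b => Complex.continuous_re.comp (continuous_bilin_pureState _ _ _)
  simp only [h1]
  rw [integral_finsetSum _ fun b _ => integrable_haar (hcont b)]
  simp only [integral_re_bilin_pureState, hsw, h11, if_true, Finset.sum_const, Finset.card_univ,
    Fintype.card_fin, nsmul_eq_mul]
  have hd := natCast_ne_zero_of_two (d := d)
  have hm := natCast_sub_one_ne_zero d
  have hp := natCast_add_one_ne_zero' d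
  rw [← Complex.ofReal_natCast, ← Complex.re_ofReal_mul]
  have h3 : ((d : ℝ) : ℂ) * (((1 - 1 / ((d : ℝ) : ℂ)) * (A.trace * A.trace)
      + (1 - 1 / ((d : ℝ) : ℂ)) * (A * A).trace) / (((d : ℝ) : ℂ) ^ 2 - 1))
      = ((A * A).trace + A.trace * A.trace) / (((d : ℝ) + 1 : ℝ) : ℂ) := by
    push_cast
    rw [show (d : ℂ) ^ 2 - 1 = (d - 1) * (d + 1) by ring]
    field_simp
    ring
  rw [h3, Complex.div_ofReal_re]

theorem integrable_of_continuous {X : Type*} [TopologicalSpace X] [CompactSpace X]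
    [MeasurableSpace X] [OpensMeasurableSpace X] (μ : Measure X) [IsFiniteMeasure μ] {f : X → ℝ}
    (hf : Continuous f) : Integrable f μ :=
  hf.integrable_of_hasCompactSupport (HasCompactSupport.of_compactSpace f)

theorem MeanVariance.mono {K : Type} [Fintype K] {w g : K → ℝ} {m V V' : ℝ}
    (hw : MeanVariance w g m V) (h : V ≤ V') : MeanVariance w g m V' :=
  ⟨hw.nonneg, hw.total, hw.mean, hw.variance.trans h⟩

section OutcomeStatistics

variable {d : ℕ} [NeZero d] (E : Op (Fin d) →ₗ[ℂ] Op (Fin d)) (s : U d × U d)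

/-- The difference of the two outcome distributions. -/
def outcomeDiff (b : Fin d) : ℝ := outcomeProb E s 0 (some b) - outcomeProb E s 1 (some b)

/-- The sum of the two outcome distributions. -/
def outcomeSum (b : Fin d) : ℝ := outcomeProb E s 0 (some b) + outcomeProb E s 1 (some b)

/-- The mean of the statistic, given the random unitaries. -/
def groupMean : ℝ :=
  ∑ b, ∑ c, purityKernel d b c * outcomeDiff E s b * outcomeDiff E s c

/-- A bound for the second moment of the statistic, given the random unitaries. -/
def groupVariance : ℝ := (d + 1) ^ 2 * (∑ b, outcomeSum E s b ^ 2) ^ 2 + 2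

end OutcomeStatistics

theorem continuous_groupMean {d : ℕ} [NeZero d] (E : Op (Fin d) →ₗ[ℂ] Op (Fin d)) :
    Continuous (groupMean E) := by
  have h := continuous_outcomeProb E
  unfold groupMean outcomeDiff
  fun_prop

theorem continuous_groupVariance {d : ℕ} [NeZero d] (E : Op (Fin d) →ₗ[ℂ] Op (Fin d)) :
    Continuous (groupVariance E) := by
  have h := continuous_outcomeProb E
  unfold groupVariance outcomeSum
  fun_prop

theorem groupVariance_bounds {d m : ℕ} [d.AtLeastTwo] (hm : d ≤ m ^ 2)
    {E : Op (Fin d) →ₗ[ℂ] Op (Fin d)} (hE : IsChannel E) (s : U d × U d) :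
    groupMean E s ^ 2 ≤ groupVariance E s ∧
    pairVariance m (purityKernel d) (outcomeDiff E s) (outcomeSum E s) ≤ groupVariance E s := by
  have h0 := outcomeProb_nonneg hE s
  refine pairVariance_purityKernel_le Nat.AtLeastTwo.prop hm (fun b => ?_) ?_
  · rw [outcomeDiff, outcomeSum, abs_le]
    constructor <;> linarith [h0 0 (some b), h0 1 (some b)]
  · have h1 := fun c => sum_outcomeProb E s c
    simp only [Fintype.sum_option] at h1
    simp only [outcomeSum, Finset.sum_add_distrib]
    linarith [h0 0 none, h0 1 none, h1 0, h1 1]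

theorem meanVariance_group {d m : ℕ} [d.AtLeastTwo] (hm0 : 0 < m) (hm : d ≤ m ^ 2)
    {E : Op (Fin d) →ₗ[ℂ] Op (Fin d)} (hE : IsChannel E) (s : U d × U d) :
    MeanVariance (fun k : (Fin m × Fin 2 → Option (Fin d)) × (Fin m × Fin 2 → Option (Fin d)) =>
        sampleWeight (outcomeProb E s) k.1 * sampleWeight (outcomeProb E s) k.2)
      (pairStatistic (purityKernel d)) (groupMean E s) (groupVariance E s) :=
  (meanVariance_pairStatistic hm0 (outcomeProb_nonneg hE s) (sum_outcomeProb E s)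
    (purityKernel d) (fun _ => rfl) fun _ => rfl).mono (groupVariance_bounds hm hE s).2

/-- The sum of the outcome differences is `tr A` in every basis, so only the sum of squares is
averaged. The factor `(d + 1) / 2` of the kernel cancels the `d + 1` of `integral_sum_trace_sq`,
which leaves half of `tr A² - (tr A)² / d`. -/
theorem integral_groupMean_right {d : ℕ} [d.AtLeastTwo] {E : Op (Fin d) →ₗ[ℂ] Op (Fin d)}
    (hE : IsHermPres E) (V : U d) : ∫ W, groupMean E (V, W) ∂haar d
      = 1 / 2 * (centeredForm E (pureState V 0 - pureState V 1)
        (pureState V 0 - pureState V 1)).re := by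
  set A := E (pureState V 0 - pureState V 1) with hA
  have hAh : Aᴴ = A := by
    rw [hA, hE, Matrix.conjTranspose_sub, pureState_conjTranspose, pureState_conjTranspose]
  have hδ : ∀ W b, outcomeDiff E (V, W) b = (A * pureState W b).trace.re := by
    intro W b
    rw [outcomeDiff, outcomeProb_some, outcomeProb_some, ← Complex.sub_re, ← Matrix.trace_sub,
      ← sub_mul, ← map_sub]
    simp [inputIndex, hA]
  have hsum : ∀ W : U d, ∑ b, (A * pureState W b).trace.re = A.trace.re := by
    intro W
    rw [← Complex.re_sum, ← Matrix.trace_sum, ← Finset.mul_sum, sum_pureState, mul_one]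
  have hsq : A.trace.re ^ 2 = (A.trace * A.trace).re := by
    have := trace_mul_re_sq (B := 1) hAh Matrix.conjTranspose_one
    rwa [mul_one] at this
  have hcont : Continuous fun W : U d => ∑ b, (A * pureState W b).trace.re ^ 2 := by
    have h : ∀ b, Continuous fun W : U d => (A * pureState W b).trace := fun b => by
      simp only [Matrix.trace, Matrix.diag_apply, Matrix.mul_apply]
      fun_prop
    exact continuous_finsetSum _ fun b _ => (Complex.continuous_re.comp (h b)).pow 2
  have hd : (0 : ℝ) < d := Nat.cast_pos.mpr (Nat.pos_of_ne_zero (NeZero.ne d))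
  simp only [groupMean, sum_sum_purityKernel, hδ, hsum]
  rw [integral_const_mul, integral_sub (integrable_haar hcont) (integrable_const _),
    integral_sum_trace_sq hAh, integral_const, probReal_univ, one_smul, hsq, centeredForm_apply,
    ← hA, Complex.sub_re, Complex.add_re]
  have h1 : (1 / (d : ℂ) * (A.trace * A.trace)).re = 1 / d * (A.trace * A.trace).re := by
    rw [← Complex.re_ofReal_mul]
    push_cast
    rfl
  rw [h1]
  field_simp
  ring

/-- Bilinear expansion gives two terms with equal states and two with orthogonal states. By unitary
invariance, half of their signed sum is the expression of `altUnitarity_eq_integral`. -/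
theorem integral_groupMean {d : ℕ} [d.AtLeastTwo] {E : Op (Fin d) →ₗ[ℂ] Op (Fin d)}
    (hE : IsHermPres E) :
    ∫ s, groupMean E s ∂((haar d).prod (haar d)) = altUnitarity E := by
  have hint : ∀ a b, Integrable
      (fun V : U d => (centeredForm E (pureState V a) (pureState V b)).re) (haar d) := fun a b =>
    integrable_haar (Complex.continuous_re.comp (continuous_bilin_pureState _ a b))
  have hint2 : ∀ a b a' b', Integrable (fun V : U d =>
      (centeredForm E (pureState V a) (pureState V b)).re
        - (centeredForm E (pureState V a') (pureState V b')).re) (haar d) :=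
    fun a b a' b' => (hint a b).sub (hint a' b')
  rw [integral_prod _ (integrable_of_continuous _ (continuous_groupMean E)),
    altUnitarity_eq_integral hE]
  simp only [integral_groupMean_right hE, map_sub, LinearMap.sub_apply, Complex.sub_re]
  rw [integral_const_mul, integral_sub (hint2 0 0 1 0) (hint2 0 1 1 1),
    integral_sub (hint 0 0) (hint 1 0), integral_sub (hint 0 1) (hint 1 1),
    integral_sub (hint 0 0) (hint 0 1)]
  simp only [integral_re_bilin_pureState, if_true, if_neg (fin_zero_ne_one (d := d)),
    if_neg (fin_zero_ne_one (d := d)).symm]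
  ring

theorem integral_outcomeProb_pow_four_le {d : ℕ} [d.AtLeastTwo] {E : Op (Fin d) →ₗ[ℂ] Op (Fin d)}
    (hE : IsChannel E) (c : Fin 2) (b : Fin d) :
    ∫ s, outcomeProb E s c (some b) ^ 4 ∂((haar d).prod (haar d)) ≤ 24 / d ^ 4 := by
  have hint : Integrable (fun s => outcomeProb E s c (some b) ^ 4) ((haar d).prod (haar d)) :=
    integrable_of_continuous _ ((continuous_outcomeProb E c (some b)).pow 4)
  rw [integral_prod _ hint]
  have h : ∀ V : U d, ∫ W, outcomeProb E (V, W) c (some b) ^ 4 ∂haar d ≤ 24 / d ^ 4 := by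
    intro V
    simp only [outcomeProb_some]
    exact integral_trace_mul_pureState_pow_four_le (hE.posSemidef (pureState_posSemidef V _))
      (hE.trace_le_one V _) b
  have h1 := integral_mono hint.integral_prod_left (integrable_const (24 / (d : ℝ) ^ 4)) h
  rwa [integral_const, probReal_univ, one_smul] at h1

/-- Power means bound the squared collision sum by `8 d` times the sum of all fourth powers, with
expectation at most `384 / d²`. As `(d + 1)² / d² ≤ 9 / 4`, the total is at most `864 + 2`. -/
theorem integral_groupVariance_le {d : ℕ} [d.AtLeastTwo] {E : Op (Fin d) →ₗ[ℂ] Op (Fin d)}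
    (hE : IsChannel E) : ∫ s, groupVariance E s ∂((haar d).prod (haar d)) ≤ 866 := by
  have hd2 : (2 : ℝ) ≤ d := by exact_mod_cast (Nat.AtLeastTwo.prop : 2 ≤ d)
  have hint : ∀ c b, Integrable (fun s => outcomeProb E s c (some b) ^ 4)
      ((haar d).prod (haar d)) := fun c b =>
    integrable_of_continuous _ ((continuous_outcomeProb E c (some b)).pow 4)
  have h1 : ∀ s, groupVariance E s ≤ (d + 1) ^ 2 * (d * ∑ b, 8 *
      (outcomeProb E s 0 (some b) ^ 4 + outcomeProb E s 1 (some b) ^ 4)) + 2 := by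
    intro s
    refine add_le_add (mul_le_mul_of_nonneg_left ?_ (by positivity)) le_rfl
    have h2 := sq_sum_le_card_mul_sum_sq (s := (Finset.univ : Finset (Fin d)))
      (f := fun b => outcomeSum E s b ^ 2)
    rw [Finset.card_univ, Fintype.card_fin] at h2
    refine h2.trans (mul_le_mul_of_nonneg_left (Finset.sum_le_sum fun b _ => ?_) (by positivity))
    rw [outcomeSum]
    generalize outcomeProb E s 0 (some b) = x
    generalize outcomeProb E s 1 (some b) = y
    have h3 : (x + y) ^ 2 ≤ 2 * (x ^ 2 + y ^ 2) := by nlinarith [sq_nonneg (x - y)]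
    have h4 := pow_le_pow_left₀ (sq_nonneg _) h3 2
    nlinarith [sq_nonneg (x ^ 2 - y ^ 2)]
  have hi : Integrable (fun s => ∑ b, 8 * (outcomeProb E s 0 (some b) ^ 4
      + outcomeProb E s 1 (some b) ^ 4)) ((haar d).prod (haar d)) :=
    integrable_finsetSum _ fun b _ => ((hint 0 b).add (hint 1 b)).const_mul 8
  have hint8 : ∀ b, Integrable (fun s => 8 * (outcomeProb E s 0 (some b) ^ 4
      + outcomeProb E s 1 (some b) ^ 4)) ((haar d).prod (haar d)) := fun b =>
    ((hint 0 b).add (hint 1 b)).const_mul 8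
  refine (integral_mono (integrable_of_continuous _ (continuous_groupVariance E))
    (((hi.const_mul (d : ℝ)).const_mul (((d : ℝ) + 1) ^ 2)).add (integrable_const 2)) h1).trans ?_
  rw [integral_add' ((hi.const_mul (d : ℝ)).const_mul _) (integrable_const 2), integral_const_mul,
    integral_const_mul, integral_const, probReal_univ, one_smul,
    integral_finsetSum _ fun b _ => hint8 b]
  have h2 : ∑ b, ∫ s, 8 * (outcomeProb E s 0 (some b) ^ 4 + outcomeProb E s 1 (some b) ^ 4)
      ∂((haar d).prod (haar d)) ≤ ∑ _b : Fin d, 384 / (d : ℝ) ^ 4 := by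
    refine Finset.sum_le_sum fun b _ => ?_
    rw [integral_const_mul, integral_add (hint 0 b) (hint 1 b)]
    have h3 := integral_outcomeProb_pow_four_le hE 0 b
    have h4 := integral_outcomeProb_pow_four_le hE 1 b
    have h5 : 384 / (d : ℝ) ^ 4 = 8 * (24 / d ^ 4 + 24 / d ^ 4) := by ring
    linarith
  rw [Finset.sum_const, Finset.card_univ, Fintype.card_fin, nsmul_eq_mul] at h2
  have h3 : ((d : ℝ) + 1) ^ 2 * (d * (d * (384 / d ^ 4))) ≤ 864 := by
    have : ((d : ℝ) + 1) ^ 2 * (d * (d * (384 / d ^ 4))) = 384 * (d + 1) ^ 2 / d ^ 2 := by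
      field_simp
    rw [this, div_le_iff₀ (by positivity)]
    nlinarith
  have h4 := mul_le_mul_of_nonneg_left (mul_le_mul_of_nonneg_left h2 (by positivity : 0 ≤ (d : ℝ)))
    (by positivity : 0 ≤ ((d : ℝ) + 1) ^ 2)
  linarith

/-! ### An algorithm with incoherent access -/

/-- The law of the random unitaries of one group of calls. -/
abbrev groupLaw (d : ℕ) : Measure (U d × U d) := (haar d).prod (haar d)

/-- The indices of the calls: the group, and within a group one of two pairs of samples, the
position in the sample, and the input state. -/
def callEquiv (m N : ℕ) : Fin N × (Fin 2 × (Fin m × Fin 2)) ≃ Fin (m * 2 * 2 * N) :=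
  (show Fin N × (Fin 2 × (Fin m × Fin 2)) ≃ ((Fin m × Fin 2) × Fin 2) × Fin N from
    ⟨fun x => (((x.2.2.1, x.2.1), x.2.2.2), x.1), fun y => (y.2, (y.1.1.2, (y.1.1.1, y.1.2))),
      fun _ => rfl, fun _ => rfl⟩).trans
  ((((finProdFinEquiv.prodCongr (Equiv.refl _)).trans finProdFinEquiv).prodCongr
    (Equiv.refl _)).trans finProdFinEquiv)

theorem callEquiv_val {m N : ℕ} (x : Fin N × (Fin 2 × (Fin m × Fin 2))) :
    (callEquiv m N x).val = x.1 + N * (x.2.2.2 + 2 * (x.2.1 + 2 * x.2.2.1)) := by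
  simp [callEquiv, finProdFinEquiv_apply_val]

/-- The factors are ordered so that the group is the call number modulo `N` and the input state the
parity of its quotient by `N`; the estimator is defined through these numbers. -/
theorem ofNat_callEquiv {m N : ℕ} [NeZero N] (x : Fin N × (Fin 2 × (Fin m × Fin 2))) :
    Fin.ofNat N (callEquiv m N x).val = x.1 ∧
    Fin.ofNat 2 ((callEquiv m N x).val / N) = x.2.2.2 := by
  have hN : 0 < N := Nat.pos_of_ne_zero (NeZero.ne N)
  rw [callEquiv_val]
  constructor
  · refine Fin.ext ?_
    rw [Fin.val_ofNat, Nat.add_mul_mod_self_left, Nat.mod_eq_of_lt x.1.isLt]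
  · refine Fin.ext ?_
    rw [Fin.val_ofNat, Nat.add_mul_div_left _ _ hN, Nat.div_eq_of_lt x.1.isLt, zero_add,
      Nat.add_mul_mod_self_left, Nat.mod_eq_of_lt x.2.2.2.isLt]

/-- The outcomes of all calls, arranged by groups and samples. -/
def groupEquiv (m N : ℕ) (O : Type) : (Fin (m * 2 * 2 * N) → O) ≃
    (Fin N → (Fin m × Fin 2 → O) × (Fin m × Fin 2 → O)) :=
  ((callEquiv m N).symm.arrowCongr (Equiv.refl O)).trans ((Equiv.curry _ _ _).trans
    (Equiv.piCongrRight fun _ => (Equiv.curry _ _ _).trans (finTwoArrowEquiv _)))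

theorem groupEquiv_apply {m N : ℕ} {O : Type} (h : Fin (m * 2 * 2 * N) → O) (g : Fin N) :
    groupEquiv m N O h g
      = (fun x => h (callEquiv m N (g, 0, x)), fun x => h (callEquiv m N (g, 1, x))) := rfl

open scoped Kronecker in
theorem posSemidef_kronecker_one {n : Type} [Fintype n] {A : Op n} (hA : A.PosSemidef) :
    (A ⊗ₖ (1 : Op (Fin 1))).PosSemidef := hA.kronecker Matrix.PosSemidef.one

open scoped Kronecker in
/-- The non-adaptive estimator without ancilla: in each of `N` groups of calls, two random
orthogonal states are sent through the channel, the outputs are measured in a random basis, and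
the outcomes are compared by an unbiased estimator. -/
def incoherentEstimator (d m N : ℕ) [d.AtLeastTwo] [NeZero N] : IncoherentAlgorithm d where
  calls := m * 2 * 2 * N
  anc := 1
  Out := Option (Fin d)
  Seed := Fin N → U d × U d
  law := Measure.pi fun _ => groupLaw d
  input ω t _ := pureState (ω (Fin.ofNat N t)).1 (inputIndex d (Fin.ofNat 2 (t / N)))
    ⊗ₖ (1 : Op (Fin 1))
  input_pos _ _ _ := posSemidef_kronecker_one (pureState_posSemidef _ _)
  input_trace _ _ _ := by
    rw [Matrix.trace_kronecker, pureState_trace, Matrix.trace_one]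
    simp
  input_meas t _ p q := by
    refine Measurable.mul ?_ measurable_const
    exact ((continuous_pureState_apply _ p.1 q.1).measurable.comp measurable_fst).comp
      (measurable_pi_apply _)
  povm ω t _ v := basisEffect (ω (Fin.ofNat N t)).2 v ⊗ₖ (1 : Op (Fin 1))
  povm_pos _ _ _ _ := posSemidef_kronecker_one (basisEffect_posSemidef _ _)
  povm_sum ω t _ := by
    have h := sum_basisEffect (ω (Fin.ofNat N t)).2
    ext p q
    rw [Matrix.sum_apply]
    simp only [Matrix.kroneckerMap_apply]
    rw [← Finset.sum_mul, ← Matrix.sum_apply, h, ← Matrix.one_kronecker_one,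
      Matrix.kroneckerMap_apply]
  povm_meas t _ v p q := by
    refine Measurable.mul ?_ measurable_const
    exact ((continuous_basisEffect v p.1 q.1).measurable.comp measurable_snd).comp
      (measurable_pi_apply _)
  value _ h := (1 / N : ℝ) * ∑ g, pairStatistic (purityKernel d) (groupEquiv m N _ h g)
  value_meas _ := measurable_const

theorem incoherentEstimator_nonAdaptive (d m N : ℕ) [d.AtLeastTwo] [NeZero N] :
    (incoherentEstimator d m N).NonAdaptive := fun _ _ _ _ => ⟨rfl, rfl⟩

/-- The probability of the outcomes, arranged by groups, given the random unitaries. -/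
def groupsWeight {d m N : ℕ} [NeZero d] (E : Op (Fin d) →ₗ[ℂ] Op (Fin d)) (ω : Fin N → U d × U d)
    (k : Fin N → (Fin m × Fin 2 → Option (Fin d)) × (Fin m × Fin 2 → Option (Fin d))) : ℝ :=
  ∏ g, (sampleWeight (outcomeProb E (ω g)) (k g).1 * sampleWeight (outcomeProb E (ω g)) (k g).2)

theorem continuous_groupsWeight {d m N : ℕ} [NeZero d] (E : Op (Fin d) →ₗ[ℂ] Op (Fin d))
    (k : Fin N → (Fin m × Fin 2 → Option (Fin d)) × (Fin m × Fin 2 → Option (Fin d))) :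
    Continuous fun ω => groupsWeight E ω k := by
  have h : ∀ (g : Fin N) (c : Fin 2) (o : Option (Fin d)),
      Continuous fun ω : Fin N → U d × U d => outcomeProb E (ω g) c o := fun g c o =>
    (continuous_outcomeProb E c o).comp (continuous_apply g)
  unfold groupsWeight sampleWeight
  fun_prop

open scoped Kronecker in
theorem incoherentEstimator_prob {d m N : ℕ} [d.AtLeastTwo] [NeZero N]
    (E : Op (Fin d) →ₗ[ℂ] Op (Fin d)) (ω : Fin N → U d × U d)
    (h : Fin (m * 2 * 2 * N) → Option (Fin d)) :
    (incoherentEstimator d m N).prob E ω h = groupsWeight E ω (groupEquiv m N _ h) := by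
  have h1 : (incoherentEstimator d m N).prob E ω h = ∏ t : Fin (m * 2 * 2 * N),
      outcomeProb E (ω (Fin.ofNat N t)) (Fin.ofNat 2 (t / N)) (h t) := by
    refine Finset.prod_congr rfl fun t _ => ?_
    change ((basisEffect (ω (Fin.ofNat N t)).2 (h t) ⊗ₖ (1 : Op (Fin 1)))
      * amplify (Fin 1) (withFailure E) (pureState (ω (Fin.ofNat N t)).1
        (inputIndex d (Fin.ofNat 2 (t / N))) ⊗ₖ (1 : Op (Fin 1)))).trace.re = _
    rw [amplify_kronecker, ← Matrix.mul_kronecker_mul, Matrix.trace_kronecker, outcomeProb]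
    simp
  rw [h1, ← (callEquiv m N).prod_comp, Fintype.prod_prod_type]
  simp only [(ofNat_callEquiv _).1, (ofNat_callEquiv _).2, Fintype.prod_prod_type (γ := ℝ),
    Fin.prod_univ_two, groupsWeight, groupEquiv_apply, sampleWeight]

theorem incoherentEstimator_successProb {d m N : ℕ} [d.AtLeastTwo] [NeZero N]
    (E : Op (Fin d) →ₗ[ℂ] Op (Fin d)) (x ε : ℝ) :
    (incoherentEstimator d m N).successProb E x ε
      = ∫ ω : Fin N → U d × U d, ∑ k : Fin N →
          (Fin m × Fin 2 → Option (Fin d)) × (Fin m × Fin 2 → Option (Fin d)),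
        (if |(1 / N : ℝ) * ∑ g, pairStatistic (purityKernel d) (k g) - x| ≤ ε
          then groupsWeight E ω k else 0) ∂Measure.pi fun _ => groupLaw d := by
  refine integral_congr_ae (Filter.Eventually.of_forall fun ω => ?_)
  refine Eq.trans ?_ ((groupEquiv m N (Option (Fin d))).sum_comp _)
  refine Finset.sum_congr rfl fun h _ => ?_
  exact if_congr Iff.rfl (incoherentEstimator_prob E ω h) rfl

/-- The second moment of a sum of independent copies of a random variable, about its mean. -/
theorem integral_sum_sub_sq_le {S : Type*} [MeasurableSpace S] (μ : Measure S)
    [IsProbabilityMeasure μ] (N : ℕ) {z : S → ℝ} (hz : MemLp z 2 μ) :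
    ∫ ω : Fin N → S, (∑ g, z (ω g) - N * ∫ s, z s ∂μ) ^ 2 ∂Measure.pi (fun _ => μ)
      ≤ N * ∫ s, z s ^ 2 ∂μ := by
  have h1 := ProbabilityTheory.variance_sum_pi (μ := fun _ : Fin N => μ) (X := fun _ => z)
    fun _ => hz
  have hz1 : Integrable z μ := hz.integrable one_le_two
  have hint : ∀ g : Fin N, Integrable (fun ω : Fin N → S => z (ω g)) (Measure.pi fun _ => μ) :=
    fun g => (measurePreserving_eval (fun _ => μ) g).integrable_comp_of_integrable hz1
  have hmean : ∫ ω : Fin N → S, ∑ g, z (ω g) ∂Measure.pi (fun _ => μ) = N * ∫ s, z s ∂μ := by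
    rw [integral_finsetSum _ fun g _ => hint g]
    have : ∀ g : Fin N, ∫ ω : Fin N → S, z (ω g) ∂Measure.pi (fun _ => μ) = ∫ s, z s ∂μ :=
      fun g => integral_comp_eval (μ := fun _ : Fin N => μ) hz.aestronglyMeasurable
    simp [this]
  rw [ProbabilityTheory.variance_eq_integral (by
    exact (Finset.aemeasurable_sum _ fun g _ => (hint g).aemeasurable))] at h1
  simp only [Finset.sum_apply, hmean] at h1
  rw [h1, Finset.sum_const, Finset.card_univ, Fintype.card_fin, nsmul_eq_mul]
  exact mul_le_mul_of_nonneg_left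
    (ProbabilityTheory.variance_le_expectation_sq hz.aestronglyMeasurable) (Nat.cast_nonneg N)

/-- Chebyshev's inequality is applied for fixed random unitaries and then averaged over them. Both
the conditional variance and the fluctuation of the conditional mean are at most `866 * N`, and
`5196 = 3 * (2 * 866)`. -/
theorem incoherentEstimator_estimates {d m N : ℕ} [d.AtLeastTwo] [NeZero N] (hm0 : 0 < m)
    (hm : d ≤ m ^ 2) {ε : ℝ} (hε : 0 < ε) (hN : 5196 ≤ N * ε ^ 2) :
    (incoherentEstimator d m N).Estimates altUnitarity ε := by
  intro E hE
  have hN0 : (0 : ℝ) < N := Nat.cast_pos.mpr (Nat.pos_of_ne_zero (NeZero.ne N))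
  have hzc := continuous_groupMean E
  have hVc := continuous_groupVariance E
  set u := altUnitarity E with hu
  have hmean : ∫ s, groupMean E s ∂groupLaw d = u := integral_groupMean hE.isHermPres
  have hpoint : ∀ ω : Fin N → U d × U d, 1 - (1 / N : ℝ) ^ 2 * (∑ g, groupVariance E (ω g)
      + (∑ g, groupMean E (ω g) - N * u) ^ 2) / ε ^ 2 ≤ ∑ k : Fin N →
          (Fin m × Fin 2 → Option (Fin d)) × (Fin m × Fin 2 → Option (Fin d)),
        (if |(1 / N : ℝ) * ∑ g, pairStatistic (purityKernel d) (k g) - u| ≤ ε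
          then groupsWeight E ω k else 0) := by
    intro ω
    exact (MeanVariance.pi fun g => meanVariance_group hm0 hm hE (ω g)).chebyshev hε
      (by field_simp)
  have hVi : ∀ g : Fin N, Integrable (fun ω : Fin N → U d × U d => groupVariance E (ω g))
      (Measure.pi fun _ => groupLaw d) := fun g =>
    integrable_of_continuous _ (hVc.comp (continuous_apply g))
  have hVs : Integrable (fun ω : Fin N → U d × U d => ∑ g, groupVariance E (ω g))
      (Measure.pi fun _ => groupLaw d) := integrable_finsetSum _ fun g _ => hVi g
  have hzi : Integrable (fun ω : Fin N → U d × U d => (∑ g, groupMean E (ω g) - N * u) ^ 2)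
      (Measure.pi fun _ => groupLaw d) := by
    refine integrable_of_continuous _ ?_
    have : ∀ g : Fin N, Continuous fun ω : Fin N → U d × U d => groupMean E (ω g) :=
      fun g => hzc.comp (continuous_apply g)
    fun_prop
  have h1 := integral_mono ((integrable_const (1 : ℝ)).sub
    (((hVs.add hzi).const_mul ((1 / N : ℝ) ^ 2)).div_const (ε ^ 2)))
    (integrable_of_continuous _ (continuous_finsetSum _ fun k _ => by
      split_ifs
      · exact continuous_groupsWeight E k
      · exact continuous_const)) hpoint
  rw [incoherentEstimator_successProb]
  refine le_trans ?_ h1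
  rw [integral_sub' (integrable_const _) (((hVs.add hzi).const_mul _).div_const _), integral_const,
    probReal_univ, one_smul, integral_div, integral_const_mul, integral_add' hVs hzi,
    integral_finsetSum _ fun g _ => hVi g]
  have h2 : ∀ g : Fin N, ∫ ω : Fin N → U d × U d, groupVariance E (ω g)
      ∂(Measure.pi fun _ => groupLaw d) = ∫ s, groupVariance E s ∂groupLaw d := fun g =>
    integral_comp_eval (μ := fun _ : Fin N => groupLaw d)
      (integrable_of_continuous _ hVc).aestronglyMeasurable
  simp only [h2, Finset.sum_const, Finset.card_univ, Fintype.card_fin, nsmul_eq_mul]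
  have h3 := integral_groupVariance_le hE
  have h4 := integral_sum_sub_sq_le (groupLaw d) N (z := groupMean E)
    (hzc.memLp_of_hasCompactSupport (HasCompactSupport.of_compactSpace _))
  rw [hmean] at h4
  have h5 : ∫ s, groupMean E s ^ 2 ∂groupLaw d ≤ 866 :=
    (integral_mono (integrable_of_continuous _ (hzc.pow 2)) (integrable_of_continuous _ hVc)
      fun s => (groupVariance_bounds hm hE s).1).trans h3
  have h6 := mul_le_mul_of_nonneg_left h3 hN0.le
  have h7 := mul_le_mul_of_nonneg_left h5 hN0.le
  set X := N * ∫ s, groupVariance E s ∂groupLaw d + ∫ ω : Fin N → U d × U d,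
    (∑ g, groupMean E (ω g) - N * u) ^ 2 ∂Measure.pi (fun _ => groupLaw d) with hX
  have h8 : X ≤ N * 1732 := by linarith
  have h9 : (1 / (N : ℝ)) ^ 2 * X / ε ^ 2 ≤ 1 / 3 := by
    rw [div_pow, one_pow, one_div_mul_eq_div, div_div, div_le_iff₀ (by positivity)]
    nlinarith [mul_le_mul_of_nonneg_left hN hN0.le]
  linarith

theorem exists_incoherentAlgorithm (d : ℕ) [d.AtLeastTwo] (ε : ℝ) (h0 : 0 < ε) (h1 : ε ≤ 1) :
    ∃ A : IncoherentAlgorithm d, (A.calls : ℝ) ≤ 41576 * (√(d : ℝ) * ε⁻¹ ^ 2) ∧ A.anc = 1 ∧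
      A.NonAdaptive ∧ A.Estimates altUnitarity ε := by
  have hinv : 1 ≤ ε⁻¹ ^ 2 := one_le_pow₀ ((one_le_inv₀ h0).mpr h1)
  have hd1 : (1 : ℝ) ≤ d := by
    exact_mod_cast Nat.one_le_iff_ne_zero.mpr (NeZero.ne d)
  have hs1 : 1 ≤ √(d : ℝ) := by rwa [Real.one_le_sqrt]
  -- There are `4 * m * N` calls with `m ≤ 2 * √d` and `N ≤ 5197 * ε⁻¹ ^ 2`, and `41576 = 4 * 2 *
  -- 5197`.
  set N := ⌈5196 * ε⁻¹ ^ 2⌉₊ with hN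
  set m := ⌈√(d : ℝ)⌉₊ with hm
  have hN0 : 0 < N := Nat.ceil_pos.mpr (by positivity)
  have hm0 : 0 < m := Nat.ceil_pos.mpr (by positivity)
  have hN1 : 5196 * ε⁻¹ ^ 2 ≤ N := Nat.le_ceil _
  have hN2 : (N : ℝ) < 5196 * ε⁻¹ ^ 2 + 1 := Nat.ceil_lt_add_one (by positivity)
  have hm1 : √(d : ℝ) ≤ m := Nat.le_ceil _
  have hm2 : (m : ℝ) < √(d : ℝ) + 1 := Nat.ceil_lt_add_one (by positivity)
  have : NeZero N := ⟨hN0.ne'⟩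
  refine ⟨incoherentEstimator d m N, ?_, rfl, incoherentEstimator_nonAdaptive d m N,
    incoherentEstimator_estimates hm0 ?_ h0 ?_⟩
  · change ((m * 2 * 2 * N : ℕ) : ℝ) ≤ _
    push_cast
    have h2 : (m : ℝ) * N ≤ (2 * √(d : ℝ)) * (5197 * ε⁻¹ ^ 2) :=
      mul_le_mul (by linarith) (by linarith) (Nat.cast_nonneg N) (by positivity)
    linarith
  · have h2 := (Real.sqrt_le_left (Nat.cast_nonneg m)).mp hm1
    exact_mod_cast h2
  · have h2 := mul_le_mul_of_nonneg_right hN1 (sq_nonneg ε)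
    rwa [mul_assoc, ← mul_pow, inv_mul_cancel₀ h0.ne', one_pow, mul_one] at h2

end UnitarityEstimation

end

open UnitarityEstimation in
theorem mainTheorem11 :
    -- the identity for the alternative unitarity
    (∀ (d : ℕ) [d.AtLeastTwo] (E : Op (Fin d) →ₗ[ℂ] Op (Fin d)), IsChannel E →
      altUnitarity E = purityIndex E - orthogonalityIndex E - (d : ℝ) / (d - 1) * sIndex E
        + 1 / ((d : ℝ) - 1) * traceIndex E ^ 2) ∧
    -- upper bound, coherent access
    (∃ C : ℝ, 0 < C ∧ ∀ (d : ℕ) [d.AtLeastTwo] (ε : ℝ), 0 < ε → ε ≤ 1 →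
      ∃ A : CoherentAlgorithm d, (A.calls : ℝ) ≤ C * ε⁻¹ ^ 2 ∧ (A.anc : ℝ) ≤ C * d ∧
        A.Estimates altUnitarity ε) ∧
    -- upper bound, incoherent access, without adaptivity and without ancilla
    (∃ C : ℝ, 0 < C ∧ ∀ (d : ℕ) [d.AtLeastTwo] (ε : ℝ), 0 < ε → ε ≤ 1 →
      ∃ A : IncoherentAlgorithm d, (A.calls : ℝ) ≤ C * (√(d : ℝ) * ε⁻¹ ^ 2) ∧ A.anc = 1 ∧
        A.NonAdaptive ∧ A.Estimates altUnitarity ε) ∧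
    -- the two distinguishing problems reduce to the estimation problem
    (∀ (d : ℕ) [d.AtLeastTwo], altUnitarity (depolarizing d) = 0 ∧
      (∀ V : U d, altUnitarity (conjMap (V : Op (Fin d))) = 1) ∧
      ∀ ε : ℝ, 0 < ε → ε ≤ 1 / 3 →
        altUnitarity (shiftMixture d (2 / 3 + ε) (1 / 3 - ε))
            - altUnitarity (shiftMixture d (2 / 3) (1 / 3))
          = (d : ℝ) ^ 2 / ((d : ℝ) ^ 2 - 1) *
            (unitarity (shiftMixture d (2 / 3 + ε) (1 / 3 - ε))
              - unitarity (shiftMixture d (2 / 3) (1 / 3))) ∧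
        2 / 3 * ε ≤ altUnitarity (shiftMixture d (2 / 3 + ε) (1 / 3 - ε))
            - altUnitarity (shiftMixture d (2 / 3) (1 / 3))) ∧
    -- lower bound, coherent access
    (∃ c : ℝ, 0 < c ∧ ∀ (d : ℕ) [d.AtLeastTwo] (ε : ℝ), 0 < ε → ε < 1 / 2 →
      ∀ A : CoherentAlgorithm d, A.Estimates altUnitarity ε →
        c * ε⁻¹ ^ 2 ≤ (A.calls : ℝ)) ∧
    -- lower bound, incoherent access, also with adaptivity and ancilla
    (∃ c : ℝ, 0 < c ∧ ∀ (d : ℕ) [d.AtLeastTwo] (ε : ℝ), 0 < ε → ε < 1 / 2 →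
      ∀ A : IncoherentAlgorithm d, A.Estimates altUnitarity ε →
        c * (√(d : ℝ) + ε⁻¹ ^ 2) ≤ (A.calls : ℝ)) := by
  refine ⟨fun d _ E hE => altUnitarity_identity hE.isHermPres,
    ⟨36, by norm_num, exists_coherentAlgorithm⟩,
    ⟨41576, by norm_num, exists_incoherentAlgorithm⟩,
    fun d _ => ⟨altUnitarity_depolarizing d, altUnitarity_conjMap, fun ε h0 _ =>
      shiftMixture_gap d ε h0⟩,
    ⟨1 / 288, by norm_num, fun d _ ε h0 h1 A hA => CoherentAlgorithm.calls_lower_bound h0 h1 hA⟩,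
    ⟨1 / 576, by norm_num, fun d _ ε h0 h1 A hA =>
      IncoherentAlgorithm.calls_lower_bound h0 h1 hA⟩⟩
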